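/- All graphs are finite, simple, connected and have positive edge weights; $d_G$ is the shortest-path metric of $G$, and $K=\{t_1,\dots,t_k\}\subseteq V$ is a set of $k$ terminals. A terminal minor of $(G,K)$ is a minor in which every terminal $t_j$ survives as the vertex obtained by contracting a connected set containing $t_j$. **Preprocessing** ($k\ge 2$, $c_w=\frac1{2400}$). First replace $G$ by a connected, positively weighted terminal minor $H$ with the same distances between terminals and at most $2\binom k2^2$ Steiner (non-terminal) vertices. Then subdivide edges of $H$ (each edge is replaced by a path of the same total weight through new vertices of degree two), with at most $\frac{\ln k}{c_w}\binom k2$ new vertices in total, such that in the resulting graph $G'$ every two distinct terminals $t,t'$ are joined by a shortest path all of whose edges have weight at most $\frac{c_w}{\ln k}\,d_{G'}(t,t')$. Finally multiply all weights by a constant $c>0$ so that $\min_{v\notin K}\min_{j}d(v,t_j)=1$ (no condition on $c$ if there are no Steiner vertices). **Algorithm.** Run the following on the graph $G''=(V'',E'')$ so obtained, with $\delta=\frac1{20}$, $r=1+\frac{\delta}{\ln k}$, $D=\frac{\delta}{\ln k}$. Set $V_j=\{t_j\}$, $R_j=0$ for all $j$. In round $\ell=0,1,2,\dots$, as long as $\bigcup_jV_j\ne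 V''$ at the beginning of the round: for $j=1,\dots,k$ in this order, sample $q_j^\ell$ from the exponential distribution with mean $D\cdot r^\ell$ (all samples independent), set $R_j\leftarrow R_j+q_j^\ell$ and replace $V_j$ by the ball of radius $R_j$ around $t_j$ in the graph induced by $G''$ on $V_j\cup V_\perp$, where $V_\perp=V''\setminus\bigcup_iV_i$. At the end contract each $V_j$ to $t_j$; in the resulting minor $M$ on $K$, the terminals $t_i\neq t_j$ are adjacent iff some edge of $G''$ joins $V_i$ and $V_j$, and the edge $\{t_i,t_j\}$ gets weight $d_{G''}(t_i,t_j)$. Divide all weights of $M$ by $c$. **Theorem.** There is a universal constant $C>0$ such that for every graph $G$ with $k$ terminals: 1. If $k\ge2$, then for every outcome of the preprocessing, with probability at least $1-\frac Ck$ the algorithm halts and the (rescaled) graph $M$ it returns has positive edge weights, is a terminal minor of $G$, and satisfies $d_G(t,t')\le d_M(t,t')\le C\log k\cdot d_G(t,t')$ for all terminals $t,t'$. 2. If $k\ge2$, the preprocessing is possible, i.e. it has at least one outcome. 3. In particular, $G$ has a terminal minor $M$ with vertex set $K$ and positive edge weights such that $d_G(t,t')\le d_M(t,t')\le C\log k\cdot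 d_G(t,t')$ for all $t,t'\in K$. -/

import Mathlib

open scoped NNReal ENNReal

noncomputable section

namespace SPR

/-- A weighted undirected simple graph; only the weights of edges of `graph` matter. -/
structure WGraph (V : Type*) where
  graph : SimpleGraph V
  weight : Sym2 V → ℝ≥0

namespace WGraph

variable {V : Type*} (G : WGraph V)

/-- All edge weights are positive. -/
def Positive : Prop := ∀ e ∈ G.graph.edgeSet, 0 < G.weight e

/-- Total weight of a walk. -/
def len {u v : V} (p : G.graph.Walk u v) : ℝ≥0 := (p.edges.map G.weight).sum

/-- Shortest path distance in the induced subgraph `G[A]` (`⊤` if there is no connecting walk). -/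
def distOn (A : Set V) (u v : V) : ℝ≥0∞ :=
  ⨅ (p : G.graph.Walk u v) (_ : ∀ x ∈ p.support, x ∈ A), (G.len p : ℝ≥0∞)

/-- Shortest path distance in `G`. -/
def dist (u v : V) : ℝ≥0∞ := G.distOn Set.univ u v

theorem distOn_le_swap (A : Set V) (u v : V) : G.distOn A u v ≤ G.distOn A v u := by
  refine le_iInf₂ fun p hp => ?_
  refine (iInf₂_le p.reverse (by simpa using hp)).trans (le_of_eq ?_)
  simp [len, SimpleGraph.Walk.edges_reverse, List.sum_reverse]

theorem dist_comm (u v : V) : G.dist u v = G.dist v u :=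
  le_antisymm (G.distOn_le_swap _ u v) (G.distOn_le_swap _ v u)

/-- The ball of radius `R` around `u` in the induced subgraph `G[A]`. -/
def ballOn (A : Set V) (u : V) (R : ℝ) : Set V :=
  {v | G.distOn A u v ≤ ENNReal.ofReal R}

/-- Multiply all weights by `c`. -/
def scale (c : ℝ≥0) : WGraph V where
  graph := G.graph
  weight e := c * G.weight e

/-- Distance from `v` to the closest terminal. -/
def termDist {k : ℕ} (t : Fin k ↪ V) (v : V) : ℝ≥0∞ := ⨅ j, G.dist v (t j)

/-- The minimum of the distance to the terminals over all Steiner (non-terminal) vertices is `1`;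
no condition if there are no Steiner vertices. -/
def IsNormalized {k : ℕ} (t : Fin k ↪ V) : Prop :=
  (Set.range t)ᶜ.Nonempty → IsLeast (G.termDist t '' (Set.range t)ᶜ) 1

/-- The minor induced by clusters `U j` around the terminals `t j`: each cluster is contracted to
its terminal (named by its index), two terminals are adjacent iff some edge of `G` joins their
clusters, and the weight of that edge is the distance of the terminals in `G`. -/
def inducedMinor {k : ℕ} (t : Fin k ↪ V) (U : Fin k → Set V) : WGraph (Fin k) where
  graph :=
    { Adj := fun i j => i ≠ j ∧ ∃ u ∈ U i, ∃ v ∈ U j, G.graph.Adj u v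
      symm := ⟨fun _ _ h => by
        obtain ⟨hne, u, hu, v, hv, h⟩ := h
        exact ⟨hne.symm, v, hv, u, hu, h.symm⟩⟩
      loopless := ⟨fun _ h => h.1 rfl⟩ }
  weight := Sym2.lift ⟨fun i j => (G.dist (t i) (t j)).toNNReal,
    fun i j => congrArg ENNReal.toNNReal (G.dist_comm (t i) (t j))⟩

end WGraph

/-- `H` with terminals `s` is a minor of `G` with terminals `t`, each terminal of `H` being
the result of contracting a vertex set of `G` that contains the corresponding terminal of `G`.
(Weights play no role here.) -/
def IsTerminalMinor {W V : Type*} {k : ℕ} (H : WGraph W) (s : Fin k ↪ W)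
    (G : WGraph V) (t : Fin k ↪ V) : Prop :=
  ∃ B : W → Set V,
    (∀ x, (G.graph.induce (B x)).Connected) ∧
    (∀ x y, x ≠ y → Disjoint (B x) (B y)) ∧
    (∀ x y, H.graph.Adj x y → ∃ u ∈ B x, ∃ v ∈ B y, G.graph.Adj u v) ∧
    (∀ j, t j ∈ B (s j))

/-- `M`, a graph on the terminals, is a solution of the Steiner point removal problem for `G`
with terminals `t` and distortion `α`. -/
def IsSPRSolution {V : Type*} {k : ℕ} (G : WGraph V) (t : Fin k ↪ V) (M : WGraph (Fin k))
    (α : ℝ) : Prop :=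
  M.Positive ∧ IsTerminalMinor M (Function.Embedding.refl (Fin k)) G t ∧
  ∀ i j, G.dist (t i) (t j) ≤ M.dist i j ∧
    M.dist i j ≤ ENNReal.ofReal α * G.dist (t i) (t j)

/-- `G` arises from `H` by replacing every edge by a path of the same total weight, all of whose
inner vertices are new and of degree two; `ι` embeds the old vertices. -/
def IsSubdivision {W V : Type*} (H : WGraph W) (G : WGraph V) (ι : W ↪ V) : Prop :=
  ∃ P : ∀ x y, H.graph.Adj x y → G.graph.Walk (ι x) (ι y),
    (∀ x y h, (P x y h).IsPath) ∧
    (∀ x y h, G.len (P x y h) = H.weight s(x, y)) ∧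
    (∀ x y (h : H.graph.Adj x y), P y x h.symm = (P x y h).reverse) ∧
    (∀ x y h z, ι z ∈ (P x y h).support → z = x ∨ z = y) ∧
    (∀ x y h x' y' h' v, v ∉ Set.range ι → v ∈ (P x y h).support →
      v ∈ (P x' y' h').support → s(x, y) = s(x', y')) ∧
    (∀ v, v ∉ Set.range ι → ∃ x y h, v ∈ (P x y h).support) ∧
    (∀ e ∈ G.graph.edgeSet, ∃ x y h, e ∈ (P x y h).edges)

/-- The constant governing the lengths of the subdivided edges. -/
def cw : ℝ := 1 / 2400

/-- `(G', t')` is an outcome of the preprocessing of the instance `(G, t)`: first a terminal minor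
`H` of `G` is taken that has at most `2 * (k choose 2) ^ 2` Steiner vertices and the same distances
between terminals; then edges of `H` are subdivided, with at most `log k / cw` new vertices for
each of the `k choose 2` pairs of terminals, so that every pair of terminals is joined by a
shortest path whose edges all have weight at most `cw / log k` times the distance of the pair. -/
def IsPreprocessing {V V' : Type*} [Fintype V'] {k : ℕ} (G : WGraph V) (t : Fin k ↪ V)
    (G' : WGraph V') (t' : Fin k ↪ V') : Prop :=
  ∃ (m : ℕ) (H : WGraph (Fin m)) (s : Fin k ↪ Fin m) (ι : Fin m ↪ V'),
    H.Positive ∧ H.graph.Connected ∧ IsTerminalMinor H s G t ∧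
    (∀ i j, H.dist (s i) (s j) = G.dist (t i) (t j)) ∧
    m ≤ k + 2 * (k.choose 2) ^ 2 ∧
    G'.Positive ∧ IsSubdivision H G' ι ∧ (∀ j, t' j = ι (s j)) ∧
    (Fintype.card V' : ℝ) ≤ m + (k.choose 2 : ℝ) * (Real.log k / cw) ∧
    ∀ i j, i ≠ j → ∃ p : G'.graph.Walk (t' i) (t' j),
      (G'.len p : ℝ≥0∞) = G'.dist (t' i) (t' j) ∧
      ∀ e ∈ p.edges,
        (G'.weight e : ℝ≥0∞) ≤ ENNReal.ofReal (cw / Real.log k) * G'.dist (t' i) (t' j)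

/-! The ball growing algorithm. -/

def delta : ℝ := 1 / 20

/-- The growth rate `r` of the means, for `k` terminals. -/
def rate (k : ℕ) : ℝ := 1 + delta / Real.log k

/-- The mean `D` of the distribution used in round `0`, for `k` terminals. -/
def initMean (k : ℕ) : ℝ := delta / Real.log k

/-- Current radii and clusters. -/
structure State (V : Type*) (k : ℕ) where
  radius : Fin k → ℝ
  cluster : Fin k → Set V

variable {V : Type*} {k : ℕ}

namespace State

/-- The set of vertices that belong to no cluster. -/
def unclustered (S : State V k) : Set V := (⋃ j, S.cluster j)ᶜ

/-- The exit condition of the main loop: the clusters cover all vertices. -/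
def Done (S : State V k) : Prop := (⋃ j, S.cluster j) = Set.univ

/-- The initial state. -/
def init (t : Fin k ↪ V) : State V k where
  radius _ := 0
  cluster j := {t j}

/-- One step: terminal `j` increases its radius by `x` and recomputes its cluster. -/
def step (G : WGraph V) (t : Fin k ↪ V) (S : State V k) (j : Fin k) (x : ℝ) : State V k where
  radius := Function.update S.radius j (S.radius j + x)
  cluster := Function.update S.cluster j
    (G.ballOn (S.unclustered ∪ S.cluster j) (t j) (S.radius j + x))

/-- One round: the steps of all terminals, in increasing order, with increments `x j`. -/
def round (G : WGraph V) (t : Fin k ↪ V) (S : State V k) (x : Fin k → ℝ) : State V k :=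
  (List.finRange k).foldl (fun S j => S.step G t j (x j)) S

open Classical in
/-- The state after at most `n` iterations of the main loop, when the increment of terminal `j` in
round `ℓ` is `q ℓ j`; the state no longer changes once the exit condition holds. -/
def run (G : WGraph V) (t : Fin k ↪ V) (q : ℕ → Fin k → ℝ) : ℕ → State V k
  | 0 => init t
  | n + 1 => if (run G t q n).Done then run G t q n else (run G t q n).round G t (q n)

end State

/-- With the increments `q`, the algorithm halts on `(G, t)` and returns `M`. -/
def Returns (G : WGraph V) (t : Fin k ↪ V) (q : ℕ → Fin k → ℝ) (M : WGraph (Fin k)) : Prop :=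
  ∃ n, (State.run G t q n).Done ∧ M = G.inducedMinor t (State.run G t q n).cluster

end SPR

end

/-! Write L = log k, r = `rate k`, and D(v) for the distance of v to the nearest terminal; after the
normalisation, D(v) ≥ 1 for every Steiner vertex. The initial mean is r - 1, so the expected radius
after T rounds is r^T - 1. Chernoff bounds give three facts for each Steiner vertex v, each with
failure probability polynomially small in k. (a) v is clustered by the first T with r^T ≥ 80 D(v)
(`State.measure_mem_unclustered_le`). (b) All radii are then below 320 D(v). (c) At the first T with
4 r^T ≥ D(v), all radii are still below D(v) (both by `State.measure_le_radius_le`). So v is taken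
when the scale is about D(v), by a terminal at distance O(D(v)). For (a), the quantity followed is
the least growth that any terminal needs to absorb v. Steps of other terminals never increase it,
and in each round it drops by an exponential amount, by memorylessness.

For the distortion, take a shortest path of length d between two terminals and cut it into blocks of
length at most γ D, with D taken at the first vertex of the block and γ = 1/(3200 L). Its Steiner
vertices start out active. When a growing cluster meets active vertices, the interval from the first
to the last of them becomes inactive; it is replaced by a detour through the terminal, charged to
the active vertex v that is reached first. The maximal active runs inside a block are slices. Once
the ball has reached v, it grows by a further γ D with probability at least 19/20 and swallows the
slice of v; otherwise at most one additional slice arises. Hence exp(s (cost + 2 · slice weight)) is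
a supermartingale (`Route.lintegral_trackMoment_step_le`). The initial slice weight is at most d/γ,
so the total cost is O(L d) except with probability k^(-3) (`measure_cost_ge`). The two ends of a
detour interval lie in one cluster, so the cost bounds the distance in the minor
(`le_sum_of_detours`, `Route.inducedMinor_dist_le`). A union bound over the at most 3000 k^4
vertices and all pairs of terminals finishes the analysis (`exists_measure_failure_le`), and minors
and distances are carried back from the subdivision to G.

For the preprocessing, a perturbation of the weights makes shortest paths unique, so that two of
them meet in a common subpath. The terminals and the ends of these common subpaths are the vertices
of H, and the path segments between neighbouring ones are its edges (`skeleton`). Each pair of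
terminals then pays for cutting the edges on its own path.

The existence statement follows from positive success probability for large k; for small k the
Voronoi minor has distortion k, which is enough. -/

noncomputable section

namespace SPR

/-! ### Shortest path distances, balls and scaling. -/

namespace WGraph

variable {V : Type*} (G : WGraph V)

@[simp] theorem len_nil (u : V) : G.len (SimpleGraph.Walk.nil : G.graph.Walk u u) = 0 := by
  simp [len]

@[simp] theorem len_cons {u v w : V} (h : G.graph.Adj u v) (p : G.graph.Walk v w) :
    G.len (SimpleGraph.Walk.cons h p) = G.weight s(u, v) + G.len p := by
  simp [len]

@[simp] theorem len_append {u v w : V} (p : G.graph.Walk u v) (q : G.graph.Walk v w) :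
    G.len (p.append q) = G.len p + G.len q := by
  simp [len, SimpleGraph.Walk.edges_append]

theorem len_bypass_le [DecidableEq V] {u v : V} (p : G.graph.Walk u v) :
    G.len p.bypass ≤ G.len p :=
  (p.edges_bypass_sublist_edges.map G.weight).sum_le_sum (fun _ _ => zero_le)

variable {G}

theorem distOn_le_len {A : Set V} {u v : V} (p : G.graph.Walk u v) (hp : ∀ x ∈ p.support, x ∈ A) :
    G.distOn A u v ≤ G.len p :=
  iInf₂_le p hp

theorem dist_le_len {u v : V} (p : G.graph.Walk u v) : G.dist u v ≤ G.len p :=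
  distOn_le_len p (by simp)

theorem distOn_anti {A B : Set V} (h : A ⊆ B) (u v : V) : G.distOn B u v ≤ G.distOn A u v :=
  le_iInf₂ fun p hp => distOn_le_len p fun x hx => h (hp x hx)

theorem dist_le_distOn (A : Set V) (u v : V) : G.dist u v ≤ G.distOn A u v :=
  distOn_anti (Set.subset_univ A) u v

theorem distOn_comm (A : Set V) (u v : V) : G.distOn A u v = G.distOn A v u :=
  le_antisymm (G.distOn_le_swap _ u v) (G.distOn_le_swap _ v u)

theorem distOn_self {A : Set V} {u : V} (h : u ∈ A) : G.distOn A u u = 0 := by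
  refine le_antisymm ?_ zero_le
  simpa using distOn_le_len (G := G) (SimpleGraph.Walk.nil : G.graph.Walk u u) (A := A)
    (by simpa using h)

@[simp] theorem dist_self (u : V) : G.dist u u = 0 := distOn_self (Set.mem_univ u)

theorem distOn_triangle (A : Set V) (u v w : V) :
    G.distOn A u w ≤ G.distOn A u v + G.distOn A v w := by
  refine ENNReal.le_iInf₂_add_iInf₂ fun p hp q hq => ?_
  refine (distOn_le_len (p.append q) ?_).trans (by simp)
  intro x hx
  rw [SimpleGraph.Walk.mem_support_append_iff] at hx
  exact hx.elim (hp x) (hq x)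

theorem dist_triangle (u v w : V) : G.dist u w ≤ G.dist u v + G.dist v w :=
  distOn_triangle _ u v w

/-- Loop erasure makes no walk longer and does not leave `A`, so the infimum is taken over finitely
many paths. -/
theorem exists_isPath_len_eq [Finite V] {A : Set V} {u v : V} (h : G.distOn A u v ≠ ⊤) :
    ∃ p : G.graph.Walk u v, p.IsPath ∧ (∀ x ∈ p.support, x ∈ A) ∧
      (G.len p : ℝ≥0∞) = G.distOn A u v := by
  classical
  have := Fintype.ofFinite V
  let S : Set (G.graph.Path u v) := {p | ∀ x ∈ p.1.support, x ∈ A}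
  have hS : S.Nonempty := by
    by_contra hS
    refine h (iInf₂_eq_top.2 fun p hp => (hS ?_).elim)
    exact ⟨⟨p.bypass, p.bypass_isPath⟩, fun x hx => hp x (p.support_bypass_subset_support hx)⟩
  obtain ⟨p, hpS, hp⟩ := S.toFinite.exists_minimalFor (fun p => G.len p.1) S hS
  refine ⟨p.1, p.2, hpS, le_antisymm (le_iInf₂ fun q hq => ?_) (distOn_le_len _ hpS)⟩
  have hqS : (⟨q.bypass, q.bypass_isPath⟩ : G.graph.Path u v) ∈ S :=
    fun x hx => hq x (q.support_bypass_subset_support hx)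
  have hle : G.len p.1 ≤ G.len q.bypass := by
    rcases le_total (G.len p.1) (G.len q.bypass) with h1 | h1
    · exact h1
    · exact hp hqS h1
  exact_mod_cast hle.trans (G.len_bypass_le q)

theorem exists_isPath_len_eq_dist [Finite V] {u v : V} (h : G.dist u v ≠ ⊤) :
    ∃ p : G.graph.Walk u v, p.IsPath ∧ (G.len p : ℝ≥0∞) = G.dist u v := by
  obtain ⟨p, h1, -, h2⟩ := exists_isPath_len_eq h
  exact ⟨p, h1, h2⟩

theorem dist_ne_top (hG : G.graph.Connected) (u v : V) : G.dist u v ≠ ⊤ := by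
  obtain ⟨p⟩ := hG.preconnected u v
  exact ne_top_of_le_ne_top ENNReal.coe_ne_top (dist_le_len p)

theorem len_pos (hG : G.Positive) {u v : V} (h : u ≠ v) (p : G.graph.Walk u v) : 0 < G.len p := by
  cases p with
  | nil => exact (h rfl).elim
  | cons hadj p =>
    rw [len_cons]
    exact add_pos_of_pos_of_nonneg (hG _ hadj) zero_le

theorem distOn_pos [Finite V] (hG : G.Positive) (A : Set V) {u v : V} (h : u ≠ v) :
    0 < G.distOn A u v := by
  by_cases ht : G.distOn A u v = ⊤
  · simp [ht]
  obtain ⟨p, -, -, hp⟩ := exists_isPath_len_eq ht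
  rw [← hp]
  exact_mod_cast len_pos hG h p

theorem dist_pos [Finite V] (hG : G.Positive) {u v : V} (h : u ≠ v) : 0 < G.dist u v :=
  distOn_pos hG _ h

theorem mem_of_distOn_ne_top {A : Set V} {u v : V} (h : G.distOn A u v ≠ ⊤) : u ∈ A ∧ v ∈ A := by
  by_contra hc
  refine h (iInf₂_eq_top.2 fun p hp => (hc ?_).elim)
  exact ⟨hp _ p.start_mem_support, hp _ p.end_mem_support⟩

/-- A shorter prefix would shorten the whole walk; the length of `q` is finite and cancels. -/
theorem distOn_eq_of_split {A : Set V} {u v w : V} {p : G.graph.Walk u w}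
    {q : G.graph.Walk w v} (hA : ∀ x ∈ (p.append q).support, x ∈ A)
    (h : (G.len (p.append q) : ℝ≥0∞) = G.distOn A u v) : (G.len p : ℝ≥0∞) = G.distOn A u w := by
  have hp : ∀ x ∈ p.support, x ∈ A := fun x hx => hA x (by
    rw [SimpleGraph.Walk.mem_support_append_iff]; exact Or.inl hx)
  have hq : ∀ x ∈ q.support, x ∈ A := fun x hx => hA x (by
    rw [SimpleGraph.Walk.mem_support_append_iff]; exact Or.inr hx)
  refine le_antisymm ?_ (distOn_le_len p hp)
  have h1 := distOn_triangle (G := G) A u w v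
  rw [← h, len_append, ENNReal.coe_add] at h1
  have h2 := h1.trans (add_le_add_right (distOn_le_len q hq) _)
  exact (ENNReal.add_le_add_iff_right ENNReal.coe_ne_top).1 h2

/-- The ball of radius `R` is connected from its centre through shortest paths. -/
theorem distOn_ballOn_le [Finite V] {A : Set V} {u v : V} {R : ℝ} (h : v ∈ G.ballOn A u R) :
    G.distOn (G.ballOn A u R) u v ≤ ENNReal.ofReal R := by
  have h' : G.distOn A u v ≤ ENNReal.ofReal R := h
  obtain ⟨p, -, hpA, hp⟩ := exists_isPath_len_eq (ne_top_of_le_ne_top ENNReal.ofReal_ne_top h')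
  refine (distOn_le_len p fun x hx => ?_).trans (hp.le.trans h')
  obtain ⟨q, r, rfl⟩ := SimpleGraph.Walk.mem_support_iff_exists_append.1 hx
  change G.distOn A u x ≤ _
  rw [← distOn_eq_of_split hpA hp]
  rw [len_append] at hp
  refine le_trans ?_ (hp.le.trans h')
  exact_mod_cast le_self_add

theorem ballOn_subset {A : Set V} {u : V} {R : ℝ} : G.ballOn A u R ⊆ A := fun v hv =>
  (mem_of_distOn_ne_top (ne_top_of_le_ne_top ENNReal.ofReal_ne_top
    (show G.distOn A u v ≤ ENNReal.ofReal R from hv))).2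

/-! Scaling. -/

theorem len_scale (c : ℝ≥0) {u v : V} (p : G.graph.Walk u v) :
    (G.scale c).len p = c * G.len p := by
  simp only [len, scale, ← List.sum_map_mul_left]

theorem dist_scale (c : ℝ≥0) (hc : c ≠ 0) (u v : V) : (G.scale c).dist u v = c * G.dist u v := by
  have h0 : (c : ℝ≥0∞) ≠ 0 := by exact_mod_cast hc
  simp only [dist, distOn, ENNReal.mul_iInf_of_ne h0 ENNReal.coe_ne_top]
  refine iInf_congr fun p => iInf_congr fun hp => ?_
  exact (congrArg ENNReal.ofNNReal (len_scale (G := G) c p)).trans (ENNReal.coe_mul _ _)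

theorem Positive.scale (hG : G.Positive) {c : ℝ≥0} (hc : 0 < c) : (G.scale c).Positive :=
  fun e he => mul_pos hc (hG e he)

theorem termDist_scale {k : ℕ} (t : Fin k ↪ V) (c : ℝ≥0) (hc : c ≠ 0) (v : V) :
    (G.scale c).termDist t v = c * G.termDist t v := by
  have h0 : (c : ℝ≥0∞) ≠ 0 := by exact_mod_cast hc
  simp only [termDist, ENNReal.mul_iInf_of_ne h0 ENNReal.coe_ne_top, dist_scale c hc]

theorem termDist_le {k : ℕ} (t : Fin k ↪ V) (v : V) (j : Fin k) : G.termDist t v ≤ G.dist v (t j) :=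
  iInf_le _ j

theorem termDist_term {k : ℕ} (t : Fin k ↪ V) (j : Fin k) : G.termDist t (t j) = 0 :=
  le_antisymm ((termDist_le t _ j).trans (by simp)) zero_le

theorem termDist_le_add {k : ℕ} (t : Fin k ↪ V) (u v : V) :
    G.termDist t u ≤ G.dist u v + G.termDist t v := by
  rw [termDist, termDist, ENNReal.add_iInf]
  exact le_iInf fun j => (iInf_le _ j).trans (dist_triangle _ _ _)

theorem exists_termDist_eq {k : ℕ} [NeZero k] (t : Fin k ↪ V) (v : V) :
    ∃ j, G.termDist t v = G.dist v (t j) := by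
  obtain ⟨j, hj⟩ := exists_eq_ciInf_of_finite (f := fun j => G.dist v (t j))
  exact ⟨j, hj.symm⟩

end WGraph

end SPR

end

noncomputable section

namespace SPR

open MeasureTheory ProbabilityTheory

/-! Sequences of states driven by independent increments. -/

/-- The state after `n` steps with transition maps `F` and inputs `x`, starting from `s`. -/
def seqRun {S X : Type*} (F : ℕ → S → X → S) (s : S) (x : ℕ → X) : ℕ → S
  | 0 => s
  | n + 1 => F n (seqRun F s x n) (x n)

theorem seqRun_congr {S X : Type*} (F : ℕ → S → X → S) (s : S) {x y : ℕ → X} {n : ℕ}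
    (h : ∀ i < n, x i = y i) : seqRun F s x n = seqRun F s y n := by
  induction n with
  | zero => rfl
  | succ n ih =>
    simp only [seqRun, ih fun i hi => h i (hi.trans n.lt_succ_self), h n n.lt_succ_self]

theorem seqRun_invariant {S : Type*} {F : ℕ → S → ℝ → S} {s : S} {Inv : S → Prop} (h0 : Inv s)
    (hInv : ∀ n s x, Inv s → 0 ≤ x → Inv (F n s x)) {x : ℕ → ℝ} (hx : ∀ n, 0 ≤ x n) (n : ℕ) :
    Inv (seqRun F s x n) := by
  induction n with
  | zero => exact h0
  | succ n ih => exact hInv _ _ _ ih (hx n)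

section

variable {S X : Type*} [MeasurableSpace S] [MeasurableSpace X] {F : ℕ → S → X → S}

theorem measurable_seqRun (hF : ∀ n, Measurable fun z : S × X => F n z.1 z.2) (s : S) (n : ℕ) :
    Measurable fun x : ℕ → X => seqRun F s x n := by
  induction n with
  | zero => exact measurable_const
  | succ n ih => exact (hF n).comp (ih.prodMk (measurable_pi_apply n))

/-- The state before step `n` is a measurable function of the inputs with index below `n` alone. -/
theorem indepFun_seqRun {Ω : Type*} [MeasurableSpace Ω] {P : Measure Ω} [Nonempty X]
    {Y : ℕ → Ω → X} (hY : ∀ n, Measurable (Y n)) (hind : iIndepFun Y P)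
    (hF : ∀ n, Measurable fun z : S × X => F n z.1 z.2) (s : S) (n : ℕ) :
    IndepFun (fun ω => seqRun F s (fun i => Y i ω) n) (Y n) P := by
  classical
  have x0 : X := Classical.arbitrary X
  -- The inputs from `n` on get a default value, which the first `n` steps do not read.
  let ext : (Finset.range n → X) → ℕ → X := fun y i =>
    if h : i ∈ Finset.range n then y ⟨i, h⟩ else x0
  have hext : Measurable ext := by
    refine measurable_pi_lambda _ fun i => ?_
    by_cases h : i ∈ Finset.range n
    · simp only [ext, h, dif_pos]
      exact measurable_pi_apply _
    · simp only [ext, h, dif_neg, not_false_eq_true]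
      exact measurable_const
  have h1 := hind.indepFun_finset (Finset.range n) {n} (by simp) hY
  have h2 := h1.comp ((measurable_seqRun hF s n).comp hext)
    (measurable_pi_apply (⟨n, by simp⟩ : ({n} : Finset ℕ)))
  have h3 : (fun ω => seqRun F s (fun i => Y i ω) n) =
      ((fun x => seqRun F s x n) ∘ ext) ∘ fun a (i : Finset.range n) => Y i a := by
    funext ω
    refine seqRun_congr F s fun i hi => ?_
    simp [ext, hi]
  rw [h3]
  exact h2

end

/-- The supermartingale principle behind all probability estimates: `W n` is a potential. Since the
state is independent of the next input, Tonelli reduces the expected change to the one-step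
inequality at a frozen state, which is needed only for states with the invariant. -/
theorem lintegral_seqRun_le {Ω S : Type*} [MeasurableSpace Ω] [MeasurableSpace S] {P : Measure Ω}
    [IsProbabilityMeasure P] {Y : ℕ → Ω → ℝ} (hY : ∀ n, Measurable (Y n)) (hind : iIndepFun Y P)
    (hnn : ∀ n, ∀ᵐ ω ∂P, 0 ≤ Y n ω) {F : ℕ → S → ℝ → S}
    (hF : ∀ n, Measurable fun z : S × ℝ => F n z.1 z.2) {s : S} {Inv : S → Prop} (h0 : Inv s)
    (hInv : ∀ n s x, Inv s → 0 ≤ x → Inv (F n s x)) {W : ℕ → S → ℝ≥0∞}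
    (hW : ∀ n, Measurable (W n)) {N : ℕ}
    (hstep : ∀ n < N, ∀ s, Inv s → ∫⁻ x, W (n + 1) (F n s x) ∂(P.map (Y n)) ≤ W n s) :
    ∫⁻ ω, W N (seqRun F s (fun n => Y n ω) N) ∂P ≤ W 0 s := by
  have hinv : ∀ᵐ ω ∂P, ∀ n, Inv (seqRun F s (fun n => Y n ω) n) := by
    filter_upwards [ae_all_iff.2 hnn] with ω hω n
    exact seqRun_invariant h0 hInv hω n
  have key : ∀ n ≤ N, ∫⁻ ω, W n (seqRun F s (fun n => Y n ω) n) ∂P ≤ W 0 s := by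
    intro n
    induction n with
    | zero => intro _; simp [seqRun]
    | succ n ih =>
      intro hn
      refine le_trans ?_ (ih (by omega))
      have hS : Measurable fun ω => seqRun F s (fun i => Y i ω) n :=
        (measurable_seqRun hF s n).comp (measurable_pi_lambda _ hY)
      have hG : Measurable fun z : S × ℝ => W (n + 1) (F n z.1 z.2) := (hW (n + 1)).comp (hF n)
      have hpair := (indepFun_iff_map_prod_eq_prod_map_map hS.aemeasurable (hY n).aemeasurable).1
        (indepFun_seqRun hY hind hF s n)
      have : IsProbabilityMeasure (P.map (Y n)) :=
        Measure.isProbabilityMeasure_map (hY n).aemeasurable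
      calc ∫⁻ ω, W (n + 1) (seqRun F s (fun n => Y n ω) (n + 1)) ∂P
          = ∫⁻ z, W (n + 1) (F n z.1 z.2) ∂(P.map fun ω =>
              (seqRun F s (fun i => Y i ω) n, Y n ω)) :=
            (lintegral_map hG (hS.prodMk (hY n))).symm
        _ = ∫⁻ y, ∫⁻ x, W (n + 1) (F n y x) ∂(P.map (Y n))
              ∂(P.map fun ω => seqRun F s (fun i => Y i ω) n) := by
            rw [hpair, lintegral_prod _ hG.aemeasurable]
        _ = ∫⁻ ω, ∫⁻ x, W (n + 1) (F n (seqRun F s (fun i => Y i ω) n) x) ∂(P.map (Y n)) ∂P :=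
            lintegral_map hG.lintegral_prod_right' hS
        _ ≤ _ := by
            refine lintegral_mono_ae ?_
            filter_upwards [hinv] with ω hω
            exact hstep n (by omega) _ (hω n)
  exact key N le_rfl

/-! Integrals with respect to exponential distributions. -/

theorem lintegral_expMeasure {r : ℝ} (f : ℝ → ℝ≥0∞) :
    ∫⁻ x, f x ∂(expMeasure r) = ∫⁻ x in Set.Ioi 0, ENNReal.ofReal (r * Real.exp (-(r * x))) * f x := by
  have h1 : expMeasure r = volume.withDensity (exponentialPDF r) := rfl
  have hm : Measurable (exponentialPDF r) := (measurable_exponentialPDFReal r).ennreal_ofReal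
  rw [h1, lintegral_withDensity_eq_lintegral_mul_non_measurable _ hm
    (Filter.Eventually.of_forall fun x => ENNReal.ofReal_lt_top),
    ← lintegral_add_compl _ (measurableSet_Ici (a := (0:ℝ)))]
  have h2 : ∫⁻ x in (Set.Ici (0:ℝ))ᶜ, (exponentialPDF r * f) x = 0 := by
    rw [setLIntegral_congr_fun (g := fun _ => 0) measurableSet_Ici.compl]
    · simp
    · intro x hx
      simp only [Set.mem_compl_iff, Set.mem_Ici, not_le] at hx
      simp [exponentialPDF_of_neg hx]
  rw [h2, add_zero, setLIntegral_congr (Ioi_ae_eq_Ici (a := (0:ℝ))).symm]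
  refine setLIntegral_congr_fun measurableSet_Ioi fun x hx => ?_
  simp only [Pi.mul_apply]
  rw [exponentialPDF_of_nonneg (le_of_lt hx)]

theorem setLIntegral_exp_expMeasure {r c a : ℝ} (hr : 0 < r) (hc : c < r) (ha : 0 ≤ a) :
    ∫⁻ x in Set.Ici a, ENNReal.ofReal (Real.exp (c * x)) ∂(expMeasure r) =
      ENNReal.ofReal (r / (r - c) * Real.exp (-((r - c) * a))) := by
  rw [← lintegral_indicator measurableSet_Ici, lintegral_expMeasure]
  have h1 : ∀ x ∈ Set.Ioi (0:ℝ), ENNReal.ofReal (r * Real.exp (-(r * x))) *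
      (Set.Ici a).indicator (fun x => ENNReal.ofReal (Real.exp (c * x))) x =
      (Set.Ici a).indicator (fun x => ENNReal.ofReal (r * Real.exp ((c - r) * x))) x := by
    intro x _
    by_cases hx : x ∈ Set.Ici a
    · simp only [hx, Set.indicator_of_mem]
      rw [← ENNReal.ofReal_mul (by positivity), mul_assoc, ← Real.exp_add]
      congr 3; ring
    · simp [hx]
  rw [setLIntegral_congr_fun measurableSet_Ioi h1, setLIntegral_indicator measurableSet_Ici]
  have h2 : (Set.Ici a ∩ Set.Ioi 0 : Set ℝ) =ᵐ[volume] Set.Ioi a := by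
    rcases ha.eq_or_lt with rfl | ha
    · exact Filter.EventuallyEq.of_eq (Set.inter_eq_right.2 Set.Ioi_subset_Ici_self)
    · exact (Filter.EventuallyEq.of_eq (Set.inter_eq_left.2 fun x hx => lt_of_lt_of_le ha hx)).trans
        Ioi_ae_eq_Ici.symm
  have hint := integrableOn_exp_mul_Ioi (a := c - r) (by linarith) a
  rw [setLIntegral_congr h2, ← ofReal_integral_eq_lintegral_ofReal (hint.const_mul r)
    (Filter.Eventually.of_forall fun x => by positivity)]
  rw [integral_const_mul, integral_exp_mul_Ioi (by linarith)]
  congr 1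
  have : r - c ≠ 0 := by linarith
  have h' : c - r ≠ 0 := by linarith
  rw [show (c - r) * a = -((r - c) * a) by ring]
  field_simp
  ring

theorem expMeasure_Ici {r a : ℝ} (hr : 0 < r) (ha : 0 ≤ a) :
    expMeasure r (Set.Ici a) = ENNReal.ofReal (Real.exp (-(r * a))) := by
  have h := setLIntegral_exp_expMeasure hr hr ha
  simpa [hr.ne'] using h

theorem ae_nonneg_expMeasure {r : ℝ} (hr : 0 < r) : ∀ᵐ x ∂(expMeasure r), 0 ≤ x := by
  have := isProbabilityMeasure_expMeasure hr
  have h := expMeasure_Ici hr (le_refl (0:ℝ))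
  simp only [mul_zero, neg_zero, Real.exp_zero, ENNReal.ofReal_one] at h
  exact (prob_compl_eq_zero_iff measurableSet_Ici).2 h

theorem lintegral_exp_expMeasure {r c : ℝ} (hr : 0 < r) (hc : c < r) :
    ∫⁻ x, ENNReal.ofReal (Real.exp (c * x)) ∂(expMeasure r) = ENNReal.ofReal (r / (r - c)) := by
  have h := setLIntegral_exp_expMeasure hr hc (le_refl 0)
  rw [setLIntegral_congr (t := Set.univ)] at h
  · simpa using h
  · exact Filter.eventuallyEq_univ.2 (ae_nonneg_expMeasure hr)

/-- A function that drops by an exponential factor from `θ` on is integrated at most as if it did so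
from `0` on. -/
theorem lintegral_expMeasure_le_of_excess {r s θ b : ℝ} (hr : 0 < r) (hs : 0 ≤ s) (hθ : 0 ≤ θ)
    (hb : 0 ≤ b) {f : ℝ → ℝ≥0∞} (h1 : ∀ x, 0 ≤ x → x < θ → f x ≤ ENNReal.ofReal (b * (r / (r + s))))
    (h2 : ∀ x, θ ≤ x → f x ≤ ENNReal.ofReal (b * Real.exp (-(s * (x - θ))))) :
    ∫⁻ x, f x ∂(expMeasure r) ≤ ENNReal.ofReal (b * (r / (r + s))) := by
  have := isProbabilityMeasure_expMeasure hr
  have hT := expMeasure_Ici hr hθ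
  set T := Real.exp (-(r * θ)) with hTdef
  have hT0 : 0 < T := Real.exp_pos _
  have hT1 : T ≤ 1 := Real.exp_le_one_iff.2 (by nlinarith)
  have hTc : expMeasure r (Set.Ici θ)ᶜ = ENNReal.ofReal (1 - T) := by
    rw [prob_compl_eq_one_sub measurableSet_Ici, hT, ENNReal.ofReal_sub _ hT0.le,
      ENNReal.ofReal_one]
  rw [← lintegral_add_compl _ (measurableSet_Ici (a := θ))]
  -- Memorylessness: given `x ≥ θ`, the excess is exponential again and integrates `b e^(-s·)` to `b
  -- r / (r + s)`. This equals the bound assumed before `θ`, so the weights `T` and `1 - T`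
  -- recombine.
  have e1 : ∫⁻ x in Set.Ici θ, f x ∂(expMeasure r) ≤ ENNReal.ofReal (T * (b * (r / (r + s)))) := by
    calc ∫⁻ x in Set.Ici θ, f x ∂(expMeasure r)
        ≤ ∫⁻ x in Set.Ici θ, ENNReal.ofReal (b * Real.exp (s * θ)) *
            ENNReal.ofReal (Real.exp (-s * x)) ∂(expMeasure r) := by
          refine setLIntegral_mono' measurableSet_Ici fun x hx => (h2 x hx).trans (le_of_eq ?_)
          rw [← ENNReal.ofReal_mul (by positivity), mul_assoc, ← Real.exp_add]
          congr 3; ring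
      _ = _ := by
          rw [lintegral_const_mul _ (by fun_prop), setLIntegral_exp_expMeasure hr (by linarith) hθ,
            ← ENNReal.ofReal_mul (by positivity)]
          congr 1
          rw [show r - -s = r + s by ring, hTdef,
            show -((r + s) * θ) = -(r * θ) + -(s * θ) by ring, Real.exp_add, Real.exp_neg (s * θ)]
          field_simp
  have e2 : ∫⁻ x in (Set.Ici θ)ᶜ, f x ∂(expMeasure r) ≤
      ENNReal.ofReal ((1 - T) * (b * (r / (r + s)))) := by
    calc ∫⁻ x in (Set.Ici θ)ᶜ, f x ∂(expMeasure r)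
        ≤ ∫⁻ x in (Set.Ici θ)ᶜ, ENNReal.ofReal (b * (r / (r + s))) ∂(expMeasure r) := by
          refine setLIntegral_mono_ae' measurableSet_Ici.compl ?_
          filter_upwards [ae_nonneg_expMeasure hr] with x hx0 hx
          exact h1 x hx0 (by simpa using hx)
      _ = _ := by
          rw [setLIntegral_const, hTc, mul_comm, ← ENNReal.ofReal_mul (by linarith)]
  refine (add_le_add e1 e2).trans (le_of_eq ?_)
  rw [← ENNReal.ofReal_add (by positivity) (mul_nonneg (by linarith) (by positivity))]
  congr 1; ring

/-- A chord of `exp` on `[0, 1]` gives `e^(3y) ≤ 1 + 9y`, and `e^(-y) ≤ 1 - y/2`. The loss is at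
most `9y/20` and the gain at least `19y/40`. -/
theorem exp_coin_bound {y E : ℝ} (hy0 : 0 ≤ y) (hy : y ≤ 1 / 3) (hE : 19 / 20 ≤ E) (hE1 : E ≤ 1) :
    (1 - E) * Real.exp (3 * y) + E * Real.exp (-y) ≤ 1 := by
  have h1 : Real.exp (3 * y) ≤ 1 + 9 * y := by
    have hc := convexOn_exp.2 (Set.mem_univ (0:ℝ)) (Set.mem_univ (1:ℝ))
      (show 0 ≤ 1 - 3 * y by linarith) (show 0 ≤ 3 * y by linarith) (by ring)
    have he := Real.exp_one_lt_d9
    simp only [smul_eq_mul, mul_zero, zero_add, mul_one, Real.exp_zero] at hc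
    nlinarith
  have h2 : Real.exp (-y) ≤ 1 - y / 2 := by
    have h3 : 1 + y ≤ Real.exp y := by linarith [Real.add_one_le_exp y]
    rw [Real.exp_neg, inv_le_iff_one_le_mul₀ (Real.exp_pos _)]
    nlinarith
  nlinarith

/-- A function that grows by `e ^ (3 y)` on a short interval from `θ` on and drops by `e ^ (-y)` after
it has an integral that is at most its value before `θ`. -/
theorem lintegral_expMeasure_le_of_coin {r θ L y b : ℝ} (hr : 0 < r) (hθ : 0 ≤ θ) (hL : 0 ≤ L)
    (hrL : r * L ≤ 1 / 20) (hy0 : 0 ≤ y) (hy : y ≤ 1 / 3) (hb : 0 ≤ b) {f : ℝ → ℝ≥0∞}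
    (h1 : ∀ x, 0 ≤ x → x < θ → f x ≤ ENNReal.ofReal b)
    (h2 : ∀ x, θ ≤ x → f x ≤ ENNReal.ofReal (b * Real.exp (3 * y)))
    (h3 : ∀ x, θ + L ≤ x → f x ≤ ENNReal.ofReal (b * Real.exp (-y))) :
    ∫⁻ x, f x ∂(expMeasure r) ≤ ENNReal.ofReal b := by
  have := isProbabilityMeasure_expMeasure hr
  have hT := expMeasure_Ici hr hθ
  have hTL := expMeasure_Ici hr (add_nonneg hθ hL)
  rw [mul_add, neg_add, Real.exp_add] at hTL
  set T := Real.exp (-(r * θ)) with hTdef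
  set E := Real.exp (-(r * L)) with hEdef
  have hT0 : 0 < T := Real.exp_pos _
  have hT1 : T ≤ 1 := Real.exp_le_one_iff.2 (by nlinarith)
  have hE1 : E ≤ 1 := Real.exp_le_one_iff.2 (by nlinarith)
  -- The coin: given that the increment reaches `θ`, it also reaches `θ + L` with probability `E`.
  have hE0 : 19 / 20 ≤ E := by linarith [Real.add_one_le_exp (-(r * L))]
  have hm1 : expMeasure r (Set.Ici θ)ᶜ = ENNReal.ofReal (1 - T) := by
    rw [prob_compl_eq_one_sub measurableSet_Ici, hT, ENNReal.ofReal_sub _ hT0.le,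
      ENNReal.ofReal_one]
  have hm2 : expMeasure r (Set.Ici θ \ Set.Ici (θ + L)) = ENNReal.ofReal (T * (1 - E)) := by
    rw [measure_sdiff (Set.Ici_subset_Ici.2 (by linarith)) measurableSet_Ici.nullMeasurableSet
      (measure_ne_top _ _), hT, hTL, ← ENNReal.ofReal_sub _ (by positivity)]
    congr 1; ring
  rw [← lintegral_add_compl _ (measurableSet_Ici (a := θ))]
  have e0 : ∫⁻ x in (Set.Ici θ)ᶜ, f x ∂(expMeasure r) ≤ ENNReal.ofReal (b * (1 - T)) := by
    calc _ ≤ ∫⁻ x in (Set.Ici θ)ᶜ, ENNReal.ofReal b ∂(expMeasure r) := by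
          refine setLIntegral_mono_ae' measurableSet_Ici.compl ?_
          filter_upwards [ae_nonneg_expMeasure hr] with x hx0 hx
          exact h1 x hx0 (by simpa using hx)
      _ = _ := by rw [setLIntegral_const, hm1, ← ENNReal.ofReal_mul hb]
  have e1 : ∫⁻ x in Set.Ici θ, f x ∂(expMeasure r) ≤
      ENNReal.ofReal (b * Real.exp (3 * y) * (T * (1 - E))) +
        ENNReal.ofReal (b * Real.exp (-y) * (T * E)) := by
    rw [← lintegral_inter_add_sdiff (B := Set.Ici (θ + L)) _ _ measurableSet_Ici, add_comm]
    refine add_le_add ?_ ?_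
    · calc _ ≤ ∫⁻ x in Set.Ici θ \ Set.Ici (θ + L),
            ENNReal.ofReal (b * Real.exp (3 * y)) ∂(expMeasure r) :=
            setLIntegral_mono' (measurableSet_Ici.diff measurableSet_Ici) fun x hx => h2 x hx.1
        _ = _ := by rw [setLIntegral_const, hm2, ← ENNReal.ofReal_mul (by positivity)]
    · rw [Set.inter_eq_right.2 (Set.Ici_subset_Ici.2 (by linarith : θ ≤ θ + L))]
      calc _ ≤ ∫⁻ x in Set.Ici (θ + L), ENNReal.ofReal (b * Real.exp (-y)) ∂(expMeasure r) :=
            setLIntegral_mono' measurableSet_Ici fun x hx => h3 x hx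
        _ = _ := by rw [setLIntegral_const, hTL, ← ENNReal.ofReal_mul (by positivity)]
  refine (add_le_add e1 e0).trans ?_
  rw [← ENNReal.ofReal_add (mul_nonneg (by positivity) (mul_nonneg hT0.le (by linarith)))
      (by positivity),
    ← ENNReal.ofReal_add (add_nonneg (mul_nonneg (by positivity)
      (mul_nonneg hT0.le (by linarith))) (by positivity)) (mul_nonneg hb (by linarith))]
  refine ENNReal.ofReal_le_ofReal ?_
  have hk := exp_coin_bound hy0 hy hE0 hE1
  have hbT : 0 ≤ b * T := by positivity
  nlinarith [mul_le_mul_of_nonneg_left hk hbT]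

end SPR

end

/-! ### Invariants and measurability of the ball growing process. -/

noncomputable section

namespace SPR

variable {V : Type*} {k : ℕ}

namespace State

/-- The vertices that cluster `j` may contain after a step of terminal `j`. -/
def avail (S : State V k) (j : Fin k) : Set V := S.unclustered ∪ S.cluster j

/-- The properties of states that are preserved by the steps of the algorithm. -/
structure Valid (G : WGraph V) (t : Fin k ↪ V) (S : State V k) : Prop where
  mem : ∀ j, t j ∈ S.cluster j
  nonneg : ∀ j, 0 ≤ S.radius j
  disjoint : ∀ i j, i ≠ j → Disjoint (S.cluster i) (S.cluster j)
  inner : ∀ j, ∀ v ∈ S.cluster j, G.distOn (S.cluster j) (t j) v ≤ ENNReal.ofReal (S.radius j)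
  outer : ∀ j, ∀ v ∈ S.unclustered, ENNReal.ofReal (S.radius j) < G.distOn (S.avail j) (t j) v

theorem mem_unclustered {S : State V k} {v : V} : v ∈ S.unclustered ↔ ∀ j, v ∉ S.cluster j := by
  simp [unclustered]

variable {G : WGraph V} {t : Fin k ↪ V} {S : State V k}

@[simp] theorem step_cluster_self (j : Fin k) (x : ℝ) :
    (S.step G t j x).cluster j = G.ballOn (S.avail j) (t j) (S.radius j + x) := by
  simp [step, avail]

@[simp] theorem step_cluster_ne {i j : Fin k} (h : i ≠ j) (x : ℝ) :
    (S.step G t j x).cluster i = S.cluster i := by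
  simp [step, h]

@[simp] theorem step_radius_self (j : Fin k) (x : ℝ) :
    (S.step G t j x).radius j = S.radius j + x := by
  simp [step]

@[simp] theorem step_radius_ne {i j : Fin k} (h : i ≠ j) (x : ℝ) :
    (S.step G t j x).radius i = S.radius i := by
  simp [step, h]

theorem Valid.distOn_avail_le (hS : S.Valid G t) {j : Fin k} {v : V} (hv : v ∈ S.cluster j) :
    G.distOn (S.avail j) (t j) v ≤ ENNReal.ofReal (S.radius j) :=
  (WGraph.distOn_anti Set.subset_union_right _ _).trans (hS.inner j v hv)

theorem Valid.cluster_subset_step (hS : S.Valid G t) (j : Fin k) {x : ℝ} (hx : 0 ≤ x) (i : Fin k) :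
    S.cluster i ⊆ (S.step G t j x).cluster i := by
  rcases eq_or_ne i j with rfl | h
  · intro v hv
    rw [step_cluster_self]
    exact (hS.distOn_avail_le hv).trans (ENNReal.ofReal_le_ofReal (by linarith))
  · rw [step_cluster_ne h]

theorem Valid.unclustered_step_subset (hS : S.Valid G t) (j : Fin k) {x : ℝ} (hx : 0 ≤ x) :
    (S.step G t j x).unclustered ⊆ S.unclustered := fun v hv => by
  rw [mem_unclustered] at hv ⊢
  exact fun i hi => hv i (hS.cluster_subset_step j hx i hi)

theorem Valid.mem_unclustered_step (_hS : S.Valid G t) {j : Fin k} {x : ℝ} {v : V}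
    (hv : v ∈ S.unclustered) (hvj : v ∉ (S.step G t j x).cluster j) :
    v ∈ (S.step G t j x).unclustered := by
  rw [mem_unclustered] at hv ⊢
  intro i
  rcases eq_or_ne i j with rfl | h
  · exact hvj
  · rw [step_cluster_ne h]; exact hv i

/-- The new ball is cut out of `avail j`, so vertices only pass from the unclustered set to cluster
`j`. -/
theorem Valid.avail_step_self (hS : S.Valid G t) (j : Fin k) {x : ℝ} (hx : 0 ≤ x) :
    (S.step G t j x).avail j = S.avail j := by
  refine Set.Subset.antisymm ?_ ?_
  · refine Set.union_subset ((hS.unclustered_step_subset j hx).trans Set.subset_union_left) ?_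
    rw [step_cluster_self]
    exact WGraph.ballOn_subset
  · rintro v (hv | hv)
    · by_cases h : v ∈ (S.step G t j x).cluster j
      · exact Or.inr h
      · exact Or.inl (hS.mem_unclustered_step hv h)
    · exact Or.inr (hS.cluster_subset_step j hx j hv)

theorem Valid.avail_step_subset (hS : S.Valid G t) (j : Fin k) {x : ℝ} (hx : 0 ≤ x) (i : Fin k) :
    (S.step G t j x).avail i ⊆ S.avail i := by
  rcases eq_or_ne i j with rfl | h
  · rw [hS.avail_step_self i hx]
  · refine Set.union_subset_union (hS.unclustered_step_subset j hx) ?_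
    rw [step_cluster_ne h]

/-- For the other terminals the available set shrinks and induced distances grow, which preserves
`outer`; for `j` itself, `outer` expresses that the new cluster is the whole ball. -/
theorem Valid.step [Finite V] (hS : S.Valid G t) (j : Fin k) {x : ℝ} (hx : 0 ≤ x) :
    (S.step G t j x).Valid G t where
  mem i := hS.cluster_subset_step j hx i (hS.mem i)
  nonneg i := by
    rcases eq_or_ne i j with rfl | h
    · rw [step_radius_self]; linarith [hS.nonneg i]
    · rw [step_radius_ne h]; exact hS.nonneg i
  disjoint := by
    have key : ∀ i, i ≠ j → Disjoint (S.cluster i) ((S.step G t j x).cluster j) := by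
      intro i h
      rw [step_cluster_self]
      refine Disjoint.mono_right WGraph.ballOn_subset ?_
      refine Set.disjoint_union_right.2 ⟨?_, hS.disjoint i j h⟩
      exact Set.disjoint_left.2 fun v h1 h2 => mem_unclustered.1 h2 i h1
    intro i l hil
    by_cases hi : i = j
    · subst hi
      rw [step_cluster_ne hil.symm]
      exact (key l hil.symm).symm
    · by_cases hl : l = j
      · subst hl
        rw [step_cluster_ne hi]
        exact key i hi
      · rw [step_cluster_ne hi, step_cluster_ne hl]
        exact hS.disjoint i l hil
  inner i v hv := by
    rcases eq_or_ne i j with rfl | h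
    · rw [step_cluster_self] at hv ⊢
      rw [step_radius_self]
      exact WGraph.distOn_ballOn_le hv
    · rw [step_cluster_ne h] at hv ⊢
      rw [step_radius_ne h]
      exact hS.inner i v hv
  outer i v hv := by
    rcases eq_or_ne i j with rfl | h
    · rw [hS.avail_step_self i hx, step_radius_self]
      have h1 := mem_unclustered.1 hv i
      rw [step_cluster_self] at h1
      exact not_le.1 h1
    · rw [step_radius_ne h]
      exact (hS.outer i v (hS.unclustered_step_subset j hx hv)).trans_le
        (WGraph.distOn_anti (hS.avail_step_subset j hx i) _ _)

theorem valid_init [Finite V] (hG : G.Positive) : (init t).Valid G t where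
  mem j := rfl
  nonneg j := le_rfl
  disjoint i j h := by
    simpa [init] using h
  inner j v hv := by
    obtain rfl : v = t j := hv
    rw [WGraph.distOn_self (by simp [init])]
    exact zero_le
  outer j v hv := by
    simp only [init, ENNReal.ofReal_zero]
    refine WGraph.distOn_pos hG _ fun h => ?_
    exact mem_unclustered.1 hv j (by simp [init, h])

/-! Measurability. -/

instance instMeasurableSpace : MeasurableSpace (State V k) :=
  MeasurableSpace.comap (fun S => (S.radius, S.cluster)) inferInstance

theorem measurable_toProd : Measurable fun S : State V k => (S.radius, S.cluster) :=
  comap_measurable _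

theorem measurable_radius : Measurable fun S : State V k => S.radius :=
  measurable_fst.comp measurable_toProd

theorem measurable_cluster : Measurable fun S : State V k => S.cluster :=
  measurable_snd.comp measurable_toProd

theorem measurable_cluster_apply (j : Fin k) : Measurable fun S : State V k => S.cluster j :=
  (measurable_pi_apply j).comp measurable_cluster

theorem measurable_avail [Finite V] (j : Fin k) : Measurable fun S : State V k => S.avail j := by
  have h : Measurable fun c : Fin k → Set V => (⋃ j, c j)ᶜ ∪ c j := measurable_of_finite _
  exact h.comp measurable_cluster

theorem measurable_iff {Z : Type*} [MeasurableSpace Z] {f : Z → State V k} :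
    Measurable f ↔ Measurable (fun z => (f z).radius) ∧ Measurable fun z => (f z).cluster := by
  refine ⟨fun h => ⟨measurable_radius.comp h, measurable_cluster.comp h⟩, fun h => ?_⟩
  exact measurable_comap_iff.2 (h.1.prodMk h.2)

/-- There are finitely many cluster configurations, so the clusters may be frozen; the induced
distances then become constants. -/
theorem measurable_of_forall_cluster [Finite V] {Z B : Type*} [MeasurableSpace Z]
    [MeasurableSpace B] {f : State V k × Z → B}
    (h : ∀ cl, Measurable fun y : (Fin k → ℝ) × Z => f (⟨y.1, cl⟩, y.2)) : Measurable f := by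
  have h1 : Measurable fun y : ((Fin k → ℝ) × Z) × (Fin k → Set V) => f (⟨y.1.1, y.2⟩, y.1.2) :=
    measurable_from_prod_countable_left h
  exact h1.comp (((measurable_radius.comp measurable_fst).prodMk measurable_snd).prodMk
    (measurable_cluster.comp measurable_fst))

theorem measurable_of_forall_cluster' [Finite V] {B : Type*} [MeasurableSpace B]
    {f : State V k → B} (h : ∀ cl, Measurable fun R => f ⟨R, cl⟩) : Measurable f := by
  have h1 : Measurable fun z : State V k × Unit => f z.1 :=
    measurable_of_forall_cluster fun cl => (h cl).comp measurable_fst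
  exact h1.comp (measurable_id.prodMk (measurable_const (a := ())))

theorem measurable_step [Finite V] (G : WGraph V) (t : Fin k ↪ V) (j : Fin k) :
    Measurable fun z : State V k × ℝ => z.1.step G t j z.2 := by
  refine measurable_iff.2 ⟨?_, ?_⟩
  · refine measurable_pi_lambda _ fun i => ?_
    rcases eq_or_ne i j with rfl | h
    · simp only [step_radius_self]
      exact (((measurable_pi_apply i).comp measurable_radius).comp measurable_fst).add
        measurable_snd
    · simp only [step_radius_ne h]
      exact ((measurable_pi_apply i).comp measurable_radius).comp measurable_fst
  · refine measurable_pi_lambda _ fun i => ?_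
    rcases eq_or_ne i j with rfl | h
    · simp only [step_cluster_self]
      refine measurable_of_forall_cluster fun cl => ?_
      refine measurable_set_iff.2 fun v => ?_
      have : Measurable fun y : (Fin k → ℝ) × ℝ => ENNReal.ofReal (y.1 i + y.2) := by fun_prop
      exact (measurableSet_le (f := fun _ => G.distOn ((⟨0, cl⟩ : State V k).avail i) (t i) v)
        measurable_const this).mem
    · simp only [step_cluster_ne h]
      exact ((measurable_pi_apply i).comp measurable_cluster).comp measurable_fst

end State

end SPR

end

/-! ### Slack: the growth that a terminal still needs to absorb a vertex. -/

noncomputable section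

namespace SPR

open MeasureTheory ProbabilityTheory

variable {V : Type*} {k : ℕ}

namespace State

variable {G : WGraph V} {t : Fin k ↪ V} {S : State V k}

/-- The increase of its radius that terminal `j` needs to include `v` into its cluster. -/
def slack (G : WGraph V) (t : Fin k ↪ V) (S : State V k) (v : V) (j : Fin k) : ℝ≥0∞ :=
  G.distOn (S.avail j) (t j) v - ENNReal.ofReal (S.radius j)

/-- The least increase of the radius of any terminal after which `v` belongs to a cluster. -/
def minSlack (G : WGraph V) (t : Fin k ↪ V) (S : State V k) (v : V) : ℝ≥0∞ :=
  ⨅ j, S.slack G t v j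

theorem minSlack_le (v : V) (j : Fin k) : S.minSlack G t v ≤ S.slack G t v j := iInf_le _ j

theorem exists_slack_eq_minSlack [NeZero k] (v : V) :
    ∃ j, S.slack G t v j = S.minSlack G t v := exists_eq_ciInf_of_finite

theorem Valid.slack_step_self (hS : S.Valid G t) (j : Fin k) {x : ℝ} (hx : 0 ≤ x) (v : V) :
    (S.step G t j x).slack G t v j = S.slack G t v j - ENNReal.ofReal x := by
  rw [slack, slack, hS.avail_step_self j hx, step_radius_self,
    ENNReal.ofReal_add (hS.nonneg j) hx, tsub_add_eq_tsub_tsub]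

theorem Valid.slack_le_step (hS : S.Valid G t) {i j : Fin k} (h : i ≠ j) {x : ℝ} (hx : 0 ≤ x)
    (v : V) : S.slack G t v i ≤ (S.step G t j x).slack G t v i := by
  rw [slack, slack, step_radius_ne h]
  exact tsub_le_tsub_right (WGraph.distOn_anti (hS.avail_step_subset j hx i) _ _) _

/-- If the step of `j` took a vertex `u` from a shortest path of `i` to `v`, then the rest of that
path, which has length at most the slack of `i`, would bring `j` to `v` with total growth at most
`x` plus that slack, against `hlt`. So the path of `i` survives. -/
theorem Valid.slack_step_le [Finite V] (hS : S.Valid G t) {i j : Fin k} (h : i ≠ j) {x : ℝ}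
    (hx : 0 ≤ x) {v : V}
    (hlt : ENNReal.ofReal x + S.slack G t v i < S.slack G t v j) :
    (S.step G t j x).slack G t v i ≤ S.slack G t v i := by
  have hfin : G.distOn (S.avail i) (t i) v ≠ ⊤ := by
    intro h1
    have h2 : S.slack G t v i = ⊤ := by rw [slack, h1]; simp
    rw [h2] at hlt
    simp at hlt
  obtain ⟨p, -, hpA, hp⟩ := WGraph.exists_isPath_len_eq hfin
  by_cases hsub : ∀ u ∈ p.support, u ∈ (S.step G t j x).avail i
  · rw [slack, slack, step_radius_ne h]
    exact tsub_le_tsub_right ((WGraph.distOn_le_len p hsub).trans hp.le) _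
  exfalso
  push Not at hsub
  obtain ⟨u, hup, hu⟩ := hsub
  have hui : u ∉ S.cluster i := fun h1 => hu (Or.inr (hS.cluster_subset_step j hx i h1))
  have huU : u ∈ S.unclustered := (hpA u hup).resolve_right hui
  have huj : u ∈ (S.step G t j x).cluster j := by
    by_contra hc
    exact hu (Or.inl (hS.mem_unclustered_step huU hc))
  rw [step_cluster_self] at huj
  have huj' : G.distOn (S.avail j) (t j) u ≤ ENNReal.ofReal (S.radius j + x) := huj
  obtain ⟨p1, p2, rfl⟩ := SimpleGraph.Walk.mem_support_iff_exists_append.1 hup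
  have h1 : ENNReal.ofReal (S.radius i) < G.len p1 :=
    (hS.outer i u huU).trans_le (WGraph.distOn_eq_of_split hpA hp).ge
  rw [WGraph.len_append, ENNReal.coe_add] at hp
  -- Behind `u`, the path cannot return to cluster `i`: by `inner` such a vertex has distance at
  -- most the radius from `t i`, whereas `u`, earlier on a shortest path, is already beyond the
  -- radius.
  have hp2 : ∀ w ∈ p2.support, w ∈ S.unclustered := by
    intro w hw
    have hwA : w ∈ S.avail i := hpA w (by
      rw [SimpleGraph.Walk.mem_support_append_iff]; exact Or.inr hw)
    refine hwA.resolve_right fun hwi => ?_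
    obtain ⟨p3, p4, rfl⟩ := SimpleGraph.Walk.mem_support_iff_exists_append.1 hw
    have h4 : ∀ y ∈ p4.support, y ∈ S.avail i := fun y hy => hpA y (by
      simp only [SimpleGraph.Walk.mem_support_append_iff]; exact Or.inr (Or.inr hy))
    have h5 : G.distOn (S.avail i) (t i) v ≤ ENNReal.ofReal (S.radius i) + G.len p4 :=
      (WGraph.distOn_triangle _ _ w _).trans
        (add_le_add (hS.distOn_avail_le hwi) (WGraph.distOn_le_len p4 h4))
    rw [← hp, WGraph.len_append, ENNReal.coe_add] at h5
    have h6 : (G.len p4 : ℝ≥0∞) ≤ G.len p3 + G.len p4 := le_add_self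
    have h7 := (add_le_add_right h6 (G.len p1 : ℝ≥0∞)).trans h5
    exact absurd ((ENNReal.add_le_add_iff_right ENNReal.coe_ne_top).1 h7) (not_le.2 h1)
  have h2 : G.distOn (S.avail j) (t j) v ≤ ENNReal.ofReal (S.radius j + x) + G.len p2 :=
    (WGraph.distOn_triangle _ _ u _).trans
      (add_le_add huj' (WGraph.distOn_le_len p2 fun w hw => Or.inl (hp2 w hw)))
  have h3 : (G.len p2 : ℝ≥0∞) ≤ S.slack G t v i := by
    rw [slack, ← hp]
    refine ENNReal.le_sub_of_add_le_left ENNReal.ofReal_ne_top ?_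
    exact add_le_add_left h1.le _
  refine absurd hlt (not_lt.2 ?_)
  rw [slack, tsub_le_iff_right]
  refine h2.trans ?_
  rw [ENNReal.ofReal_add (hS.nonneg j) hx, add_comm (ENNReal.ofReal (S.radius j)),
    add_assoc, add_assoc, add_comm (ENNReal.ofReal (S.radius j))]
  exact add_le_add_right (add_le_add_left h3 _) _

/-- While the increment of terminal `j` is too small to become the best one, the best terminals
remain the best ones. -/
theorem Valid.slack_step_eq_minSlack [Finite V] (hS : S.Valid G t) {i j : Fin k} {x : ℝ}
    (hx : 0 ≤ x) {v : V} (hi : S.slack G t v i = S.minSlack G t v)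
    (hlt : ENNReal.ofReal x + S.minSlack G t v < S.slack G t v j) :
    i ≠ j ∧ (S.step G t j x).slack G t v i = (S.step G t j x).minSlack G t v ∧
      (S.step G t j x).minSlack G t v = S.minSlack G t v := by
  have hij : i ≠ j := by
    rintro rfl
    rw [hi] at hlt
    exact absurd hlt (not_lt.2 le_add_self)
  have h1 : (S.step G t j x).slack G t v i ≤ S.minSlack G t v := by
    rw [← hi]
    exact hS.slack_step_le hij hx (by rwa [hi])
  have h2 : S.minSlack G t v ≤ (S.step G t j x).minSlack G t v := by
    refine le_iInf fun l => ?_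
    rcases eq_or_ne l j with rfl | hl
    · rw [hS.slack_step_self l hx]
      exact ENNReal.le_sub_of_add_le_left ENNReal.ofReal_ne_top hlt.le
    · exact (minSlack_le v l).trans (hS.slack_le_step hl hx v)
  have h3 := minSlack_le (S := S.step G t j x) (G := G) (t := t) v i
  exact ⟨hij, le_antisymm (h1.trans h2) h3, le_antisymm (h3.trans h1) h2⟩

theorem Valid.minSlack_step_le_sub (hS : S.Valid G t) {j : Fin k} {x : ℝ}
    (hx : 0 ≤ x) (v : V) :
    (S.step G t j x).minSlack G t v ≤ S.slack G t v j - ENNReal.ofReal x :=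
  (minSlack_le v j).trans (hS.slack_step_self j hx v).le

/-- Either `x` is too small for `j` to become best and the best terminal is undisturbed, or the
slack of `j` itself falls to at most the old minimum. -/
theorem Valid.minSlack_step_le [Finite V] [NeZero k] (hS : S.Valid G t) (j : Fin k) {x : ℝ}
    (hx : 0 ≤ x) (v : V) : (S.step G t j x).minSlack G t v ≤ S.minSlack G t v := by
  by_cases h : ENNReal.ofReal x + S.minSlack G t v < S.slack G t v j
  · obtain ⟨i, hi⟩ := exists_slack_eq_minSlack (S := S) (G := G) (t := t) v
    exact (hS.slack_step_eq_minSlack hx hi h).2.2.le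
  · refine (hS.minSlack_step_le_sub hx v).trans ?_
    rw [tsub_le_iff_left]
    exact not_lt.1 h

/-- A shortest path from the nearest terminal to `v` contains no other terminal, since that one
would be nearer. So it lies in the graph initially available to the nearest terminal. -/
theorem minSlack_init_le [Finite V] [NeZero k] (hG : G.Positive) (hc : G.graph.Connected)
    (v : V) : (init t).minSlack G t v ≤ G.termDist t v := by
  obtain ⟨j, hj⟩ := WGraph.exists_termDist_eq (G := G) t v
  obtain ⟨p, -, hp⟩ := WGraph.exists_isPath_len_eq_dist (WGraph.dist_ne_top hc (t j) v)
  rw [hj, WGraph.dist_comm, ← hp]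
  refine (minSlack_le v j).trans (tsub_le_self.trans (WGraph.distOn_le_len p fun u hu => ?_))
  by_cases hu' : ∀ i, u ≠ t i
  · exact Or.inl (mem_unclustered.2 hu')
  push Not at hu'
  obtain ⟨i, rfl⟩ := hu'
  rcases eq_or_ne i j with rfl | hij
  · exact Or.inr rfl
  exfalso
  obtain ⟨p1, p2, rfl⟩ := SimpleGraph.Walk.mem_support_iff_exists_append.1 hu
  have h1 : 0 < G.len p1 := WGraph.len_pos hG (t.injective.ne hij.symm) p1
  have h2 := WGraph.termDist_le (G := G) t v i
  rw [hj, G.dist_comm v, G.dist_comm v, ← hp] at h2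
  have h3 := h2.trans (WGraph.dist_le_len p2)
  rw [WGraph.len_append] at h3
  have h4 : G.len p1 + G.len p2 ≤ G.len p2 := by exact_mod_cast h3
  exact absurd h4 (not_le.2 (lt_add_of_pos_left _ h1))

theorem measurable_slack [Finite V] (G : WGraph V) (t : Fin k ↪ V) (v : V) (j : Fin k) :
    Measurable fun S : State V k => S.slack G t v j := by
  refine measurable_of_forall_cluster' fun cl => ?_
  have : Measurable fun R : Fin k → ℝ =>
      G.distOn ((⟨0, cl⟩ : State V k).avail j) (t j) v - ENNReal.ofReal (R j) := by
    fun_prop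
  exact this

theorem measurable_minSlack [Finite V] (G : WGraph V) (t : Fin k ↪ V) (v : V) :
    Measurable fun S : State V k => S.minSlack G t v :=
  Measurable.iInf fun j => measurable_slack G t v j

theorem measurableSet_mem_unclustered [Finite V] (v : V) :
    MeasurableSet {S : State V k | v ∈ S.unclustered} := by
  have h : Measurable fun c : Fin k → Set V => v ∈ (⋃ j, c j)ᶜ := measurable_of_finite _
  exact (h.comp measurable_cluster).setOf

end State

end SPR

end

/-! ### Rounds of independent exponential increments. -/

noncomputable section

namespace SPR

open MeasureTheory ProbabilityTheory

theorem lintegral_expMeasure_le_const {r : ℝ} (hr : 0 < r) {f : ℝ → ℝ≥0∞} {c : ℝ≥0∞}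
    (h : ∀ x, 0 ≤ x → f x ≤ c) : ∫⁻ x, f x ∂(expMeasure r) ≤ c := by
  have := isProbabilityMeasure_expMeasure hr
  calc ∫⁻ x, f x ∂(expMeasure r) ≤ ∫⁻ x, c ∂(expMeasure r) := by
        refine lintegral_mono_ae ?_
        filter_upwards [ae_nonneg_expMeasure hr] with x hx using h x hx
    _ = c := by simp

/-- Independent exponential variables, in rounds of `k` variables each, with mean `m ℓ` in round
`ℓ`. -/
structure ExpRounds {Ω : Type*} [MeasurableSpace Ω] (P : Measure Ω) (k : ℕ) (m : ℕ → ℝ)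
    (Y : ℕ → Ω → ℝ) : Prop where
  measurable : ∀ n, Measurable (Y n)
  indep : iIndepFun Y P
  pos : ∀ l, 0 < m l
  law : ∀ n, P.map (Y n) = expMeasure (1 / m (n / k))

theorem ExpRounds.ae_nonneg {Ω : Type*} [MeasurableSpace Ω] {P : Measure Ω} {k : ℕ} {m : ℕ → ℝ}
    {Y : ℕ → Ω → ℝ} (h : ExpRounds P k m Y) (n : ℕ) : ∀ᵐ ω ∂P, 0 ≤ Y n ω := by
  have h1 := ae_nonneg_expMeasure (one_div_pos.2 (h.pos (n / k)))
  rw [← h.law n] at h1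
  exact ae_of_ae_map (h.measurable n).aemeasurable h1

/-- The state after `n` steps of a process whose steps are grouped in rounds of `k` steps. -/
def roundRun {k : ℕ} [NeZero k] {S X : Type*} (F : ℕ → Fin k → S → X → S) (s : S) (x : ℕ → X)
    (n : ℕ) : S :=
  seqRun (fun n => F (n / k) (Fin.ofNat k n)) s x n

section

variable {Ω S : Type*} [MeasurableSpace Ω] [MeasurableSpace S] {P : Measure Ω}
  [IsProbabilityMeasure P] {k : ℕ} [NeZero k] {m : ℕ → ℝ} {Y : ℕ → Ω → ℝ}

omit [IsProbabilityMeasure P] in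
theorem measurable_roundRun {F : ℕ → Fin k → S → ℝ → S} (hY : ExpRounds P k m Y)
    (hF : ∀ l j, Measurable fun z : S × ℝ => F l j z.1 z.2) (s : S) (n : ℕ) :
    Measurable fun ω => roundRun F s (fun n => Y n ω) n :=
  (measurable_seqRun (fun n => hF (n / k) (Fin.ofNat k n)) s n).comp
    (measurable_pi_lambda _ hY.measurable)

/-- Step `n` belongs to terminal `n % k` in round `n / k`; `W l j` is the potential just before
terminal `j` moves in round `l`, and `hwrap` glues the end of a round to the start of the next. -/
theorem lintegral_roundRun_le (hY : ExpRounds P k m Y) {F : ℕ → Fin k → S → ℝ → S}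
    (hF : ∀ l j, Measurable fun z : S × ℝ => F l j z.1 z.2) {s : S} {Inv : S → Prop} (h0 : Inv s)
    (hInv : ∀ l j s x, Inv s → 0 ≤ x → Inv (F l j s x)) {W : ℕ → ℕ → S → ℝ≥0∞}
    (hW : ∀ l j, Measurable (W l j)) (hwrap : ∀ l s, W l k s = W (l + 1) 0 s) {T : ℕ}
    (hstep : ∀ l < T, ∀ j : Fin k, ∀ s, Inv s →
      ∫⁻ x, W l (j + 1) (F l j s x) ∂(expMeasure (1 / m l)) ≤ W l j s) :
    ∫⁻ ω, W T 0 (roundRun F s (fun n => Y n ω) (T * k)) ∂P ≤ W 0 0 s := by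
  have hk : 0 < k := NeZero.pos k
  have key := lintegral_seqRun_le (P := P) hY.measurable hY.indep hY.ae_nonneg
    (F := fun n => F (n / k) (Fin.ofNat k n)) (fun n => hF _ _) h0 (fun n => hInv _ _)
    (W := fun n => W (n / k) (n % k)) (fun n => hW _ _) (N := T * k) ?_
  · simpa [roundRun, hk.ne'] using key
  intro n hn s hs
  have hl : n / k < T := (Nat.div_lt_iff_lt_mul hk).2 hn
  refine le_trans (le_of_eq ?_) (hstep (n / k) hl (Fin.ofNat k n) s hs)
  rw [hY.law n]
  refine lintegral_congr fun x => ?_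
  have hj : ((Fin.ofNat k n : Fin k) : ℕ) = n % k := rfl
  rw [hj]
  have hmod := Nat.mod_lt n hk
  have hdm := Nat.div_add_mod n k
  rcases Nat.lt_or_ge (n % k + 1) k with h | h
  · have h4 : n + 1 = k * (n / k) + (n % k + 1) := by omega
    have h1 : (n + 1) / k = n / k := by
      conv_lhs => rw [h4, Nat.mul_add_div hk, Nat.div_eq_of_lt h, add_zero]
    have h2 : (n + 1) % k = n % k + 1 := by
      conv_lhs => rw [h4, Nat.mul_add_mod, Nat.mod_eq_of_lt h]
    simp only [h1, h2]
  · have h3 : n % k + 1 = k := by omega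
    have h4 : n + 1 = k * (n / k + 1) := by
      rw [mul_add, mul_one]; omega
    have h1 : (n + 1) / k = n / k + 1 := by
      rw [h4, Nat.mul_div_cancel_left _ hk]
    have h2 : (n + 1) % k = 0 := by rw [h4]; exact Nat.mul_mod_right _ _
    simp only [h1, h2, h3]
    exact (hwrap _ _).symm

end

variable {V : Type*} {k : ℕ}

namespace State

/-! ### Tail bound for a vertex to remain unclustered. -/

section cover

variable [Finite V] [NeZero k] {G : WGraph V} {t : Fin k ↪ V}

open Classical in
/-- The exponential moment, with parameter `s`, of the increase of radius needed to cluster `v`. -/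
def coverMoment (G : WGraph V) (t : Fin k ↪ V) (v : V) (s : ℝ) (B : ℕ → ℝ) (T l j : ℕ) :
    State V k → ℝ≥0∞ :=
  {S : State V k | v ∈ S.unclustered}.indicator fun S =>
    ENNReal.ofReal (Real.exp (s * (S.minSlack G t v).toReal) * ∏ i ∈ Finset.Ico (l + 1) T, B i) *
      if ∃ i : Fin k, j ≤ i ∧ S.slack G t v i = S.minSlack G t v then ENNReal.ofReal (B l) else 1

omit [Finite V] [NeZero k] in
theorem coverMoment_of_mem {v : V} {S : State V k} (hv : v ∈ S.unclustered) (s : ℝ) (B : ℕ → ℝ)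
    (T l j : ℕ) [Decidable (∃ i : Fin k, j ≤ i ∧ S.slack G t v i = S.minSlack G t v)] :
    coverMoment G t v s B T l j S =
      ENNReal.ofReal (Real.exp (s * (S.minSlack G t v).toReal) *
        ∏ i ∈ Finset.Ico (l + 1) T, B i) *
        if ∃ i : Fin k, j ≤ i ∧ S.slack G t v i = S.minSlack G t v then
          ENNReal.ofReal (B l) else 1 := by
  rw [coverMoment, Set.indicator_of_mem (by exact hv)]
  congr

omit [Finite V] [NeZero k] in
theorem coverMoment_of_notMem {v : V} {S : State V k} (hv : v ∉ S.unclustered) (s : ℝ)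
    (B : ℕ → ℝ) (T l j : ℕ) : coverMoment G t v s B T l j S = 0 := by
  rw [coverMoment, Set.indicator_of_notMem (by exact hv)]

omit [NeZero k] in
theorem measurable_coverMoment (v : V) (s : ℝ) (B : ℕ → ℝ) (T l j : ℕ) :
    Measurable (coverMoment G t v s B T l j) := by
  refine Measurable.indicator ?_ (measurableSet_mem_unclustered v)
  refine Measurable.mul ?_ (Measurable.ite ?_ measurable_const measurable_const)
  · have := (measurable_minSlack G t v).ennreal_toReal
    fun_prop
  · simp only [Set.ofPred_exists]
    refine MeasurableSet.iUnion fun i => ?_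
    refine (MeasurableSet.const _).inter ?_
    exact measurableSet_eq_fun (measurable_slack G t v i) (measurable_minSlack G t v)

omit [Finite V] in
theorem coverMoment_wrap (v : V) (s : ℝ) {B : ℕ → ℝ} {T : ℕ} (hB0 : ∀ l, 0 < B l)
    (hB : ∀ l, T ≤ l → B l = 1) (l : ℕ) (S : State V k) :
    coverMoment G t v s B T l k S = coverMoment G t v s B T (l + 1) 0 S := by
  classical
  by_cases hv : v ∈ S.unclustered
  · rw [coverMoment_of_mem hv, coverMoment_of_mem hv]
    rw [if_neg (by rintro ⟨i, hi, -⟩; exact absurd i.2 (not_lt.2 hi)),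
      if_pos (by
        obtain ⟨i, hi⟩ := exists_slack_eq_minSlack (S := S) (G := G) (t := t) v
        exact ⟨i, Nat.zero_le _, hi⟩), mul_one,
      ← ENNReal.ofReal_mul (mul_nonneg (Real.exp_pos _).le
        (Finset.prod_nonneg fun i _ => (hB0 i).le))]
    congr 1
    rw [mul_assoc]
    congr 1
    rcases Nat.lt_or_ge (l + 1) T with h | h
    · rw [Finset.prod_eq_prod_Ico_succ_bot h, mul_comm]
    · rw [Finset.Ico_eq_empty (by omega), Finset.Ico_eq_empty (by omega), hB _ h]
      simp
  · rw [coverMoment_of_notMem hv, coverMoment_of_notMem hv]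

/-- The factor `B l` is the gain still expected in round `l`, present while some best terminal has
yet to move. If the increment of `j` is too small to make it the best, a best terminal is still to
come. Otherwise `j` becomes best, and the excess over the threshold lowers the minimal slack; its
exponential moment is exactly `B l`. -/
theorem lintegral_coverMoment_step_le {v : V} {s : ℝ} (hs : 0 ≤ s) {m : ℕ → ℝ} (hm : ∀ l, 0 < m l)
    {B : ℕ → ℝ} {T l : ℕ} (hB0 : ∀ l, 0 < B l)
    (hBl : B l = (1 / m l) / (1 / m l + s)) (j : Fin k) {S : State V k} (hS : S.Valid G t)
    (hfin : S.minSlack G t v ≠ ⊤) :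
    ∫⁻ x, coverMoment G t v s B T l (j + 1) (S.step G t j x) ∂(expMeasure (1 / m l)) ≤
      coverMoment G t v s B T l j S := by
  classical
  have hr : 0 < 1 / m l := one_div_pos.2 (hm l)
  have := isProbabilityMeasure_expMeasure hr
  set c := ∏ i ∈ Finset.Ico (l + 1) T, B i with hc
  have hc0 : 0 ≤ c := Finset.prod_nonneg fun i _ => (hB0 i).le
  set a := (S.minSlack G t v).toReal with ha
  set b := Real.exp (s * a) * c with hb
  have hb0 : 0 ≤ b := mul_nonneg (Real.exp_pos _).le hc0
  have hB1 : B l ≤ 1 := by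
    rw [hBl, div_le_one (by linarith)]; linarith
  have hfac : ∀ S' : State V k, ∀ j' : ℕ, (if ∃ i : Fin k, j' ≤ i ∧ S'.slack G t v i =
      S'.minSlack G t v then ENNReal.ofReal (B l) else 1) ≤ 1 := by
    intro S' j'
    split_ifs
    · exact ENNReal.ofReal_le_one.2 hB1
    · exact le_rfl
  by_cases hv : v ∈ S.unclustered
  swap
  · -- a clustered vertex remains clustered
    refine lintegral_expMeasure_le_const hr fun x hx => ?_
    rw [coverMoment_of_notMem fun h => hv (hS.unclustered_step_subset j hx h)]
    exact zero_le
  have hgen : ∀ x, 0 ≤ x → coverMoment G t v s B T l (j + 1) (S.step G t j x) ≤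
      ENNReal.ofReal b := by
    intro x hx
    by_cases hv' : v ∈ (S.step G t j x).unclustered
    · rw [coverMoment_of_mem hv']
      refine (mul_le_of_le_one_right' (hfac _ _)).trans (ENNReal.ofReal_le_ofReal ?_)
      rw [hb]
      gcongr
      exact ENNReal.toReal_mono hfin (hS.minSlack_step_le j hx v)
    · rw [coverMoment_of_notMem hv']; exact zero_le
  -- Without a best terminal to come, the gain of the round is already booked and monotonicity of
  -- the minimal slack suffices.
  by_cases hp : ∃ i : Fin k, (j : ℕ) ≤ i ∧ S.slack G t v i = S.minSlack G t v
  swap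
  · rw [coverMoment_of_mem hv, if_neg hp, mul_one]
    exact lintegral_expMeasure_le_const hr hgen
  have hR : coverMoment G t v s B T l j S = ENNReal.ofReal (b * B l) := by
    rw [coverMoment_of_mem hv, if_pos hp, ENNReal.ofReal_mul hb0]
  obtain ⟨i, hij, hi⟩ := hp
  have hwait : ∀ x, 0 ≤ x → ENNReal.ofReal x + S.minSlack G t v < S.slack G t v j →
      coverMoment G t v s B T l (j + 1) (S.step G t j x) ≤ ENNReal.ofReal (b * B l) := by
    intro x hx hlt
    obtain ⟨h1, h2, h3⟩ := hS.slack_step_eq_minSlack hx hi hlt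
    by_cases hv' : v ∈ (S.step G t j x).unclustered
    · rw [coverMoment_of_mem hv', if_pos, h3, ← ha, ← hc, ← hb, ENNReal.ofReal_mul hb0]
      refine ⟨i, ?_, h2⟩
      have : (j : ℕ) ≠ i := fun h => h1 (Fin.ext h.symm)
      omega
    · rw [coverMoment_of_notMem hv']; exact zero_le
  rw [hR]
  by_cases htop : S.slack G t v j = ⊤
  · refine lintegral_expMeasure_le_const hr fun x hx => hwait x hx ?_
    rw [htop]
    exact ENNReal.add_lt_top.2 ⟨ENNReal.ofReal_lt_top, hfin.lt_top⟩
  have hθ : a ≤ (S.slack G t v j).toReal := ENNReal.toReal_mono htop (minSlack_le v j)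
  rw [hBl]
  -- The threshold at which `j` catches up with the best terminals; it is `0` if `j` is one of them.
  refine lintegral_expMeasure_le_of_excess (θ := (S.slack G t v j).toReal - a) hr hs
    (by linarith) hb0 ?_ ?_
  · intro x hx hxθ
    rw [← hBl]
    refine hwait x hx ?_
    rw [← ENNReal.ofReal_toReal hfin, ← ENNReal.ofReal_toReal htop,
      ← ENNReal.ofReal_add hx ENNReal.toReal_nonneg]
    exact (ENNReal.ofReal_lt_ofReal_iff_of_nonneg (by positivity)).2 (by linarith)
  · intro x hxθ
    have hx : 0 ≤ x := by linarith
    by_cases hv' : v ∈ (S.step G t j x).unclustered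
    · rw [coverMoment_of_mem hv']
      refine (mul_le_of_le_one_right' (hfac _ _)).trans (ENNReal.ofReal_le_ofReal ?_)
      have hx' : ENNReal.ofReal x ≤ S.slack G t v j := by
        have h1 := (hS.step j hx).outer j v hv'
        have h2 : 0 < (S.step G t j x).slack G t v j := tsub_pos_of_lt h1
        rw [hS.slack_step_self j hx] at h2
        exact (tsub_pos_iff_lt.1 h2).le
      have h1 : ((S.step G t j x).minSlack G t v).toReal ≤ (S.slack G t v j).toReal - x := by
        refine (ENNReal.toReal_mono (ENNReal.sub_ne_top htop)
          (hS.minSlack_step_le_sub hx v)).trans (le_of_eq ?_)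
        rw [ENNReal.toReal_sub_of_le hx' htop, ENNReal.toReal_ofReal hx]
      rw [hb, mul_right_comm, ← Real.exp_add]
      gcongr
      nlinarith
    · rw [coverMoment_of_notMem hv']; exact zero_le

/-- A vertex `v` is unlikely to be unclustered after `T` rounds if the radii are likely to exceed the
distance of `v` to the terminals. -/
theorem measure_mem_unclustered_le {Ω : Type*} [MeasurableSpace Ω] {P : Measure Ω}
    [IsProbabilityMeasure P] {m : ℕ → ℝ} {Y : ℕ → Ω → ℝ} (hY : ExpRounds P k m Y)
    (hG : G.Positive) (hc : G.graph.Connected) (v : V) {s : ℝ} (hs : 0 ≤ s) (T : ℕ) :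
    P {ω | v ∈ (roundRun (fun _ j S x => S.step G t j x) (init t) (fun n => Y n ω)
        (T * k)).unclustered} ≤
      ENNReal.ofReal (Real.exp (s * (G.termDist t v).toReal) *
        ∏ l ∈ Finset.range T, (1 / (1 + s * m l))) := by
  classical
  have hfin : G.termDist t v ≠ ⊤ :=
    ne_top_of_le_ne_top (WGraph.dist_ne_top hc v (t 0)) (WGraph.termDist_le t v 0)
  -- The Laplace transform `1 / (1 + s m l)` of an increment; with the value `1` from `T` on, the
  -- final moment dominates the indicator of `v` being unclustered.
  let B : ℕ → ℝ := fun l => if l < T then (1 / m l) / (1 / m l + s) else 1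
  have hB0 : ∀ l, 0 < B l := by
    intro l
    have := hY.pos l
    simp only [B]; split_ifs <;> positivity
  have hmain := lintegral_roundRun_le hY (F := fun _ j (S : State V k) x => S.step G t j x)
    (fun _ j => measurable_step G t j) (s := init t)
    (Inv := fun S => S.Valid G t ∧ S.minSlack G t v ≠ ⊤)
    ⟨valid_init hG, ne_top_of_le_ne_top hfin (minSlack_init_le hG hc v)⟩
    (fun l j S x hS hx => ⟨hS.1.step j hx, ne_top_of_le_ne_top hS.2 (hS.1.minSlack_step_le j hx v)⟩)
    (W := coverMoment G t v s B T) (measurable_coverMoment v s B T)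
    (coverMoment_wrap v s hB0 fun l hl => if_neg (not_lt.2 hl)) (T := T)
    (fun l hl j S hS => lintegral_coverMoment_step_le hs hY.pos hB0 (if_pos hl) j hS.1 hS.2)
  have h0 : coverMoment G t v s B T 0 0 (init t) ≤
      ENNReal.ofReal (Real.exp (s * (G.termDist t v).toReal) *
        ∏ l ∈ Finset.range T, (1 / (1 + s * m l))) := by
    by_cases hv : v ∈ (init t).unclustered
    swap
    · rw [coverMoment_of_notMem hv]; exact zero_le
    rw [coverMoment_of_mem hv, if_pos (by
      obtain ⟨i, hi⟩ := exists_slack_eq_minSlack (S := init t) (G := G) (t := t) v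
      exact ⟨i, Nat.zero_le _, hi⟩), ← ENNReal.ofReal_mul (mul_nonneg (Real.exp_pos _).le
        (Finset.prod_nonneg fun i _ => (hB0 i).le))]
    refine ENNReal.ofReal_le_ofReal ?_
    rw [mul_assoc]
    have hprod : (∏ i ∈ Finset.Ico (0 + 1) T, B i) * B 0 =
        ∏ l ∈ Finset.range T, (1 / (1 + s * m l)) := by
      rcases Nat.eq_zero_or_pos T with rfl | hT
      · simp [B]
      · rw [mul_comm, ← Finset.prod_eq_prod_Ico_succ_bot hT, Nat.Ico_zero_eq_range]
        refine Finset.prod_congr rfl fun l hl => ?_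
        have := hY.pos l
        simp only [B, if_pos (Finset.mem_range.1 hl)]
        field_simp
    rw [hprod]
    refine mul_le_mul_of_nonneg_right ?_ (Finset.prod_nonneg fun l _ => ?_)
    · gcongr
      exact minSlack_init_le hG hc v
    · have := hY.pos l
      positivity
  refine le_trans ?_ (hmain.trans h0)
  have hmeas : MeasurableSet {ω | v ∈ (roundRun (fun _ j (S : State V k) x => S.step G t j x)
      (init t) (fun n => Y n ω) (T * k)).unclustered} :=
    measurable_roundRun hY (F := fun _ j (S : State V k) x => S.step G t j x)
      (fun _ j => measurable_step G t j) (init t) (T * k) (measurableSet_mem_unclustered v)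
  rw [← lintegral_indicator_one hmeas]
  refine lintegral_mono fun ω => ?_
  refine Set.indicator_le' (g := fun ω => coverMoment G t v s B T T 0 (roundRun
    (fun _ j (S : State V k) x => S.step G t j x) (init t) (fun n => Y n ω) (T * k)))
    (fun ω hω => ?_) (fun _ _ => zero_le) ω
  rw [coverMoment_of_mem (by exact hω), Finset.Ico_eq_empty (by omega), Finset.prod_empty, mul_one]
  have h1 : B T = 1 := if_neg (lt_irrefl _)
  rw [h1, ENNReal.ofReal_one, ite_self, mul_one]
  simp only [Pi.one_apply]
  rw [← ENNReal.ofReal_one]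
  exact ENNReal.ofReal_le_ofReal (Real.one_le_exp (mul_nonneg hs ENNReal.toReal_nonneg))

end cover

/-! ### Tail bound for the radii. -/

section radius

variable [Finite V] [NeZero k] {G : WGraph V} {t : Fin k ↪ V}

/-- The exponential moment, with parameter `s`, of the radius of terminal `j`. -/
def radiusMoment (j : Fin k) (s : ℝ) (A : ℕ → ℝ) (T l i : ℕ) (S : State V k) : ℝ≥0∞ :=
  ENNReal.ofReal (Real.exp (s * S.radius j) * ∏ i ∈ Finset.Ico (l + 1) T, A i) *
    if i ≤ (j : ℕ) then ENNReal.ofReal (A l) else 1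

omit [Finite V] [NeZero k] in
theorem measurable_radiusMoment (j : Fin k) (s : ℝ) (A : ℕ → ℝ) (T l i : ℕ) :
    Measurable (radiusMoment (V := V) j s A T l i) := by
  have h : Measurable fun S : State V k => S.radius j :=
    (measurable_pi_apply j).comp measurable_radius
  unfold radiusMoment
  fun_prop

omit [Finite V] [NeZero k] in
theorem radiusMoment_wrap (j : Fin k) (s : ℝ) {A : ℕ → ℝ} {T : ℕ} (hA0 : ∀ l, 0 < A l)
    (hA : ∀ l, T ≤ l → A l = 1) (l : ℕ) (S : State V k) :
    radiusMoment j s A T l k S = radiusMoment j s A T (l + 1) 0 S := by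
  rw [radiusMoment, radiusMoment, if_neg (not_le.2 j.2), if_pos (Nat.zero_le _), mul_one,
      ← ENNReal.ofReal_mul (mul_nonneg (Real.exp_pos _).le
        (Finset.prod_nonneg fun i _ => (hA0 i).le)), mul_assoc]
  congr 2
  rcases Nat.lt_or_ge (l + 1) T with h | h
  · rw [Finset.prod_eq_prod_Ico_succ_bot h, mul_comm]
  · rw [Finset.Ico_eq_empty (by omega), Finset.Ico_eq_empty (by omega), hA _ h]
    simp

omit [Finite V] [NeZero k] in
theorem lintegral_radiusMoment_step_le (j : Fin k) {s : ℝ} {m : ℕ → ℝ}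
    (hm : ∀ l, 0 < m l) {A : ℕ → ℝ} {T l : ℕ} (hA0 : ∀ l, 0 < A l) (hsl : s < 1 / m l)
    (hAl : A l = (1 / m l) / (1 / m l - s)) (i : Fin k) (S : State V k) :
    ∫⁻ x, radiusMoment j s A T l (i + 1) (S.step G t i x) ∂(expMeasure (1 / m l)) ≤
      radiusMoment j s A T l i S := by
  have hr : 0 < 1 / m l := one_div_pos.2 (hm l)
  have hc0 : 0 ≤ ∏ i ∈ Finset.Ico (l + 1) T, A i := Finset.prod_nonneg fun i _ => (hA0 i).le
  unfold radiusMoment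
  rcases eq_or_ne j i with rfl | h
  · rw [if_pos le_rfl]
    simp only [step_radius_self, Nat.succ_le_iff, lt_irrefl, if_false, mul_one]
    refine le_of_eq ?_
    calc _ = ∫⁻ x, ENNReal.ofReal (Real.exp (s * S.radius j) * ∏ i ∈ Finset.Ico (l + 1) T, A i) *
          ENNReal.ofReal (Real.exp (s * x)) ∂(expMeasure (1 / m l)) := by
          refine lintegral_congr fun x => ?_
          rw [← ENNReal.ofReal_mul (by positivity), mul_add, Real.exp_add]
          congr 1; ring
      _ = _ := by
          rw [lintegral_const_mul _ (by fun_prop), lintegral_exp_expMeasure hr hsl, hAl]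
  · refine lintegral_expMeasure_le_const hr fun x _ => ?_
    rw [step_radius_ne h]
    have h1 : (i : ℕ) + 1 ≤ j ↔ (i : ℕ) ≤ j := by
      have : (j : ℕ) ≠ i := fun h' => h (Fin.ext h')
      omega
    simp only [h1, le_refl]

/-- Chernoff's bound: the radius is a sum of `T` independent exponential variables, whose moment
generating functions are `1 / (1 - s m l)`. -/
theorem measure_le_radius_le {Ω : Type*} [MeasurableSpace Ω] {P : Measure Ω}
    [IsProbabilityMeasure P] {m : ℕ → ℝ} {Y : ℕ → Ω → ℝ} (hY : ExpRounds P k m Y)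
    (hG : G.Positive) (j : Fin k) {s : ℝ} (hs : 0 ≤ s) {T : ℕ}
    (hsm : ∀ l < T, s * m l < 1) (y : ℝ) :
    P {ω | y ≤ (roundRun (fun _ j S x => S.step G t j x) (init t) (fun n => Y n ω)
        (T * k)).radius j} ≤
      ENNReal.ofReal (Real.exp (-(s * y)) * ∏ l ∈ Finset.range T, (1 / (1 - s * m l))) := by
  let A : ℕ → ℝ := fun l => if l < T then (1 / m l) / (1 / m l - s) else 1
  have hsm' : ∀ l < T, s < 1 / m l := fun l hl => by
    rw [lt_div_iff₀ (hY.pos l)]; exact hsm l hl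
  have hA0 : ∀ l, 0 < A l := by
    intro l
    have := hY.pos l
    simp only [A]; split_ifs with hl
    · have := hsm' l hl
      have h2 : 0 < 1 / m l - s := by linarith
      positivity
    · exact one_pos
  have hmain := lintegral_roundRun_le hY (F := fun _ j (S : State V k) x => S.step G t j x)
    (fun _ j => measurable_step G t j) (s := init t)
    (Inv := fun S => S.Valid G t) (valid_init hG) (fun l j S x hS hx => hS.step j hx)
    (W := radiusMoment j s A T) (measurable_radiusMoment j s A T)
    (radiusMoment_wrap j s hA0 fun l hl => if_neg (not_lt.2 hl)) (T := T)
    (fun l hl i S _ => lintegral_radiusMoment_step_le j hY.pos hA0 (hsm' l hl) (if_pos hl) i S)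
  have h0 : radiusMoment j s A T 0 0 (init t) =
      ENNReal.ofReal (∏ l ∈ Finset.range T, (1 / (1 - s * m l))) := by
    rw [radiusMoment, if_pos (Nat.zero_le _), ← ENNReal.ofReal_mul (mul_nonneg (Real.exp_pos _).le
        (Finset.prod_nonneg fun i _ => (hA0 i).le))]
    congr 1
    simp only [init, mul_zero, Real.exp_zero, one_mul]
    rcases Nat.eq_zero_or_pos T with rfl | hT
    · simp [A]
    · rw [mul_comm, ← Finset.prod_eq_prod_Ico_succ_bot hT, Nat.Ico_zero_eq_range]
      refine Finset.prod_congr rfl fun l hl => ?_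
      have h1 := hY.pos l
      have h2 := hsm l (Finset.mem_range.1 hl)
      have h3 := hsm' l (Finset.mem_range.1 hl)
      simp only [A, if_pos (Finset.mem_range.1 hl)]
      rw [div_eq_div_iff (by linarith) (by linarith)]
      field_simp
  rw [h0] at hmain
  have hmeas : Measurable fun ω => (roundRun (fun _ j (S : State V k) x => S.step G t j x)
      (init t) (fun n => Y n ω) (T * k)).radius j :=
    ((measurable_pi_apply j).comp measurable_radius).comp
      (measurable_roundRun hY (F := fun _ j (S : State V k) x => S.step G t j x)
        (fun _ j => measurable_step G t j) (init t) (T * k))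
  have hmk := mul_meas_ge_le_lintegral (μ := P) (f := fun ω => radiusMoment j s A T T 0
    (roundRun (fun _ j (S : State V k) x => S.step G t j x) (init t) (fun n => Y n ω) (T * k)))
    ((measurable_radiusMoment j s A T T 0).comp (measurable_roundRun hY
      (F := fun _ j (S : State V k) x => S.step G t j x)
        (fun _ j => measurable_step G t j) (init t) (T * k))) (ENNReal.ofReal (Real.exp (s * y)))
  have hexp : ENNReal.ofReal (Real.exp (-(s * y))) * ENNReal.ofReal (Real.exp (s * y)) = 1 := by
    rw [← ENNReal.ofReal_mul (Real.exp_pos _).le, ← Real.exp_add]; simp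
  rw [ENNReal.ofReal_mul (Real.exp_pos _).le]
  refine le_trans ?_ (mul_le_mul_right (hmk.trans hmain) _)
  rw [← mul_assoc, hexp, one_mul]
  refine measure_mono fun ω hω => ?_
  simp only [Set.mem_ofPred_eq, radiusMoment]
  have hAT : A T = 1 := if_neg (lt_irrefl _)
  rw [Finset.Ico_eq_empty (by omega), Finset.prod_empty, hAT, mul_one]
  simp only [ENNReal.ofReal_one, ite_self, mul_one]
  refine ENNReal.ofReal_le_ofReal (Real.exp_le_exp.2 (mul_le_mul_of_nonneg_left hω hs))

end radius

end State

end SPR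

end

noncomputable section

namespace SPR

/-! Slices: maximal runs of consecutive active positions in a block. -/

section slices

variable (β : ℕ → ℕ) (g : ℕ → ℝ) (A : Finset ℕ)

open Classical in
/-- The left ends of the slices of `A`. -/
def leftEnds : Finset ℕ := A.filter fun i => ¬ ∃ l ∈ A, l + 1 = i ∧ β l = β i

/-- The total weight of the slices of `A`, where each slice has the weight of its block. -/
def sliceWeight : ℝ := ∑ i ∈ leftEnds β A, g (β i)

variable {β g A}

theorem mem_leftEnds {i : ℕ} : i ∈ leftEnds β A ↔ i ∈ A ∧ ¬ ∃ l ∈ A, l + 1 = i ∧ β l = β i := by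
  simp [leftEnds]

theorem exists_leftEnd {i : ℕ} (hi : i ∈ A) :
    ∃ l ≤ i, l ∈ leftEnds β A ∧ ∀ m, l ≤ m → m ≤ i → m ∈ A ∧ β m = β i := by
  induction i using Nat.strong_induction_on with
  | _ i ih =>
    by_cases h : i ∈ leftEnds β A
    · refine ⟨i, le_rfl, h, fun m h1 h2 => ?_⟩
      obtain rfl : m = i := by omega
      exact ⟨hi, rfl⟩
    · have h1 : ∃ l ∈ A, l + 1 = i ∧ β l = β i := by
        by_contra hc
        exact h (mem_leftEnds.2 ⟨hi, hc⟩)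
      obtain ⟨i', hi', rfl, hb⟩ := h1
      obtain ⟨l, hl, hl1, hl2⟩ := ih i' (by omega) hi'
      refine ⟨l, by omega, hl1, fun m h1 h2 => ?_⟩
      rcases Nat.lt_or_ge i' m with h3 | h3
      · obtain rfl : m = i' + 1 := by omega
        exact ⟨hi, rfl⟩
      · exact ⟨(hl2 m h1 h3).1, (hl2 m h1 h3).2.trans hb⟩

theorem sliceWeight_nonneg (hg : ∀ i, 0 ≤ g i) : 0 ≤ sliceWeight β g A :=
  Finset.sum_nonneg fun _ _ => hg _

-- A position becomes a left end only by losing its predecessor, so the one candidate is `b + 1`,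
-- and only if a slice runs across the right end of the removed interval.
open Classical in
theorem leftEnds_sdiff_subset (a b : ℕ) :
    leftEnds β (A \ Finset.Icc a b) ⊆ (leftEnds β A \ Finset.Icc a b) ∪
      ({b + 1} : Finset ℕ).filter fun _ => b + 1 ∈ A ∧ b ∈ A ∧ β b = β (b + 1) := by
  intro i hi
  rw [mem_leftEnds, Finset.mem_sdiff] at hi
  obtain ⟨⟨hiA, hiI⟩, hi2⟩ := hi
  rw [Finset.mem_union, Finset.mem_sdiff]
  by_cases h : i ∈ leftEnds β A
  · exact Or.inl ⟨h, hiI⟩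
  refine Or.inr ?_
  have h1 : ∃ l ∈ A, l + 1 = i ∧ β l = β i := by
    by_contra hc
    exact h (mem_leftEnds.2 ⟨hiA, hc⟩)
  obtain ⟨l, hl, rfl, hb⟩ := h1
  have hlI : l ∈ Finset.Icc a b := by
    by_contra hc
    exact hi2 ⟨l, Finset.mem_sdiff.2 ⟨hl, hc⟩, rfl, hb⟩
  rw [Finset.mem_Icc] at hlI hiI
  obtain rfl : l = b := by omega
  simp [hiA, hl, hb]

theorem sliceWeight_sdiff_le_sum (hg : ∀ i, 0 ≤ g i) (a b : ℕ) :
    sliceWeight β g (A \ Finset.Icc a b) ≤ ∑ i ∈ leftEnds β A \ Finset.Icc a b, g (β i) ∨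
    (b + 1 ∈ A ∧ b ∈ A ∧ β b = β (b + 1) ∧ sliceWeight β g (A \ Finset.Icc a b) ≤
      (∑ i ∈ leftEnds β A \ Finset.Icc a b, g (β i)) + g (β b)) := by
  classical
  by_cases h : b + 1 ∈ A ∧ b ∈ A ∧ β b = β (b + 1)
  · refine Or.inr ⟨h.1, h.2.1, h.2.2, ?_⟩
    have h1 : leftEnds β (A \ Finset.Icc a b) ⊆ (leftEnds β A \ Finset.Icc a b) ∪ {b + 1} := by
      refine (leftEnds_sdiff_subset a b).trans (Finset.union_subset_union_right ?_)
      exact Finset.filter_subset _ _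
    refine (Finset.sum_le_sum_of_subset_of_nonneg h1 fun i _ _ => hg _).trans ?_
    refine (Finset.sum_union_inter (s₁ := leftEnds β A \ Finset.Icc a b) (s₂ := {b + 1})
      (f := fun i => g (β i)) ▸ le_add_of_nonneg_right (Finset.sum_nonneg fun i _ => hg _)).trans ?_
    rw [Finset.sum_singleton, h.2.2]
  · refine Or.inl (Finset.sum_le_sum_of_subset_of_nonneg ?_ fun i _ _ => hg _)
    refine (leftEnds_sdiff_subset a b).trans (Finset.union_subset (Finset.Subset.refl _) ?_)
    intro i hi
    exact absurd (Finset.mem_filter.1 hi).2 h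

theorem sum_sdiff_add_sum_le (hg : ∀ i, 0 ≤ g i) {a b : ℕ} {s : Finset ℕ}
    (hs : ∀ i ∈ s, i ∈ leftEnds β A ∧ a ≤ i ∧ i ≤ b) :
    (∑ i ∈ leftEnds β A \ Finset.Icc a b, g (β i)) + ∑ i ∈ s, g (β i) ≤ sliceWeight β g A := by
  rw [← Finset.sum_union]
  · refine Finset.sum_le_sum_of_subset_of_nonneg ?_ fun i _ _ => hg _
    exact Finset.union_subset Finset.sdiff_subset fun i hi => (hs i hi).1
  · refine Finset.disjoint_left.2 fun i h1 h2 => ?_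
    exact (Finset.mem_sdiff.1 h1).2 (Finset.mem_Icc.2 (hs i h2).2)

/-- At most one slice is created, as the remainder of the slice through `b`. If that slice starts
before `a`, it contains `v` and has the weight of the block of `v`; if it starts inside the
interval, its removed left end pays for the new one. -/
theorem sliceWeight_sdiff_Icc_le (hg : ∀ i, 0 ≤ g i) {a v b : ℕ} (hav : a ≤ v) (hvb : v ≤ b) :
    sliceWeight β g (A \ Finset.Icc a b) ≤ sliceWeight β g A + g (β v) := by
  have h0 := sum_sdiff_add_sum_le hg (β := β) (A := A) (a := a) (b := b) (s := ∅) (by simp)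
  rw [Finset.sum_empty, add_zero] at h0
  rcases sliceWeight_sdiff_le_sum hg (β := β) (A := A) a b with h | ⟨-, hbA, -, h⟩
  · linarith [hg (β v)]
  obtain ⟨l, hl, hl1, hl2⟩ := exists_leftEnd (β := β) hbA
  rcases Nat.lt_or_ge l a with hla | hla
  · rw [(hl2 v (by omega) hvb).2]
    linarith
  · have h1 := sum_sdiff_add_sum_le hg (β := β) (A := A) (a := a) (b := b) (s := {l})
      (by simp [hl1, hla, hl])
    rw [Finset.sum_singleton, (hl2 l le_rfl hl).2] at h1
    linarith [hg (β v)]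

/-- The whole slice of `v` is removed, left end included. A slice left over at `b + 1` is paid for
by the left end of the slice through `b`, which is also removed and is a different one. -/
theorem sliceWeight_sdiff_Icc_add_le (hg : ∀ i, 0 ≤ g i) {a v b : ℕ} (hav : a ≤ v) (hvb : v ≤ b)
    (hvA : v ∈ A)
    (hcov : ∀ i, (∀ m ∈ Finset.uIcc v i, m ∈ A ∧ β m = β v) → a ≤ i ∧ i ≤ b) :
    sliceWeight β g (A \ Finset.Icc a b) + g (β v) ≤ sliceWeight β g A := by
  obtain ⟨lv, hlv, hlv1, hlv2⟩ := exists_leftEnd (β := β) hvA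
  have hlvI : a ≤ lv ∧ lv ≤ b := by
    refine hcov lv fun m hm => ?_
    rw [Finset.uIcc_of_ge hlv, Finset.mem_Icc] at hm
    exact hlv2 m hm.1 hm.2
  rcases sliceWeight_sdiff_le_sum hg (β := β) (A := A) a b with h | ⟨hb1, hbA, hbb, h⟩
  · have h1 := sum_sdiff_add_sum_le hg (β := β) (A := A) (a := a) (b := b) (s := {lv})
      (by simp [hlv1, hlvI])
    rw [Finset.sum_singleton, (hlv2 lv le_rfl hlv).2] at h1
    linarith
  obtain ⟨l, hl, hl1, hl2⟩ := exists_leftEnd (β := β) hbA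
  -- Otherwise the slice of `v` would run through `b` to `b + 1`, and `hcov` would put `b + 1`
  -- inside the interval.
  have hvl : v < l := by
    by_contra hc
    push Not at hc
    have hv := (hl2 v hc hvb).2
    have h2 := hcov (b + 1) fun m hm => by
      rw [Finset.uIcc_of_le (by omega), Finset.mem_Icc] at hm
      rcases Nat.lt_or_ge b m with h3 | h3
      · obtain rfl : m = b + 1 := by omega
        exact ⟨hb1, hbb.symm.trans hv.symm⟩
      · exact ⟨(hl2 m (by omega) h3).1, (hl2 m (by omega) h3).2.trans hv.symm⟩
    omega
  have h1 := sum_sdiff_add_sum_le hg (β := β) (A := A) (a := a) (b := b) (s := {lv, l})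
    (by
      intro i hi
      rw [Finset.mem_insert, Finset.mem_singleton] at hi
      rcases hi with rfl | rfl
      · exact ⟨hlv1, hlvI⟩
      · exact ⟨hl1, by omega, hl⟩)
  rw [Finset.sum_pair (by omega), (hlv2 lv le_rfl hlv).2, (hl2 l le_rfl hl).2] at h1
  linarith

end slices

/-! Blocks: a partition of a path into intervals that are short compared to the values of `D`. -/

section blocks

/-- The first position of the block of a position. -/
def blockStart (γ : ℝ) (pos D : ℕ → ℝ) : ℕ → ℕ
  | 0 => 0
  | i + 1 => if pos (i + 1) - pos (blockStart γ pos D i) ≤ γ * D (blockStart γ pos D i) then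
      blockStart γ pos D i else i + 1

variable {γ : ℝ} {pos D : ℕ → ℝ}

local notation "β" => blockStart γ pos D

theorem blockStart_le (i : ℕ) : β i ≤ i := by
  induction i with
  | zero => exact le_rfl
  | succ i ih => rw [blockStart]; split_ifs <;> omega

theorem blockStart_succ (i : ℕ) : β (i + 1) = β i ∨ β (i + 1) = i + 1 := by
  rw [blockStart]; split_ifs <;> simp

theorem pos_sub_pos_blockStart_le (hγ : 0 ≤ γ) (hD : ∀ i, 0 ≤ D i) (i : ℕ) :
    pos i - pos (β i) ≤ γ * D (β i) := by
  cases i with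
  | zero => simpa [blockStart] using mul_nonneg hγ (hD 0)
  | succ i =>
    by_cases h : pos (i + 1) - pos (β i) ≤ γ * D (β i)
    · rw [blockStart, if_pos h]; exact h
    · rw [blockStart, if_neg h, sub_self]; exact mul_nonneg hγ (hD _)

/-- A block ends only when the next position is more than `γ D` beyond its start, so every block but
the last is paid for by a stretch of the path of its own. -/
theorem sum_blockStarts_le (h0 : pos 0 = 0) (n : ℕ) :
    ∑ i ∈ (Finset.range (n + 1)).filter (fun i => β i = i), γ * D i ≤
      pos (β n) + γ * D (β n) := by
  induction n with
  | zero => simp [Finset.filter_singleton, blockStart, h0]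
  | succ n ih =>
    rw [Finset.range_add_one, Finset.filter_insert]
    have hle := blockStart_le (γ := γ) (pos := pos) (D := D) n
    by_cases h : pos (n + 1) - pos (β n) ≤ γ * D (β n)
    · have h1 : β (n + 1) = β n := by rw [blockStart, if_pos h]
      rw [if_neg (by rw [h1]; omega), h1]
      exact ih
    · have h1 : β (n + 1) = n + 1 := by rw [blockStart, if_neg h]
      rw [if_pos h1, Finset.sum_insert (by simp), h1]
      push Not at h
      linarith

end blocks

/-! Detours. -/

/-- If a path of `n` edges is covered by intervals whose ends have distance zero with respect to `ρ`,
where the ends of each interval do not belong to any earlier interval, then the `ρ`-distance of the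
ends of the path is bounded by the total cost of the intervals. -/
theorem le_sum_of_detours {ι : Type*} [LinearOrder ι] {ρ : ℕ → ℕ → ℝ≥0∞}
    (htri : ∀ i j l, ρ i l ≤ ρ i j + ρ j l) {n : ℕ} {h w : ℕ → ℝ≥0∞}
    (hstep : ∀ i < n, ρ i (i + 1) ≤ h i + w i + h (i + 1)) {T : Finset ι} {a b : ι → ℕ}
    {H : ι → ℝ≥0∞} (hab : ∀ s ∈ T, a s ≤ b s ∧ b s ≤ n) (hρ : ∀ s ∈ T, ρ (a s) (b s) = 0)
    (hH : ∀ s ∈ T, h (a s) + h (b s) ≤ H s + ∑ i ∈ Finset.Ico (a s) (b s), w i)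
    (hlam : ∀ s ∈ T, ∀ s' ∈ T, s' < s →
      ¬ (a s' ≤ a s ∧ a s ≤ b s') ∧ ¬ (a s' ≤ b s ∧ b s ≤ b s'))
    (hcov : ∀ i ≤ n, ∃ s ∈ T, a s ≤ i ∧ i ≤ b s) :
    ρ 0 n ≤ ∑ s ∈ T, H s + ∑ i ∈ Finset.range n, w i := by
  classical
  have hlast : ∀ i ≤ n, ∃ s ∈ T, (a s ≤ i ∧ i ≤ b s) ∧
      ∀ s' ∈ T, a s' ≤ i ∧ i ≤ b s' → s' ≤ s := by
    intro i hi
    have hne : (T.filter fun s => a s ≤ i ∧ i ≤ b s).Nonempty := by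
      obtain ⟨s, hs, h⟩ := hcov i hi
      exact ⟨s, Finset.mem_filter.2 ⟨hs, h⟩⟩
    have hm := Finset.max'_mem _ hne
    rw [Finset.mem_filter] at hm
    exact ⟨_, hm.1, hm.2, fun s' h1 h2 => Finset.le_max' _ _ (Finset.mem_filter.2 ⟨h1, h2⟩)⟩
  have hend : ∀ s ∈ T, b s = n → ρ (a s) n + h (a s) ≤
      ∑ s' ∈ T.filter (fun s' => a s ≤ a s'), H s' + ∑ i ∈ Finset.Ico (a s) n, w i := by
    intro s hs hb
    have h2 := hρ s hs
    have h3 := hH s hs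
    rw [hb] at h2 h3
    have h4 : H s ≤ ∑ s' ∈ T.filter (fun s' => a s ≤ a s'), H s' :=
      Finset.single_le_sum (fun i _ => (zero_le : 0 ≤ H i)) (Finset.mem_filter.2 ⟨hs, le_rfl⟩)
    rw [h2, zero_add]
    have h5 : h (a s) ≤ h (a s) + h n := le_self_add
    exact h5.trans (h3.trans (add_le_add h4 le_rfl))
  -- Greedy traversal: with `s` the latest interval at `a s`, jump to `b s` for free, cross one edge
  -- and go on with the latest interval at `b s + 1`. The term `h (a s)` on the left pays for the
  -- edge by which the interval is entered.
  have key : ∀ N : ℕ, ∀ s ∈ T, n - a s ≤ N →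
      (∀ s' ∈ T, a s' ≤ a s ∧ a s ≤ b s' → s' ≤ s) →
      ρ (a s) n + h (a s) ≤ ∑ s' ∈ T.filter (fun s' => a s ≤ a s'), H s' +
        ∑ i ∈ Finset.Ico (a s) n, w i := by
    intro N
    induction N with
    | zero =>
      intro s hs hN _
      have h1 := hab s hs
      exact hend s hs (by omega)
    | succ N ih =>
      intro s hs hN hmax
      have h1 := hab s hs
      rcases h1.2.eq_or_lt with hb | hb
      · exact hend s hs hb
      obtain ⟨s', hs', hc', hmax'⟩ := hlast (b s + 1) hb
      -- If `s'` started earlier, it would contain `b s`, which is excluded for `s' < s`; for `s <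
      -- s'` it would have to start before `a s`, so `s` would not be the latest interval at `a s`.
      have ha' : a s' = b s + 1 := by
        by_contra hne
        have hle : a s' ≤ b s := by omega
        rcases lt_trichotomy s' s with hlt | rfl | hlt
        · exact (hlam s hs s' hs' hlt).2 ⟨hle, by omega⟩
        · omega
        · have h3 := (hlam s' hs' s hs hlt).1
          have h4 : a s' < a s := by omega
          exact absurd (hmax s' hs' ⟨h4.le, by omega⟩) (not_le.2 hlt)
      have hrec := ih s' hs' (by omega) (by rw [ha']; exact hmax')
      have hst := hstep (b s) hb
      rw [← ha'] at hst
      have hsum : H s + ∑ s'' ∈ T.filter (fun s'' => a s' ≤ a s''), H s'' ≤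
          ∑ s'' ∈ T.filter (fun s'' => a s ≤ a s''), H s'' := by
        rw [← Finset.sum_insert (s := T.filter (fun s'' => a s' ≤ a s''))
          (by rw [Finset.mem_filter]; omega)]
        refine Finset.sum_le_sum_of_subset fun s'' hs'' => ?_
        rw [Finset.mem_insert, Finset.mem_filter] at hs''
        rw [Finset.mem_filter]
        rcases hs'' with rfl | hs''
        · exact ⟨hs, le_rfl⟩
        · exact ⟨hs''.1, by omega⟩
      have hw : ∑ i ∈ Finset.Ico (a s) (b s), w i + (w (b s) + ∑ i ∈ Finset.Ico (a s') n, w i) =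
          ∑ i ∈ Finset.Ico (a s) n, w i := by
        rw [ha', ← Finset.sum_eq_sum_Ico_succ_bot hb, Finset.sum_Ico_consecutive _ h1.1 h1.2]
      calc ρ (a s) n + h (a s)
          ≤ (ρ (a s) (b s) + (ρ (b s) (a s') + ρ (a s') n)) + h (a s) :=
            add_le_add_left ((htri _ (b s) _).trans (add_le_add_right (htri _ (a s') _) _)) _
        _ ≤ (0 + ((h (b s) + w (b s) + h (a s')) + ρ (a s') n)) + h (a s) := by
            rw [hρ s hs]
            gcongr
        _ = (h (a s) + h (b s)) + (w (b s) + (ρ (a s') n + h (a s'))) := by ring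
        _ ≤ (H s + ∑ i ∈ Finset.Ico (a s) (b s), w i) +
            (w (b s) + (∑ s'' ∈ T.filter (fun s'' => a s' ≤ a s''), H s'' +
              ∑ i ∈ Finset.Ico (a s') n, w i)) := by
            exact add_le_add (hH s hs) (add_le_add le_rfl hrec)
        _ = (H s + ∑ s'' ∈ T.filter (fun s'' => a s' ≤ a s''), H s'') +
            (∑ i ∈ Finset.Ico (a s) (b s), w i +
              (w (b s) + ∑ i ∈ Finset.Ico (a s') n, w i)) := by ring
        _ ≤ _ := by rw [hw]; gcongr
  obtain ⟨s, hs, hc, hmax⟩ := hlast 0 (Nat.zero_le _)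
  have ha : a s = 0 := by omega
  have h1 := key (n - a s) s hs le_rfl (by rw [ha]; exact hmax)
  rw [ha] at h1
  refine le_self_add.trans (h1.trans ?_)
  rw [Finset.range_eq_Ico]
  gcongr
  exact Finset.filter_subset _ _

end SPR

end

/-! ### Routes: bookkeeping of detours along a path between terminals. -/

noncomputable section

namespace SPR

open MeasureTheory ProbabilityTheory

variable {V : Type*} {k : ℕ}

/-- A walk between terminals, with the positions of its vertices along it. -/
structure Route (G : WGraph V) (t : Fin k ↪ V) where
  n : ℕ
  pt : ℕ → V
  pos : ℕ → ℝ
  pos_zero : pos 0 = 0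
  mono : Monotone pos
  adj : ∀ i < n, G.graph.Adj (pt i) (pt (i + 1))
  weight : ∀ i < n, (G.weight s(pt i, pt (i + 1)) : ℝ) = pos (i + 1) - pos i
  start_mem : pt 0 ∈ Set.range t
  end_mem : pt n ∈ Set.range t

namespace Route

variable {G : WGraph V} {t : Fin k ↪ V} (R : Route G t)

/-- The distance of a vertex of the route to the terminals. -/
def D (i : ℕ) : ℝ := (G.termDist t (R.pt i)).toReal

theorem D_nonneg (i : ℕ) : 0 ≤ R.D i := ENNReal.toReal_nonneg

theorem D_eq_zero {i : ℕ} (h : R.pt i ∈ Set.range t) : R.D i = 0 := by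
  obtain ⟨j, hj⟩ := h
  rw [D, ← hj, WGraph.termDist_term, ENNReal.toReal_zero]

theorem distOn_le {B : Set V} {i l : ℕ} (hi : i ≤ R.n) (hl : l ≤ R.n)
    (hB : ∀ m ∈ Finset.uIcc i l, R.pt m ∈ B) :
    G.distOn B (R.pt i) (R.pt l) ≤ ENNReal.ofReal |R.pos l - R.pos i| := by
  have key : ∀ d i : ℕ, i + d ≤ R.n → (∀ m, i ≤ m → m ≤ i + d → R.pt m ∈ B) →
      G.distOn B (R.pt i) (R.pt (i + d)) ≤ ENNReal.ofReal (R.pos (i + d) - R.pos i) := by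
    intro d
    induction d with
    | zero =>
      intro i _ h
      rw [add_zero, WGraph.distOn_self (h i le_rfl le_rfl)]
      exact zero_le
    | succ d ih =>
      intro i hn h
      have h1 := ih i (by omega) fun m h1 h2 => h m h1 (by omega)
      have hadj := R.adj (i + d) (by omega)
      have h2 : G.distOn B (R.pt (i + d)) (R.pt (i + d + 1)) ≤
          ENNReal.ofReal (R.pos (i + d + 1) - R.pos (i + d)) := by
        rw [← R.weight _ (by omega), ENNReal.ofReal_coe_nnreal]
        refine (WGraph.distOn_le_len (SimpleGraph.Walk.cons hadj SimpleGraph.Walk.nil) ?_).trans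
          (by simp)
        intro x hx
        simp only [SimpleGraph.Walk.support_cons, SimpleGraph.Walk.support_nil, List.mem_cons,
          List.not_mem_nil, or_false] at hx
        rcases hx with rfl | rfl
        · exact h _ (by omega) (by omega)
        · exact h _ (by omega) (by omega)
      refine (WGraph.distOn_triangle B _ (R.pt (i + d)) _).trans ((add_le_add h1 h2).trans ?_)
      rw [← ENNReal.ofReal_add (sub_nonneg.2 (R.mono (by omega)))
        (sub_nonneg.2 (R.mono (by omega)))]
      refine ENNReal.ofReal_le_ofReal (le_of_eq ?_)
      rw [← add_assoc]; ring
  rcases le_total i l with h | h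
  · obtain ⟨d, rfl⟩ := Nat.exists_eq_add_of_le h
    rw [abs_of_nonneg (sub_nonneg.2 (R.mono h))]
    exact key d i hl fun m h1 h2 => hB m (by rw [Finset.uIcc_of_le h, Finset.mem_Icc]; exact ⟨h1, h2⟩)
  · obtain ⟨d, rfl⟩ := Nat.exists_eq_add_of_le h
    rw [abs_sub_comm, abs_of_nonneg (sub_nonneg.2 (R.mono h)), WGraph.distOn_comm]
    exact key d l hi fun m h1 h2 => hB m (by rw [Finset.uIcc_of_ge h, Finset.mem_Icc]; exact ⟨h1, h2⟩)

theorem dist_le {i l : ℕ} (hi : i ≤ R.n) (hl : l ≤ R.n) :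
    G.dist (R.pt i) (R.pt l) ≤ ENNReal.ofReal |R.pos l - R.pos i| :=
  R.distOn_le hi hl fun _ _ => Set.mem_univ _

section

variable [NeZero k] (hc : G.graph.Connected)
include hc

theorem termDist_ne_top (v : V) : G.termDist t v ≠ ⊤ :=
  ne_top_of_le_ne_top (WGraph.dist_ne_top hc v (t 0)) (WGraph.termDist_le t v 0)

theorem D_le_add {i l : ℕ} (hi : i ≤ R.n) (hl : l ≤ R.n) :
    R.D i ≤ R.D l + |R.pos l - R.pos i| := by
  have h1 := (WGraph.termDist_le_add t (R.pt i) (R.pt l)).trans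
    (add_le_add_left (R.dist_le hi hl) _)
  have h2 := ENNReal.toReal_mono
    (ENNReal.add_ne_top.2 ⟨ENNReal.ofReal_ne_top, termDist_ne_top hc (R.pt l)⟩) h1
  rw [ENNReal.toReal_add ENNReal.ofReal_ne_top (termDist_ne_top hc _),
    ENNReal.toReal_ofReal (abs_nonneg _)] at h2
  change R.D i ≤ _ + R.D l at h2
  linarith

theorem D_le_pos {i : ℕ} (hi : i ≤ R.n) : R.D i ≤ R.pos R.n := by
  have h := R.D_le_add hc hi (Nat.zero_le _)
  rw [R.D_eq_zero R.start_mem, zero_add, R.pos_zero, zero_sub, abs_neg,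
    abs_of_nonneg (by rw [← R.pos_zero]; exact R.mono (Nat.zero_le _))] at h
  exact h.trans (R.mono hi)

end

/-- The first position of the block of a position of the route. -/
def block (γ : ℝ) : ℕ → ℕ := blockStart γ R.pos R.D

open Classical in
/-- The positions of the Steiner vertices. -/
def steiner : Finset ℕ := (Finset.range (R.n + 1)).filter fun i => R.pt i ∉ Set.range t

theorem mem_steiner {i : ℕ} : i ∈ R.steiner ↔ i ≤ R.n ∧ R.pt i ∉ Set.range t := by
  simp [steiner]

theorem abs_pos_sub_le {γ : ℝ} (hγ : 0 ≤ γ) {i l : ℕ} (h : R.block γ i = R.block γ l) :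
    |R.pos i - R.pos l| ≤ γ * R.D (R.block γ l) := by
  have h1 := pos_sub_pos_blockStart_le (pos := R.pos) hγ R.D_nonneg i
  have h2 := pos_sub_pos_blockStart_le (pos := R.pos) hγ R.D_nonneg l
  have h3 := R.mono (blockStart_le (γ := γ) (pos := R.pos) (D := R.D) i)
  have h4 := R.mono (blockStart_le (γ := γ) (pos := R.pos) (D := R.D) l)
  unfold block at h ⊢
  rw [h] at h1 h3
  rw [abs_le]
  constructor <;> linarith

/-- The distance to the terminals is 1-Lipschitz along the route, and a position is within `γ D` of
the start of its block. -/
theorem D_block_le [NeZero k] (hc : G.graph.Connected) {γ : ℝ} (hγ : 0 ≤ γ) {i : ℕ}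
    (hi : i ≤ R.n) : R.D (R.block γ i) ≤ R.D i + γ * R.D (R.block γ i) ∧
      R.D i ≤ R.D (R.block γ i) + γ * R.D (R.block γ i) := by
  have hb : R.block γ i ≤ i := blockStart_le i
  have h1 := R.D_le_add hc (hb.trans hi) hi
  have h2 := R.D_le_add hc hi (hb.trans hi)
  have h3 : R.pos i - R.pos (R.block γ i) ≤ γ * R.D (R.block γ i) :=
    pos_sub_pos_blockStart_le hγ R.D_nonneg i
  have h4 := R.mono hb
  rw [abs_of_nonneg (by linarith)] at h1
  rw [abs_sub_comm, abs_of_nonneg (by linarith)] at h2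
  constructor <;> linarith

/-- Initially every slice starts at a block start: a block that contains a terminal has `D = 0` at
its start because `γ < 1`, so it contains no Steiner vertex. The last block contains a terminal and
has weight `0`, so the block starts add up to at most the length divided by `γ`. -/
theorem sliceWeight_steiner_le [Finite V] [NeZero k] (hG : G.Positive) (hc : G.graph.Connected)
    {γ : ℝ} (hγ : 0 < γ) (hγ1 : γ < 1) :
    γ * sliceWeight (R.block γ) R.D R.steiner ≤ R.pos R.n := by
  have hzero : ∀ i ≤ R.n, R.pt i ∈ Set.range t → R.D (R.block γ i) = 0 := by
    intro i hi h
    have h1 := (R.D_block_le hc hγ.le hi).1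
    rw [R.D_eq_zero h] at h1
    have h2 := R.D_nonneg (R.block γ i)
    nlinarith
  have hsub : leftEnds (R.block γ) R.steiner ⊆
      (Finset.range (R.n + 1)).filter (fun i => R.block γ i = i) := by
    intro i hi
    rw [mem_leftEnds] at hi
    obtain ⟨hi1, hi2⟩ := hi
    rw [mem_steiner] at hi1
    rw [Finset.mem_filter, Finset.mem_range]
    refine ⟨by omega, ?_⟩
    cases i with
    | zero => rfl
    | succ i =>
      rcases blockStart_succ (γ := γ) (pos := R.pos) (D := R.D) i with h | h
      swap
      · exact h
      exfalso
      have h' : R.block γ (i + 1) = R.block γ i := h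
      have hit : R.pt i ∈ Set.range t := by
        by_contra hc'
        exact hi2 ⟨i, R.mem_steiner.2 ⟨by omega, hc'⟩, rfl, h'.symm⟩
      have h1 := (R.D_block_le hc hγ.le hi1.1).2
      rw [h', hzero i (by omega) hit] at h1
      have h2 : 0 < R.D (i + 1) := by
        obtain ⟨j, hj⟩ := WGraph.exists_termDist_eq (G := G) t (R.pt (i + 1))
        refine ENNReal.toReal_pos ?_ (termDist_ne_top hc _)
        rw [hj]
        exact (WGraph.dist_pos hG fun h => hi1.2 ⟨j, h.symm⟩).ne'
      linarith
  have h1 : sliceWeight (R.block γ) R.D R.steiner ≤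
      ∑ i ∈ (Finset.range (R.n + 1)).filter (fun i => R.block γ i = i), R.D i := by
    refine (Finset.sum_le_sum_of_subset_of_nonneg hsub fun i _ _ => R.D_nonneg _).trans
      (le_of_eq ?_)
    exact Finset.sum_congr rfl fun i hi => by rw [(Finset.mem_filter.1 hi).2]
  have h2 := sum_blockStarts_le (γ := γ) (D := R.D) R.pos_zero R.n
  have h3 := hzero R.n le_rfl R.end_mem
  have h4 := R.mono (blockStart_le (γ := γ) (pos := R.pos) (D := R.D) R.n)
  rw [← Finset.mul_sum] at h2
  change _ ≤ R.pos (R.block γ R.n) + γ * R.D (R.block γ R.n) at h2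
  change R.pos (R.block γ R.n) ≤ _ at h4
  rw [h3, mul_zero, add_zero] at h2
  exact (mul_le_mul_of_nonneg_left h1 hγ.le).trans (h2.trans h4)

open Classical in
/-- The position in `A` that is the first to be reached by a growing ball in `G[B]`. -/
def firstHit (B : Set V) (j : Fin k) (A : Finset ℕ) : ℕ :=
  if h : A.Nonempty then (A.exists_min_image (fun i => G.distOn B (t j) (R.pt i)) h).choose else 0

theorem firstHit_spec (B : Set V) (j : Fin k) {A : Finset ℕ} (h : A.Nonempty) :
    R.firstHit B j A ∈ A ∧
      ∀ i ∈ A, G.distOn B (t j) (R.pt (R.firstHit B j A)) ≤ G.distOn B (t j) (R.pt i) := by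
  rw [firstHit, dif_pos h]
  exact (A.exists_min_image (fun i => G.distOn B (t j) (R.pt i)) h).choose_spec

open Classical in
/-- The positions in `A` that are covered by the cluster `U`. -/
def hits (U : Set V) (A : Finset ℕ) : Finset ℕ := A.filter fun i => R.pt i ∈ U

theorem mem_hits {U : Set V} {A : Finset ℕ} {i : ℕ} : i ∈ R.hits U A ↔ i ∈ A ∧ R.pt i ∈ U := by
  simp [hits]

open Classical in
/-- The active positions that remain, and the cost of the detour, when terminal `j` grows its cluster
to `U` in `G[B]` and the active positions are `A`. No cost is charged, and all positions become
inactive, if the first vertex that is reached is too far from the terminals. -/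
def track (γ thr : ℝ) (j : Fin k) (B U : Set V) (A : Finset ℕ) : Finset ℕ × ℝ :=
  if h : (R.hits U A).Nonempty then
    if thr < R.D (R.firstHit B j A) then (∅, 0)
    else (A \ Finset.Icc ((R.hits U A).min' h) ((R.hits U A).max' h),
      R.D (R.block γ (R.firstHit B j A)))
  else (A, 0)

theorem track_subset (γ thr : ℝ) (j : Fin k) (B U : Set V) (A : Finset ℕ) :
    (R.track γ thr j B U A).1 ⊆ A := by
  unfold track
  split_ifs
  · exact Finset.empty_subset _
  · exact Finset.sdiff_subset
  · exact Finset.Subset.refl _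

theorem pt_notMem_of_mem_track {γ thr : ℝ} {j : Fin k} {B U : Set V} {A : Finset ℕ} {i : ℕ}
    (hi : i ∈ (R.track γ thr j B U A).1) : R.pt i ∉ U := by
  intro hU
  have hiC : i ∈ R.hits U A := R.mem_hits.2 ⟨R.track_subset _ _ _ _ _ _ hi, hU⟩
  have hne : (R.hits U A).Nonempty := ⟨i, hiC⟩
  unfold track at hi
  rw [dif_pos hne] at hi
  split_ifs at hi
  · simp at hi
  · exact (Finset.mem_sdiff.1 hi).2 (Finset.mem_Icc.2 ⟨Finset.min'_le _ _ hiC, Finset.le_max' _ _ hiC⟩)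

theorem track_of_hits_empty {γ thr : ℝ} {j : Fin k} {B U : Set V} {A : Finset ℕ}
    (h : R.hits U A = ∅) : R.track γ thr j B U A = (A, 0) := by
  rw [track, dif_neg (by rw [h]; simp)]

/-- One step of the algorithm together with the bookkeeping for the route. -/
def trackStep (γ : ℝ) (thr : ℕ → ℝ) (l : ℕ) (j : Fin k) (e : State V k × Finset ℕ × ℝ) (x : ℝ) :
    State V k × Finset ℕ × ℝ :=
  (e.1.step G t j x,
    (R.track γ (thr l) j (e.1.avail j) ((e.1.step G t j x).cluster j) e.2.1).1,
    e.2.2 + (R.track γ (thr l) j (e.1.avail j) ((e.1.step G t j x).cluster j) e.2.1).2)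

/-- The invariant of the bookkeeping: active positions are unclustered. -/
def TrackValid (e : State V k × Finset ℕ × ℝ) : Prop :=
  e.1.Valid G t ∧ ∀ i ∈ e.2.1, i ≤ R.n ∧ R.pt i ∈ e.1.unclustered

variable {R}

theorem TrackValid.step [Finite V] {e : State V k × Finset ℕ × ℝ} (he : R.TrackValid e) (γ : ℝ)
    (thr : ℕ → ℝ) (l : ℕ) (j : Fin k) {x : ℝ} (hx : 0 ≤ x) :
    R.TrackValid (R.trackStep γ thr l j e x) := by
  refine ⟨he.1.step j hx, fun i hi => ?_⟩
  have h1 := he.2 i (R.track_subset _ _ _ _ _ _ hi)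
  exact ⟨h1.1, he.1.mem_unclustered_step h1.2 (R.pt_notMem_of_mem_track hi)⟩

theorem trackValid_init [Finite V] (hG : G.Positive) :
    R.TrackValid (State.init t, R.steiner, 0) := by
  refine ⟨State.valid_init hG, fun i hi => ?_⟩
  have h := R.mem_steiner.1 hi
  refine ⟨h.1, State.mem_unclustered.2 fun j hj => h.2 ⟨j, ?_⟩⟩
  exact (show R.pt i = t j from hj).symm

instance instMeasurableSpaceFinsetNat : MeasurableSpace (Finset ℕ) := ⊤

variable (R)

theorem measurable_track [Finite V] (γ thr : ℝ) (j : Fin k) :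
    Measurable fun y : Set V × Set V × Finset ℕ => R.track γ thr j y.1 y.2.1 y.2.2 :=
  measurable_of_countable _

theorem measurable_trackStep [Finite V] (γ : ℝ) (thr : ℕ → ℝ) (l : ℕ) (j : Fin k) :
    Measurable fun z : (State V k × Finset ℕ × ℝ) × ℝ => R.trackStep γ thr l j z.1 z.2 := by
  have hstep : Measurable fun z : (State V k × Finset ℕ × ℝ) × ℝ => z.1.1.step G t j z.2 :=
    (State.measurable_step G t j).comp
      ((measurable_fst.comp measurable_fst).prodMk measurable_snd)
  have hz : Measurable fun z : (State V k × Finset ℕ × ℝ) × ℝ => z.1.1 :=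
    measurable_fst.comp measurable_fst
  have hA : Measurable fun z : (State V k × Finset ℕ × ℝ) × ℝ => z.1.2.1 :=
    measurable_fst.comp (measurable_snd.comp measurable_fst)
  have hK : Measurable fun z : (State V k × Finset ℕ × ℝ) × ℝ => z.1.2.2 :=
    measurable_snd.comp (measurable_snd.comp measurable_fst)
  have hd : Measurable fun z : (State V k × Finset ℕ × ℝ) × ℝ =>
      R.track γ (thr l) j (z.1.1.avail j) ((z.1.1.step G t j z.2).cluster j) z.1.2.1 :=
    (R.measurable_track γ (thr l) j).comp (f := fun z : (State V k × Finset ℕ × ℝ) × ℝ =>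
      (z.1.1.avail j, (z.1.1.step G t j z.2).cluster j, z.1.2.1))
      (((State.measurable_avail j).comp hz).prodMk
        (((State.measurable_cluster_apply j).comp hstep).prodMk hA))
  exact hstep.prodMk ((measurable_fst.comp hd).prodMk (hK.add (measurable_snd.comp hd)))

/-- The exponential moment, with parameter `s`, of the costs and the weight of the slices. -/
def trackMoment (γ s : ℝ) (e : State V k × Finset ℕ × ℝ) : ℝ≥0∞ :=
  ENNReal.ofReal (Real.exp (s * (e.2.2 + 2 * sliceWeight (R.block γ) R.D e.2.1)))

theorem measurable_trackMoment (γ s : ℝ) : Measurable (R.trackMoment γ s) := by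
  have h1 : Measurable fun A : Finset ℕ => sliceWeight (R.block γ) R.D A :=
    measurable_of_countable _
  have h2 : Measurable fun e : State V k × Finset ℕ × ℝ => sliceWeight (R.block γ) R.D e.2.1 :=
    h1.comp (measurable_fst.comp measurable_snd)
  have h3 : Measurable fun e : State V k × Finset ℕ × ℝ => e.2.2 :=
    measurable_snd.comp measurable_snd
  unfold trackMoment
  fun_prop

/-- The first position `v` to be reached does not depend on the increment. Let `w` be the weight of
its block. Reaching `v` costs `w`; stopping soon after may also add a slice of weight `w`, counted
twice, which raises the exponent by at most `3 s w`. After a further growth by `γ w` the slice of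
`v` is gone, which changes the exponent by at most `s w - 2 s w`. -/
theorem lintegral_trackMoment_step_le [Finite V] {γ s m : ℝ} {thr : ℕ → ℝ} {l : ℕ} (hγ : 0 ≤ γ)
    (hs : 0 ≤ s) (hm : 0 < m) (hsD : ∀ i ≤ R.n, s * R.D i ≤ 1 / 3)
    (hblock : ∀ i ≤ R.n, R.D i ≤ thr l → γ * R.D (R.block γ i) ≤ m / 20) (j : Fin k)
    {e : State V k × Finset ℕ × ℝ} (he : R.TrackValid e) :
    ∫⁻ x, R.trackMoment γ s (R.trackStep γ thr l j e x) ∂(expMeasure (1 / m)) ≤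
      R.trackMoment γ s e := by
  obtain ⟨S, A, K⟩ := e
  obtain ⟨hS, hA⟩ := he
  simp only at hS hA
  have hr : 0 < 1 / m := one_div_pos.2 hm
  set sw := sliceWeight (R.block γ) R.D A with hsw
  have hsame : ∀ x, R.hits ((S.step G t j x).cluster j) A = ∅ →
      R.trackMoment γ s (R.trackStep γ thr l j (S, A, K) x) = R.trackMoment γ s (S, A, K) := by
    intro x hx
    simp only [trackMoment, trackStep, R.track_of_hits_empty hx, add_zero]
  rcases A.eq_empty_or_nonempty with hAe | hAe
  · refine lintegral_expMeasure_le_const hr fun x _ => (hsame x ?_).le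
    rw [hAe]; rfl
  obtain ⟨hv, hmin⟩ := R.firstHit_spec (S.avail j) j hAe
  set v := R.firstHit (S.avail j) j A with hvdef
  have hvn : v ≤ R.n := (hA v hv).1
  -- If `v` is too far away, a hit empties the active set at no cost, so the exponent cannot rise.
  by_cases hearly : thr l < R.D v
  · refine lintegral_expMeasure_le_const hr fun x _ => ?_
    by_cases hne : (R.hits ((S.step G t j x).cluster j) A).Nonempty
    · simp only [trackMoment, trackStep, track]
      rw [dif_pos hne, if_pos hearly]
      refine ENNReal.ofReal_le_ofReal (Real.exp_le_exp.2 (mul_le_mul_of_nonneg_left ?_ hs))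
      have h0 : sliceWeight (R.block γ) R.D ∅ = 0 := by simp [sliceWeight, leftEnds]
      simp only [h0]
      linarith [sliceWeight_nonneg (β := R.block γ) (A := A) R.D_nonneg]
    · exact (hsame x (Finset.not_nonempty_iff_eq_empty.1 hne)).le
  push Not at hearly
  by_cases htop : G.distOn (S.avail j) (t j) (R.pt v) = ⊤
  · refine lintegral_expMeasure_le_const hr fun x _ => (hsame x ?_).le
    refine Finset.eq_empty_of_forall_notMem fun i hi => ?_
    obtain ⟨hiA, hi⟩ := R.mem_hits.1 hi
    rw [State.step_cluster_self] at hi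
    have h1 := hmin i hiA
    rw [htop, top_le_iff] at h1
    have h2 : G.distOn (S.avail j) (t j) (R.pt i) ≤ _ := hi
    rw [h1, top_le_iff] at h2
    exact ENNReal.ofReal_ne_top h2
  set d := (G.distOn (S.avail j) (t j) (R.pt v)).toReal with hd
  have hdd : G.distOn (S.avail j) (t j) (R.pt v) = ENNReal.ofReal d :=
    (ENNReal.ofReal_toReal htop).symm
  have hd0 : 0 ≤ d := ENNReal.toReal_nonneg
  have hRd : S.radius j < d := by
    have h1 := hS.outer j _ (hA v hv).2
    rw [hdd] at h1
    exact (ENNReal.ofReal_lt_ofReal_iff'.1 h1).1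
  have hR0 := hS.nonneg j
  have hhit : ∀ x, d - S.radius j ≤ x → v ∈ R.hits ((S.step G t j x).cluster j) A := by
    intro x hx
    refine R.mem_hits.2 ⟨hv, ?_⟩
    rw [State.step_cluster_self]
    change G.distOn _ _ _ ≤ _
    rw [hdd]
    exact ENNReal.ofReal_le_ofReal (by linarith)
  have hb : R.D (R.block γ v) ≤ R.D (R.block γ v) := le_rfl
  have hbn : R.block γ v ≤ R.n := (blockStart_le v).trans hvn
  refine lintegral_expMeasure_le_of_coin (θ := d - S.radius j) (L := γ * R.D (R.block γ v))
    (y := s * R.D (R.block γ v)) hr (by linarith) (mul_nonneg hγ (R.D_nonneg _)) ?_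
    (mul_nonneg hs (R.D_nonneg _)) (hsD _ hbn) (Real.exp_pos _).le ?_ ?_ ?_
  · have := hblock v hvn hearly
    rw [one_div, inv_mul_le_iff₀ hm]
    linarith
  · intro x hx hxθ
    refine (hsame x ?_).le
    refine Finset.eq_empty_of_forall_notMem fun i hi => ?_
    obtain ⟨hiA, hi⟩ := R.mem_hits.1 hi
    rw [State.step_cluster_self] at hi
    have h2 : G.distOn (S.avail j) (t j) (R.pt i) ≤ _ := hi
    have h1 := (hmin i hiA).trans h2
    rw [hdd] at h1
    have := (ENNReal.ofReal_le_ofReal_iff (by linarith)).1 h1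
    linarith
  · intro x hx
    have hvC := hhit x hx
    have hne : (R.hits ((S.step G t j x).cluster j) A).Nonempty := ⟨v, hvC⟩
    simp only [trackMoment, trackStep, track]
    rw [dif_pos hne, if_neg (not_lt.2 hearly), ← Real.exp_add]
    refine ENNReal.ofReal_le_ofReal (Real.exp_le_exp.2 ?_)
    have h1 := sliceWeight_sdiff_Icc_le (β := R.block γ) (A := A) R.D_nonneg
      (Finset.min'_le _ v hvC) (Finset.le_max' _ v hvC)
    simp only [← hvdef]
    nlinarith
  · intro x hx
    have hvC := hhit x (by linarith [mul_nonneg hγ (R.D_nonneg (R.block γ v))])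
    have hne : (R.hits ((S.step G t j x).cluster j) A).Nonempty := ⟨v, hvC⟩
    simp only [trackMoment, trackStep, track]
    rw [dif_pos hne, if_neg (not_lt.2 hearly), ← Real.exp_add]
    refine ENNReal.ofReal_le_ofReal (Real.exp_le_exp.2 ?_)
    -- The active run from `v` inside its block is unclustered, hence available to `j`, and is no
    -- longer than `γ` times the weight of the block; so the ball contains it.
    have h1 := sliceWeight_sdiff_Icc_add_le (β := R.block γ) (A := A) R.D_nonneg
      (Finset.min'_le _ v hvC) (Finset.le_max' _ v hvC) hv (fun i hi => by
        have hiA := (hi i Finset.right_mem_uIcc).1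
        have hin := (hA i hiA).1
        have hiC : i ∈ R.hits ((S.step G t j x).cluster j) A := by
          refine R.mem_hits.2 ⟨hiA, ?_⟩
          rw [State.step_cluster_self]
          change G.distOn _ _ _ ≤ _
          have h2 := R.distOn_le hvn hin (B := S.avail j)
            fun m hm => Or.inl (hA m (hi m hm).1).2
          refine (WGraph.distOn_triangle _ _ (R.pt v) _).trans ((add_le_add hdd.le h2).trans ?_)
          rw [← ENNReal.ofReal_add hd0 (abs_nonneg _)]
          refine ENNReal.ofReal_le_ofReal ?_
          have h3 := R.abs_pos_sub_le hγ (hi i Finset.right_mem_uIcc).2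
          linarith
        exact ⟨Finset.min'_le _ i hiC, Finset.le_max' _ i hiC⟩)
    simp only [← hvdef]
    nlinarith

/-- The total cost of the detours is unlikely to be much larger than the length of the route. -/
theorem measure_le_cost_le [Finite V] [NeZero k] (hG : G.Positive) (hc : G.graph.Connected)
    {Ω : Type*} [MeasurableSpace Ω] {P : Measure Ω} [IsProbabilityMeasure P] {m : ℕ → ℝ}
    {Y : ℕ → Ω → ℝ} (hY : ExpRounds P k m Y) {γ s : ℝ} {thr : ℕ → ℝ} (hγ : 0 < γ) (hγ1 : γ < 1)
    (hs : 0 ≤ s) (hsD : s * R.pos R.n ≤ 1 / 3)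
    (hblock : ∀ l, ∀ i ≤ R.n, R.D i ≤ thr l → γ * R.D (R.block γ i) ≤ m l / 20) (T : ℕ) (y : ℝ) :
    P {ω | y ≤ (roundRun (R.trackStep γ thr) (State.init t, R.steiner, 0) (fun n => Y n ω)
        (T * k)).2.2} ≤
      ENNReal.ofReal (Real.exp (s * (2 * R.pos R.n / γ - y))) := by
  have hmain := lintegral_roundRun_le hY (F := R.trackStep γ thr) (R.measurable_trackStep γ thr)
    (s := (State.init t, R.steiner, 0)) (Inv := R.TrackValid) (trackValid_init hG)
    (fun l j e x he hx => he.step γ thr l j hx)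
    (W := fun _ _ => R.trackMoment γ s) (fun _ _ => R.measurable_trackMoment γ s)
    (fun _ _ => rfl) (T := T)
    (fun l hl j e he => R.lintegral_trackMoment_step_le hγ.le hs (hY.pos l)
      (fun i hi => (mul_le_mul_of_nonneg_left (R.D_le_pos hc hi) hs).trans hsD) (hblock l) j he)
  have h0 : R.trackMoment γ s (State.init t, R.steiner, 0) ≤
      ENNReal.ofReal (Real.exp (s * (2 * R.pos R.n / γ))) := by
    refine ENNReal.ofReal_le_ofReal (Real.exp_le_exp.2 (mul_le_mul_of_nonneg_left ?_ hs))
    have h1 := R.sliceWeight_steiner_le hG hc hγ hγ1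
    rw [mul_comm] at h1
    have h2 := (le_div_iff₀ hγ).2 h1
    simp only [zero_add]
    rw [mul_div_assoc]
    linarith
  have hmk := mul_meas_ge_le_lintegral (μ := P) (f := fun ω => R.trackMoment γ s
    (roundRun (R.trackStep γ thr) (State.init t, R.steiner, 0) (fun n => Y n ω) (T * k)))
    ((R.measurable_trackMoment γ s).comp (measurable_roundRun hY
      (R.measurable_trackStep γ thr) (State.init t, R.steiner, 0) (T * k)))
    (ENNReal.ofReal (Real.exp (s * y)))
  have hexp : ENNReal.ofReal (Real.exp (-(s * y))) * ENNReal.ofReal (Real.exp (s * y)) = 1 := by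
    rw [← ENNReal.ofReal_mul (Real.exp_pos _).le, ← Real.exp_add]; simp
  rw [show s * (2 * R.pos R.n / γ - y) = -(s * y) + s * (2 * R.pos R.n / γ) by ring, Real.exp_add,
    ENNReal.ofReal_mul (Real.exp_pos _).le]
  refine le_trans ?_ (mul_le_mul_right (hmk.trans (hmain.trans h0)) _)
  rw [← mul_assoc, hexp, one_mul]
  refine measure_mono fun ω hω => ?_
  simp only [Set.mem_ofPred_eq, trackMoment]
  refine ENNReal.ofReal_le_ofReal (Real.exp_le_exp.2 (mul_le_mul_of_nonneg_left ?_ hs))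
  have h1 : 0 ≤ sliceWeight (R.block γ) R.D (roundRun (R.trackStep γ thr)
      (State.init t, R.steiner, 0) (fun n => Y n ω) (T * k)).2.1 := sliceWeight_nonneg R.D_nonneg
  have h2 : y ≤ _ := hω
  linarith

end Route

end SPR

end

/-! ### Deterministic analysis of a run: termination and detours. -/

noncomputable section

namespace SPR

variable {V : Type*} {k : ℕ}

section roundRun

variable [NeZero k]

/-- The state after `n` steps of the algorithm, without an exit condition. -/
def State.steps (G : WGraph V) (t : Fin k ↪ V) (x : ℕ → ℝ) (n : ℕ) : State V k :=
  roundRun (fun _ j S x => S.step G t j x) (State.init t) x n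

variable {G : WGraph V} {t : Fin k ↪ V} {x : ℕ → ℝ}

namespace State

theorem steps_succ (n : ℕ) :
    steps G t x (n + 1) = (steps G t x n).step G t (Fin.ofNat k n) (x n) := rfl

theorem steps_valid [Finite V] (hG : G.Positive) (hx : ∀ n, 0 ≤ x n) (n : ℕ) :
    (steps G t x n).Valid G t := by
  induction n with
  | zero => exact valid_init hG
  | succ n ih => exact ih.step _ (hx n)

theorem steps_cluster_mono [Finite V] (hG : G.Positive) (hx : ∀ n, 0 ≤ x n) (j : Fin k) :
    Monotone fun n => (steps G t x n).cluster j :=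
  monotone_nat_of_le_succ fun n => (steps_valid hG hx n).cluster_subset_step _ (hx n) j

theorem steps_round (n : ℕ) :
    steps G t x ((n + 1) * k) =
      (steps G t x (n * k)).round G t (fun j => x (n * k + j)) := by
  have key : ∀ i ≤ k, steps G t x (n * k + i) =
      ((List.finRange k).take i).foldl (fun S j => S.step G t j (x (n * k + j)))
        (steps G t x (n * k)) := by
    intro i
    induction i with
    | zero => intro _; simp
    | succ i ih =>
      intro hi
      have hlen : i < (List.finRange k).length := by simpa using hi
      rw [List.take_succ_eq_append_getElem hlen, List.foldl_append, ← ih (by omega), ← add_assoc,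
        steps_succ]
      have h1 : Fin.ofNat k (n * k + i) = ⟨i, hi⟩ := by
        ext
        simp [Fin.ofNat, Nat.mod_eq_of_lt (show i < k from hi)]
      rw [h1]
      simp only [List.foldl_cons, List.foldl_nil, List.getElem_finRange, Fin.cast_mk]
  have h := key k le_rfl
  rw [List.take_of_length_le (by simp)] at h
  rw [add_mul, one_mul, h]
  rfl

omit [NeZero k] in
theorem done_iff {S : State V k} : S.Done ↔ ∀ v, ∃ j, v ∈ S.cluster j := by
  simp [Done, Set.eq_univ_iff_forall]

omit [NeZero k] in
theorem done_iff_unclustered {S : State V k} : S.Done ↔ ∀ v, v ∉ S.unclustered := by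
  simp [done_iff, mem_unclustered]

theorem steps_cluster_eq_of_done [Finite V] (hG : G.Positive) (hx : ∀ n, 0 ≤ x n) {n n' : ℕ}
    (hn : n ≤ n') (hd : (steps G t x n).Done) :
    (steps G t x n').cluster = (steps G t x n).cluster := by
  funext j
  refine Set.Subset.antisymm (fun v hv => ?_) (steps_cluster_mono hG hx j hn)
  obtain ⟨i, hi⟩ := done_iff.1 hd v
  rcases eq_or_ne i j with rfl | hij
  · exact hi
  · exact (Set.disjoint_left.1 ((steps_valid hG hx n').disjoint i j hij)
      (steps_cluster_mono hG hx i hn hi) hv).elim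

theorem run_eq_steps {q : ℕ → Fin k → ℝ} (hq : ∀ l (j : Fin k), q l j = x (l * k + j)) {n : ℕ}
    (h : ∀ i < n, ¬ (steps G t x (i * k)).Done) : run G t q n = steps G t x (n * k) := by
  induction n with
  | zero => simp [run, steps, roundRun, seqRun]
  | succ n ih =>
    have ih' := ih fun i hi => h i (by omega)
    rw [run, if_neg (by rw [ih']; exact h n (by omega)), ih', steps_round]
    congr 1
    funext j
    exact hq n j

/-- Clusters are disjoint and only grow, so they are frozen once they cover everything. Running on
after the exit condition does not change the output. -/
theorem returns_of_done [Finite V] (hG : G.Positive) (hx : ∀ n, 0 ≤ x n) {q : ℕ → Fin k → ℝ}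
    (hq : ∀ l (j : Fin k), q l j = x (l * k + j)) {T : ℕ} (hd : (steps G t x (T * k)).Done) :
    Returns G t q (G.inducedMinor t (steps G t x (T * k)).cluster) := by
  classical
  have hex : ∃ n, (steps G t x (n * k)).Done := ⟨T, hd⟩
  have hm := Nat.find_spec hex
  have hrun := run_eq_steps hq fun i hi => Nat.find_min hex hi
  refine ⟨Nat.find hex, by rw [hrun]; exact hm, ?_⟩
  rw [hrun, steps_cluster_eq_of_done hG hx (Nat.mul_le_mul_right k (Nat.find_min' hex hd)) hm]

end State

end roundRun

namespace WGraph

variable {G : WGraph V} {t : Fin k ↪ V}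

theorem inducedMinor_dist_le {U : Fin k → Set V} {i j : Fin k} {u v : V} (hu : u ∈ U i)
    (hv : v ∈ U j) (h : G.graph.Adj u v) :
    (G.inducedMinor t U).dist i j ≤ G.dist (t i) (t j) := by
  rcases eq_or_ne i j with rfl | hij
  · simp
  have hadj : (G.inducedMinor t U).graph.Adj i j := ⟨hij, u, hu, v, hv, h⟩
  refine (dist_le_len (SimpleGraph.Walk.cons hadj SimpleGraph.Walk.nil)).trans ?_
  simp only [len_cons, len_nil, add_zero]
  exact ENNReal.coe_toNNReal_le_self

/-- A shortest path between two terminals as a route. -/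
theorem exists_route [Finite V] (hc : G.graph.Connected) (i j : Fin k) :
    ∃ R : Route G t, R.pt 0 = t i ∧ R.pt R.n = t j ∧
      ENNReal.ofReal (R.pos R.n) = G.dist (t i) (t j) := by
  obtain ⟨p, -, hp⟩ := exists_isPath_len_eq_dist (dist_ne_top hc (t i) (t j))
  let w : ℕ → ℝ≥0 := fun l => G.weight s(p.getVert l, p.getVert (l + 1))
  have hlen : ∀ {u v : V} (q : G.graph.Walk u v),
      ∑ l ∈ Finset.range q.length, G.weight s(q.getVert l, q.getVert (l + 1)) = G.len q := by
    intro u v q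
    induction q with
    | nil => simp
    | cons h q ih =>
      rw [SimpleGraph.Walk.length_cons, Finset.sum_range_succ', len_cons, ← ih, add_comm]
      simp
  refine ⟨{
    n := p.length
    pt := p.getVert
    pos := fun i => ∑ l ∈ Finset.range i, (w l : ℝ)
    pos_zero := by simp
    mono := monotone_nat_of_le_succ fun n => by
      rw [Finset.sum_range_succ]; exact le_add_of_nonneg_right (NNReal.coe_nonneg _)
    adj := fun i hi => p.adj_getVert_succ hi
    weight := fun i _ => by rw [Finset.sum_range_succ]; simp [w]
    start_mem := by simp
    end_mem := by simp }, by simp, by simp, ?_⟩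
  rw [← hp, ← hlen p]
  simp only [w]
  rw [← NNReal.coe_sum, ENNReal.ofReal_coe_nnreal]

end WGraph

namespace Route

variable [NeZero k] {G : WGraph V} {t : Fin k ↪ V} (R : Route G t)

/-- The state of the algorithm and the bookkeeping for the route after `n` steps. -/
def tracked (γ : ℝ) (thr : ℕ → ℝ) (x : ℕ → ℝ) (n : ℕ) : State V k × Finset ℕ × ℝ :=
  roundRun (R.trackStep γ thr) (State.init t, R.steiner, 0) x n

variable {R} {γ : ℝ} {thr : ℕ → ℝ} {x : ℕ → ℝ}

theorem tracked_succ (n : ℕ) : R.tracked γ thr x (n + 1) =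
    R.trackStep γ thr (n / k) (Fin.ofNat k n) (R.tracked γ thr x n) (x n) := rfl

theorem tracked_fst (n : ℕ) : (R.tracked γ thr x n).1 = State.steps G t x n := by
  induction n with
  | zero => rfl
  | succ n ih => rw [tracked_succ, State.steps_succ, ← ih]; rfl

theorem tracked_valid [Finite V] (hG : G.Positive) (hx : ∀ n, 0 ≤ x n) (n : ℕ) :
    R.TrackValid (R.tracked γ thr x n) := by
  induction n with
  | zero => exact trackValid_init hG
  | succ n ih => exact ih.step _ _ _ _ (hx n)

theorem tracked_active_anti : Antitone fun n => (R.tracked γ thr x n).2.1 :=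
  antitone_nat_of_succ_le fun _ => R.track_subset _ _ _ _ _ _

/-- The cost of the detours bounds the distance in the induced minor. -/
theorem inducedMinor_dist_le [Finite V] (hG : G.Positive) (hc : G.graph.Connected)
    (hx : ∀ n, 0 ≤ x n) {N : ℕ} (hd : (State.steps G t x N).Done) (hγ : 0 ≤ γ) (hγ1 : γ ≤ 1)
    {C : ℝ} (hC : 0 ≤ C)
    (hlate : ∀ n < N, ∀ j, ∀ i ≤ R.n, R.pt i ∉ Set.range t →
      R.pt i ∈ (State.steps G t x (n + 1)).cluster j → R.D i ≤ thr (n / k))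
    (hnear : ∀ j, ∀ i ≤ R.n, R.pt i ∉ Set.range t → R.pt i ∈ (State.steps G t x N).cluster j →
      G.dist (t j) (R.pt i) ≤ ENNReal.ofReal (C * R.D i))
    {i₁ i₂ : Fin k} (h₁ : R.pt 0 = t i₁) (h₂ : R.pt R.n = t i₂) :
    (G.inducedMinor t (State.steps G t x N).cluster).dist i₁ i₂ ≤
      ENNReal.ofReal (4 * C * (R.tracked γ thr x N).2.2 + R.pos R.n) := by
  classical
  have hval := State.steps_valid (t := t) hG hx
  -- `c i` is the final cluster of position `i`.
  choose c hc' using fun i => State.done_iff.1 hd (R.pt i)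
  have huniq : ∀ {i j}, R.pt i ∈ (State.steps G t x N).cluster j → c i = j := by
    intro i j h
    by_contra hne
    exact Set.disjoint_left.1 ((hval N).disjoint _ _ hne) (hc' i) h
  have hterm : ∀ {i j}, R.pt i = t j → c i = j := fun h => huniq (by rw [h]; exact (hval N).mem _)
  set M := G.inducedMinor t (State.steps G t x N).cluster with hM
  let A : ℕ → Finset ℕ := fun n => (R.tracked γ thr x n).2.1
  let j : ℕ → Fin k := fun n => Fin.ofNat k n
  let Ht : ℕ → Finset ℕ := fun n => R.hits ((State.steps G t x (n + 1)).cluster (j n)) (A n)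
  let v : ℕ → ℕ := fun n => R.firstHit ((State.steps G t x n).avail (j n)) (j n) (A n)
  have hAval : ∀ n, ∀ i ∈ A n, i ≤ R.n ∧ R.pt i ∈ (State.steps G t x n).unclustered := by
    intro n i hi
    have h := (tracked_valid (R := R) (γ := γ) (thr := thr) hG hx n).2 i hi
    rwa [tracked_fst] at h
  have hAst : ∀ n, A n ⊆ R.steiner := fun n =>
    tracked_active_anti (R := R) (γ := γ) (thr := thr) (x := x) (Nat.zero_le n)
  have hmem : ∀ {n i}, i ∈ Ht n → i ≤ R.n ∧ R.pt i ∉ Set.range t ∧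
      R.pt i ∈ (State.steps G t x (n + 1)).cluster (j n) ∧ i ∈ A n := by
    intro n i hi
    have h1 := R.mem_hits.1 hi
    exact ⟨(hAval n i h1.1).1, (R.mem_steiner.1 (hAst n h1.1)).2, h1.2, h1.1⟩
  have hfin : ∀ {n i}, n < N → i ∈ Ht n → c i = j n := fun hn hi =>
    huniq (State.steps_cluster_mono hG hx _ (Nat.succ_le_of_lt hn) (hmem hi).2.2.1)
  have hvmem : ∀ {n}, (Ht n).Nonempty → v n ∈ Ht n := by
    rintro n ⟨i, hi⟩
    have hiA := (hmem hi).2.2.2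
    have h1 := R.firstHit_spec ((State.steps G t x n).avail (j n)) (j n) ⟨i, hiA⟩
    refine R.mem_hits.2 ⟨h1.1, ?_⟩
    have h2 := (hmem hi).2.2.1
    rw [State.steps_succ, State.step_cluster_self] at h2 ⊢
    exact (h1.2 i hiA).trans h2
  have htrack : ∀ n, (R.tracked γ thr x (n + 1)).2 =
      ((R.track γ (thr (n / k)) (j n) ((State.steps G t x n).avail (j n))
        ((State.steps G t x (n + 1)).cluster (j n)) (A n)).1,
      (R.tracked γ thr x n).2.2 + (R.track γ (thr (n / k)) (j n)
        ((State.steps G t x n).avail (j n))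
        ((State.steps G t x (n + 1)).cluster (j n)) (A n)).2) := by
    intro n
    rw [tracked_succ, State.steps_succ, ← tracked_fst (R := R) (γ := γ) (thr := thr)]
    rfl
  -- By `hlate`, the clause of `track` that gives up on far vertices never applies.
  have hnotearly : ∀ {n}, n < N → (Ht n).Nonempty → ¬ thr (n / k) < R.D (v n) := by
    intro n hn hne
    have h := hmem (hvmem hne)
    exact not_lt.2 (hlate n hn (j n) (v n) h.1 h.2.1 h.2.2.1)
  have htr1 : ∀ {n} (_ : n < N) (hne : (Ht n).Nonempty), (R.tracked γ thr x (n + 1)).2 =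
      (A n \ Finset.Icc ((Ht n).min' hne) ((Ht n).max' hne),
        (R.tracked γ thr x n).2.2 + R.D (R.block γ (v n))) := by
    intro n hn hne
    rw [htrack, track, dif_pos hne, if_neg (hnotearly hn hne)]
  have htr2 : ∀ {n}, ¬ (Ht n).Nonempty →
      (R.tracked γ thr x (n + 1)).2 = (A n, (R.tracked γ thr x n).2.2) := by
    intro n hne
    rw [htrack, R.track_of_hits_empty (Finset.not_nonempty_iff_eq_empty.1 hne), add_zero]
  let h : ℕ → ℝ≥0∞ := fun i => G.dist (t (c i)) (R.pt i)
  let w : ℕ → ℝ≥0∞ := fun i => ENNReal.ofReal (R.pos (i + 1) - R.pos i)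
  have hwsum : ∀ a b, a ≤ b → ∑ i ∈ Finset.Ico a b, w i = ENNReal.ofReal (R.pos b - R.pos a) := by
    intro a b hab
    rw [← ENNReal.ofReal_sum_of_nonneg fun i _ => sub_nonneg.2 (R.mono i.le_succ),
      Finset.sum_Ico_sub _ hab]
  -- the cost bookkeeping
  have hcost : ∀ n ≤ N, ∑ τ ∈ (Finset.range n).filter (fun τ => (Ht τ).Nonempty),
      2 * h (v τ) ≤ ENNReal.ofReal (4 * C * (R.tracked γ thr x n).2.2) ∧
        0 ≤ (R.tracked γ thr x n).2.2 := by
    intro n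
    induction n with
    | zero => intro _; simp [tracked, roundRun, seqRun]
    | succ n ih =>
      intro hn
      obtain ⟨ih1, ih2⟩ := ih (by omega)
      rw [Finset.range_add_one, Finset.filter_insert]
      by_cases hne : (Ht n).Nonempty
      · rw [if_pos hne, Finset.sum_insert (by simp), htr1 hn hne]
        have hm := hmem (hvmem hne)
        have hD0 := R.D_nonneg (R.block γ (v n))
        refine ⟨?_, add_nonneg ih2 hD0⟩
        -- The factor `2` compares `D` at `v n` and at its block start, using `γ ≤ 1`. The detour
        -- costs `2 * h (v n)`, which explains the factor `4 * C`.
        have h1 : h (v n) ≤ ENNReal.ofReal (C * (2 * R.D (R.block γ (v n)))) := by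
          have h3 := hnear (j n) (v n) hm.1 hm.2.1
            (State.steps_cluster_mono hG hx _ (Nat.succ_le_of_lt hn) hm.2.2.1)
          change G.dist (t (c (v n))) _ ≤ _
          rw [hfin hn (hvmem hne)]
          refine h3.trans (ENNReal.ofReal_le_ofReal (mul_le_mul_of_nonneg_left ?_ hC))
          have h4 := (R.D_block_le hc hγ hm.1).2
          nlinarith
        have h2 : (2 : ℝ≥0∞) = ENNReal.ofReal 2 := by simp
        rw [mul_add, ENNReal.ofReal_add (mul_nonneg (by linarith) ih2)
          (mul_nonneg (by linarith) hD0), add_comm]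
        refine add_le_add ih1 ?_
        rw [h2]
        refine (mul_le_mul_right h1 _).trans (le_of_eq ?_)
        rw [← ENNReal.ofReal_mul (by norm_num)]
        congr 1; ring
      · rw [if_neg hne, htr2 hne]
        exact ⟨ih1, ih2⟩
  -- the detours
  let a : ℕ → ℕ := fun s => if s ≤ R.n then s else
    if hne : (Ht (s - (R.n + 1))).Nonempty then (Ht (s - (R.n + 1))).min' hne else 0
  let b : ℕ → ℕ := fun s => if s ≤ R.n then s else
    if hne : (Ht (s - (R.n + 1))).Nonempty then (Ht (s - (R.n + 1))).max' hne else 0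
  let H : ℕ → ℝ≥0∞ := fun s => if s ≤ R.n then 0 else 2 * h (v (s - (R.n + 1)))
  let Ts : Finset ℕ := ((Finset.range (R.n + 1)).filter fun i => R.pt i ∈ Set.range t) ∪
    ((Finset.range N).filter fun τ => (Ht τ).Nonempty).image fun τ => R.n + 1 + τ
  have hTs : ∀ s ∈ Ts, (s ≤ R.n ∧ R.pt s ∈ Set.range t ∧ a s = s ∧ b s = s ∧ H s = 0) ∨
      ∃ τ, ∃ hne : (Ht τ).Nonempty, τ < N ∧ s = R.n + 1 + τ ∧ a s = (Ht τ).min' hne ∧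
        b s = (Ht τ).max' hne ∧ H s = 2 * h (v τ) := by
    intro s hs
    rcases Finset.mem_union.1 hs with hs | hs
    · rw [Finset.mem_filter, Finset.mem_range] at hs
      have : s ≤ R.n := by omega
      exact Or.inl ⟨this, hs.2, if_pos this, if_pos this, if_pos this⟩
    · obtain ⟨τ, hτ, rfl⟩ := Finset.mem_image.1 hs
      rw [Finset.mem_filter, Finset.mem_range] at hτ
      have h1 : ¬ R.n + 1 + τ ≤ R.n := by omega
      have h2 : R.n + 1 + τ - (R.n + 1) = τ := by omega
      refine Or.inr ⟨τ, hτ.2, hτ.1, rfl, ?_, ?_, ?_⟩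
      · simp only [a, if_neg h1, h2, dif_pos hτ.2]
      · simp only [b, if_neg h1, h2, dif_pos hτ.2]
      · simp only [H, if_neg h1, h2]
  have hAsucc : ∀ {τ i} (_ : τ < N) (hne : (Ht τ).Nonempty), i ∈ A (τ + 1) →
      ¬ ((Ht τ).min' hne ≤ i ∧ i ≤ (Ht τ).max' hne) := by
    intro τ i hτ hne hi
    change i ∈ (R.tracked γ thr x (τ + 1)).2.1 at hi
    rw [htr1 hτ hne] at hi
    exact fun hh => (Finset.mem_sdiff.1 hi).2 (Finset.mem_Icc.2 hh)
  have hmain := le_sum_of_detours (ι := ℕ) (ρ := fun i l => M.dist (c i) (c l))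
    (fun _ _ _ => WGraph.dist_triangle _ _ _) (n := R.n) (h := h) (w := w) ?_ (T := Ts) (a := a)
    (b := b) (H := H) ?_ ?_ ?_ ?_ ?_
  · rw [hterm h₁, hterm h₂] at hmain
    refine hmain.trans ?_
    have h1 : ∑ s ∈ Ts, H s ≤ ENNReal.ofReal (4 * C * (R.tracked γ thr x N).2.2) := by
      refine le_trans ?_ (hcost N le_rfl).1
      refine (Finset.sum_union_inter (f := H) ▸ le_self_add :
        ∑ s ∈ Ts, H s ≤ ∑ s ∈ (Finset.range (R.n + 1)).filter (fun i => R.pt i ∈ Set.range t), H s +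
          ∑ s ∈ ((Finset.range N).filter fun τ => (Ht τ).Nonempty).image
            (fun τ => R.n + 1 + τ), H s).trans ?_
      rw [Finset.sum_image (by intro a _ b _ hab; simpa using hab), Finset.sum_eq_zero, zero_add]
      · refine Finset.sum_le_sum fun τ _ => le_of_eq ?_
        have h1 : ¬ R.n + 1 + τ ≤ R.n := by omega
        have h2 : R.n + 1 + τ - (R.n + 1) = τ := by omega
        simp only [H, if_neg h1, h2]
      · intro s hs
        rw [Finset.mem_filter, Finset.mem_range] at hs
        exact if_pos (by omega)
    rw [ENNReal.ofReal_add (mul_nonneg (by linarith) (hcost N le_rfl).2)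
      (by rw [← R.pos_zero]; exact R.mono (Nat.zero_le _))]
    refine add_le_add h1 (le_of_eq ?_)
    rw [Finset.range_eq_Ico, hwsum _ _ (Nat.zero_le _), R.pos_zero, sub_zero]
  · intro i hi
    refine (WGraph.inducedMinor_dist_le (hc' i) (hc' (i + 1)) (R.adj i hi)).trans ?_
    have h1 := R.dist_le (i := i) (l := i + 1) hi.le hi
    rw [abs_of_nonneg (sub_nonneg.2 (R.mono i.le_succ))] at h1
    refine (WGraph.dist_triangle _ (R.pt i) _).trans ?_
    rw [add_assoc]
    refine add_le_add le_rfl ((WGraph.dist_triangle _ (R.pt (i + 1)) _).trans ?_)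
    exact add_le_add h1 (G.dist_comm _ _).le
  · intro s hs
    rcases hTs s hs with ⟨h1, -, h2, h3, -⟩ | ⟨τ, hne, hτ, rfl, h2, h3, -⟩
    · rw [h2, h3]; exact ⟨le_rfl, h1⟩
    · rw [h2, h3]
      exact ⟨Finset.min'_le_max' _ hne, (hmem (Finset.max'_mem _ hne)).1⟩
  · intro s hs
    rcases hTs s hs with ⟨h1, -, h2, h3, -⟩ | ⟨τ, hne, hτ, rfl, h2, h3, -⟩
    · simp [h2, h3]
    · rw [h2, h3, hfin hτ (Finset.min'_mem _ hne), hfin hτ (Finset.max'_mem _ hne)]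
      simp
  · intro s hs
    rcases hTs s hs with ⟨h1, ⟨i, hi⟩, h2, h3, h4⟩ | ⟨τ, hne, hτ, rfl, h2, h3, h4⟩
    · have : h s = 0 := by
        change G.dist (t (c s)) (R.pt s) = 0
        rw [hterm hi.symm, ← hi, WGraph.dist_self]
      rw [h2, h3, h4, this]; simp
    · have hvm := hvmem hne
      have hav := Finset.min'_le _ _ hvm
      have hvb := Finset.le_max' _ _ hvm
      have hca := hfin hτ (Finset.min'_mem _ hne)
      have hcb := hfin hτ (Finset.max'_mem _ hne)
      have hcv := hfin hτ hvm
      rw [h2, h3, h4, hwsum _ _ (hav.trans hvb)]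
      set a' := (Ht τ).min' hne
      set b' := (Ht τ).max' hne
      -- The ends and `v τ` lie in one cluster, so the ends are reached from its terminal by way of
      -- `v τ` and then along the route.
      have e1 : h a' ≤ h (v τ) + ENNReal.ofReal (R.pos (v τ) - R.pos a') := by
        have h5 := R.dist_le (i := v τ) (l := a') (hmem hvm).1 (hav.trans (hmem hvm).1)
        rw [abs_sub_comm, abs_of_nonneg (sub_nonneg.2 (R.mono hav))] at h5
        change G.dist (t (c a')) _ ≤ G.dist (t (c (v τ))) _ + _
        rw [hca, hcv]
        exact (WGraph.dist_triangle _ (R.pt (v τ)) _).trans (add_le_add le_rfl h5)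
      have e2 : h b' ≤ h (v τ) + ENNReal.ofReal (R.pos b' - R.pos (v τ)) := by
        have h5 := R.dist_le (i := v τ) (l := b') (hmem hvm).1
          (hmem (Finset.max'_mem _ hne)).1
        rw [abs_of_nonneg (sub_nonneg.2 (R.mono hvb))] at h5
        change G.dist (t (c b')) _ ≤ G.dist (t (c (v τ))) _ + _
        rw [hcb, hcv]
        exact (WGraph.dist_triangle _ (R.pt (v τ)) _).trans (add_le_add le_rfl h5)
      refine (add_le_add e1 e2).trans (le_of_eq ?_)
      rw [show R.pos b' - R.pos a' = (R.pos (v τ) - R.pos a') + (R.pos b' - R.pos (v τ)) by ring,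
        ENNReal.ofReal_add (sub_nonneg.2 (R.mono hav)) (sub_nonneg.2 (R.mono hvb))]
      ring
  · intro s hs s' hs' hlt
    rcases hTs s hs with ⟨h1, -, h2, h3, -⟩ | ⟨τ, hne, hτ, rfl, h2, h3, -⟩
    · rcases hTs s' hs' with ⟨h1', -, h2', h3', -⟩ | ⟨τ', hne', hτ', rfl, h2', h3', -⟩
      · omega
      · omega
    · have hma := hmem (Finset.min'_mem _ hne)
      have hmb := hmem (Finset.max'_mem _ hne)
      rcases hTs s' hs' with ⟨h1', h5', h2', h3', -⟩ | ⟨τ', hne', hτ', rfl, h2', h3', -⟩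
      · rw [h2, h3, h2', h3']
        constructor
        · intro hh
          rw [show (Ht τ).min' hne = s' by omega] at hma
          exact hma.2.1 h5'
        · intro hh
          rw [show (Ht τ).max' hne = s' by omega] at hmb
          exact hmb.2.1 h5'
      · rw [h2, h3, h2', h3']
        have hle : τ' + 1 ≤ τ := by omega
        have hanti := tracked_active_anti (R := R) (γ := γ) (thr := thr) (x := x) hle
        exact ⟨hAsucc hτ' hne' (hanti hma.2.2.2), hAsucc hτ' hne' (hanti hmb.2.2.2)⟩
  · intro i hi
    by_cases hit : R.pt i ∈ Set.range t
    · refine ⟨i, Finset.mem_union_left _ ?_, ?_⟩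
      · rw [Finset.mem_filter, Finset.mem_range]; exact ⟨by omega, hit⟩
      · simp [a, b, hi]
    · have hi0 : i ∈ A 0 := R.mem_steiner.2 ⟨hi, hit⟩
      have hiN : i ∉ A N := fun hh => State.done_iff_unclustered.1 hd _ (hAval N i hh).2
      have hex : ∃ n, i ∉ A n := ⟨N, hiN⟩
      have hfs := Nat.find_spec hex
      obtain ⟨τ, hτ⟩ : ∃ τ, Nat.find hex = τ + 1 := by
        refine Nat.exists_eq_succ_of_ne_zero fun h0 => ?_
        rw [h0] at hfs
        exact hfs hi0
      have hτA : i ∈ A τ := by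
        by_contra hh
        exact Nat.find_min hex (by omega) hh
      have hτN : τ < N := by
        have := Nat.find_min' hex hiN
        omega
      rw [hτ] at hfs
      have hne : (Ht τ).Nonempty := by
        by_contra hne
        refine hfs ?_
        change i ∈ (R.tracked γ thr x (τ + 1)).2.1
        rw [htr2 hne]
        exact hτA
      have hIcc : (Ht τ).min' hne ≤ i ∧ i ≤ (Ht τ).max' hne := by
        by_contra hh
        refine hfs ?_
        change i ∈ (R.tracked γ thr x (τ + 1)).2.1
        rw [htr1 hτN hne]
        exact Finset.mem_sdiff.2 ⟨hτA, fun h5 => hh (Finset.mem_Icc.1 h5)⟩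
      refine ⟨R.n + 1 + τ, Finset.mem_union_right _ (Finset.mem_image.2 ⟨τ, ?_, rfl⟩), ?_⟩
      · rw [Finset.mem_filter, Finset.mem_range]; exact ⟨hτN, hne⟩
      · have h1 : ¬ R.n + 1 + τ ≤ R.n := by omega
        have h2 : R.n + 1 + τ - (R.n + 1) = τ := by omega
        simp only [a, b, if_neg h1, h2, dif_pos hne]
        exact hIcc

end Route

end SPR

end

/-! ### Numerical estimates for the parameters of the algorithm. -/

noncomputable section

namespace SPR

open MeasureTheory ProbabilityTheory

variable {V : Type*} {k : ℕ}

/-- The mean of the increments in round `l`, for `k` terminals. -/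
def mean (k l : ℕ) : ℝ := initMean k * rate k ^ l

section numerics

theorem one_le_log_of_three_le (hk : 3 ≤ k) : 1 ≤ Real.log k := by
  rw [Real.le_log_iff_exp_le (by positivity)]
  have : (3 : ℝ) ≤ k := by exact_mod_cast hk
  linarith [Real.exp_one_lt_d9]

theorem one_lt_rate (hL : 1 ≤ Real.log k) : 1 < rate k := by
  have : 0 < delta / Real.log k := div_pos (by norm_num [delta]) (by linarith)
  unfold rate
  linarith

theorem mean_eq (k l : ℕ) : mean k l = rate k ^ l / (20 * Real.log k) := by
  rw [mean, initMean, delta, div_div, one_div, mul_comm, div_eq_mul_inv]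

theorem mean_pos (hL : 1 ≤ Real.log k) (l : ℕ) : 0 < mean k l := by
  rw [mean_eq]
  have := one_lt_rate hL
  positivity

theorem sum_mean (hL : 1 ≤ Real.log k) (T : ℕ) :
    ∑ l ∈ Finset.range T, mean k l = rate k ^ T - 1 := by
  have h1 := one_lt_rate hL
  have h2 : initMean k = rate k - 1 := by simp [initMean, rate]
  simp only [mean]
  rw [← Finset.mul_sum, h2, mul_comm, geom_sum_mul]

/-- About `10 log k` rounds change the scale by at most `e^(1/2)`, so that many consecutive rounds
have comparable means. -/
theorem rate_pow_floor_le (hL : 1 ≤ Real.log k) : rate k ^ ⌊10 * Real.log k⌋₊ ≤ 2 := by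
  have h1 : rate k ≤ Real.exp (1 / (20 * Real.log k)) := by
    have := Real.add_one_le_exp (1 / (20 * Real.log k))
    rw [rate, delta, div_div]
    linarith
  have h0 := one_lt_rate hL
  calc rate k ^ ⌊10 * Real.log k⌋₊ ≤ Real.exp (1 / (20 * Real.log k)) ^ ⌊10 * Real.log k⌋₊ := by
        gcongr
    _ = Real.exp (⌊10 * Real.log k⌋₊ * (1 / (20 * Real.log k))) := by rw [← Real.exp_nat_mul]
    _ ≤ Real.exp (1 / 2) := by
        gcongr
        have := Nat.floor_le (show 0 ≤ 10 * Real.log k by linarith)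
        rw [mul_one_div, div_le_iff₀ (by positivity)]
        linarith
    _ ≤ 2 := by
        have h3 : Real.exp (1 / 2) ^ 2 = Real.exp 1 := by rw [← Real.exp_nat_mul]; norm_num
        nlinarith [Real.exp_one_lt_d9, Real.exp_pos (1 / 2)]

/-- With `s = 40 L / y`, each `s m l = 2 r^l / y` is at most `1/2`, where `1 / (1 - x) ≤ e^(2x)`.
The means sum to `r^T - 1`, so the product is at most `e^(20 L + 1)`, against `e^(-40 L)`. -/
theorem prod_radius_le (hL : 1 ≤ Real.log k) {y : ℝ} (hy : 0 < y) {T : ℕ}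
    (h : ∀ l < T, 4 * rate k ^ l ≤ y) :
    Real.exp (-(40 * Real.log k / y * y)) *
      ∏ l ∈ Finset.range T, (1 / (1 - 40 * Real.log k / y * mean k l)) ≤
        Real.exp (-(19 * Real.log k)) := by
  have h0 := one_lt_rate hL
  set L := Real.log k with hLdef
  have hx : ∀ l < T, 0 ≤ 40 * L / y * mean k l ∧ 40 * L / y * mean k l ≤ 1 / 2 := by
    intro l hl
    refine ⟨mul_nonneg (by positivity) (mean_pos hL l).le, ?_⟩
    rw [mean_eq, ← hLdef, div_mul_div_comm, div_le_iff₀ (by positivity)]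
    nlinarith [h l hl]
  have h1 : ∏ l ∈ Finset.range T, (1 / (1 - 40 * L / y * mean k l)) ≤
      ∏ l ∈ Finset.range T, Real.exp (2 * (40 * L / y * mean k l)) := by
    refine Finset.prod_le_prod (fun l hl => ?_) fun l hl => ?_
    · have := (hx l (Finset.mem_range.1 hl)).2
      exact one_div_nonneg.2 (by linarith)
    · obtain ⟨h3, h4⟩ := hx l (Finset.mem_range.1 hl)
      rw [div_le_iff₀ (by linarith)]
      have := Real.add_one_le_exp (2 * (40 * L / y * mean k l))
      nlinarith
  have h2 : ∑ l ∈ Finset.range T, 2 * (40 * L / y * mean k l) ≤ 20 * L + 1 := by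
    rw [← Finset.mul_sum, ← Finset.mul_sum, sum_mean hL]
    rcases T with _ | T
    · simp; positivity
    · have h5 := h T (by omega)
      have h6 : (20 * L) * rate k = 20 * L + 1 := by
        rw [rate, delta, ← hLdef]; field_simp
      rw [← h6, div_mul_eq_mul_div, ← mul_div_assoc, div_le_iff₀ hy, pow_succ]
      nlinarith [mul_le_mul_of_nonneg_left h5 (show 0 ≤ 20 * L * rate k by positivity)]
  calc _ ≤ Real.exp (-(40 * L / y * y)) * ∏ l ∈ Finset.range T, Real.exp (2 * (40 * L / y * mean k l)) := by
        gcongr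
    _ = Real.exp (-(40 * L) + ∑ l ∈ Finset.range T, 2 * (40 * L / y * mean k l)) := by
        rw [← Real.exp_sum, ← Real.exp_add, div_mul_cancel₀ _ hy.ne']
    _ ≤ _ := by
        gcongr
        linarith

/-- With `s = 80 L / r^T`, the first factor is at most `e^L`. In the last `⌊10 L⌋ ≥ 9 L` rounds the
scale is at least `r^T / 2`, so `s m l ≥ 2` and each factor is at most `1/3 ≤ e^(-1)`. -/
theorem prod_cover_le (hL : 1 ≤ Real.log k) {D : ℝ} (hD : 1 ≤ D) {T : ℕ} (h : 80 * D ≤ rate k ^ T) :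
    Real.exp (80 * Real.log k / rate k ^ T * D) *
      ∏ l ∈ Finset.range T, (1 / (1 + 80 * Real.log k / rate k ^ T * mean k l)) ≤
        Real.exp (-(8 * Real.log k)) := by
  have h0 := one_lt_rate hL
  have hfl := rate_pow_floor_le hL
  set L := Real.log k with hLdef
  have hn0 : ⌊10 * L⌋₊ ≤ T := by
    by_contra hlt
    have := pow_le_pow_right₀ h0.le (not_le.1 hlt).le
    linarith
  obtain ⟨a, rfl⟩ := Nat.exists_eq_add_of_le' hn0
  set n0 := ⌊10 * L⌋₊ with hn0def
  have hpos : ∀ l, 0 ≤ 80 * L / rate k ^ (a + n0) * mean k l := fun l =>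
    mul_nonneg (by positivity) (mean_pos hL l).le
  have h9 : 9 * L ≤ n0 := by
    have := Nat.lt_floor_add_one (10 * L)
    rw [← hn0def] at this
    linarith
  have hexp : (1 : ℝ) / 3 ≤ Real.exp (-1) := by
    rw [Real.exp_neg, one_div]
    exact inv_anti₀ (Real.exp_pos _) (by linarith [Real.exp_one_lt_d9])
  have h1 : ∏ l ∈ Finset.range (a + n0), (1 / (1 + 80 * L / rate k ^ (a + n0) * mean k l)) ≤
      1 * Real.exp (-1) ^ n0 := by
    rw [Finset.prod_range_add]
    refine mul_le_mul ?_ ?_ ?_ zero_le_one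
    · refine Finset.prod_le_one (fun l _ => ?_) fun l _ => ?_
      · have := hpos l; positivity
      · exact div_le_one_of_le₀ (by linarith [hpos l]) (by linarith [hpos l])
    · have h2 : ∀ l ∈ Finset.range n0,
          1 / (1 + 80 * L / rate k ^ (a + n0) * mean k (a + l)) ≤ Real.exp (-1) := by
        intro l _
        refine le_trans (one_div_le_one_div_of_le (by norm_num) ?_) hexp
        suffices 2 ≤ 80 * L / rate k ^ (a + n0) * mean k (a + l) by linarith
        rw [mean_eq, ← hLdef, div_mul_div_comm, le_div_iff₀ (by positivity), pow_add, pow_add]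
        have h3 : (1 : ℝ) ≤ rate k ^ l := one_le_pow₀ h0.le
        have h4 : 0 < rate k ^ a := by positivity
        have h5 : rate k ^ a * rate k ^ n0 ≤ rate k ^ a * 2 := by gcongr
        have h6 : rate k ^ a * 1 ≤ rate k ^ a * rate k ^ l := by gcongr
        nlinarith
      calc _ ≤ ∏ l ∈ Finset.range n0, Real.exp (-1) :=
            Finset.prod_le_prod (fun l _ => by have := hpos (a + l); positivity) h2
        _ = _ := by simp
    · exact Finset.prod_nonneg fun l _ => by have := hpos (a + l); positivity
  calc _ ≤ Real.exp L * (1 * Real.exp (-1) ^ n0) := by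
        refine mul_le_mul ?_ h1 (Finset.prod_nonneg fun l _ => by have := hpos l; positivity)
          (Real.exp_pos _).le
        gcongr
        rw [div_mul_eq_mul_div, div_le_iff₀ (by positivity)]
        nlinarith
    _ = Real.exp (L - n0) := by
        rw [one_mul, ← Real.exp_nat_mul, ← Real.exp_add]; ring_nf
    _ ≤ _ := by
        gcongr
        linarith

end numerics

end SPR

end

/-! ### Union bound over the bad events. -/

noncomputable section

namespace SPR

open MeasureTheory ProbabilityTheory

variable {V : Type*} {k : ℕ}

section core

variable [NeZero k] {G : WGraph V} {t : Fin k ↪ V}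

omit [NeZero k] in
theorem State.Valid.dist_le {S : State V k} (hS : S.Valid G t) {j : Fin k} {v : V}
    (hv : v ∈ S.cluster j) : G.dist (t j) v ≤ ENNReal.ofReal (S.radius j) :=
  (WGraph.dist_le_distOn _ _ _).trans (hS.inner j v hv)

/-- Sufficient conditions on the increments for a small distortion of a pair of terminals. -/
theorem inducedMinor_dist_le_of_track [Finite V] (hG : G.Positive) (hc : G.graph.Connected)
    {x : ℕ → ℝ} (hx : ∀ n, 0 ≤ x n) {ρ : ℕ → ℝ} {T : ℕ} {T₁ T₃ : V → ℕ} {C : ℝ} (hC : 0 ≤ C)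
    (hT₁ : ∀ v, T₁ v ≤ T) (hT₃ : ∀ v l, ρ l < (G.termDist t v).toReal → l < T₃ v)
    (hcover : ∀ v, v ∉ Set.range t → v ∉ (State.steps G t x (T₁ v * k)).unclustered)
    (hfar : ∀ v, v ∉ Set.range t → ∀ j,
      (State.steps G t x (T₁ v * k)).radius j ≤ C * (G.termDist t v).toReal)
    (hnear : ∀ v, v ∉ Set.range t → ∀ j,
      (State.steps G t x (T₃ v * k)).radius j < (G.termDist t v).toReal) :
    (State.steps G t x (T * k)).Done ∧ ∀ (R : Route G t) {γ : ℝ}, 0 ≤ γ → γ ≤ 1 →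
      ∀ i j, R.pt 0 = t i → R.pt R.n = t j →
        (G.inducedMinor t (State.steps G t x (T * k)).cluster).dist i j ≤
          ENNReal.ofReal (4 * C * (R.tracked γ ρ x (T * k)).2.2 + R.pos R.n) := by
  have hval := State.steps_valid (t := t) hG hx
  have hclust : ∀ v, v ∉ Set.range t → ∃ j, v ∈ (State.steps G t x (T₁ v * k)).cluster j := by
    intro v hv
    by_contra hne
    push Not at hne
    exact hcover v hv (State.mem_unclustered.2 hne)
  have hmono : ∀ v j, v ∈ (State.steps G t x (T₁ v * k)).cluster j →
      v ∈ (State.steps G t x (T * k)).cluster j := fun v j h =>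
    State.steps_cluster_mono hG hx j (Nat.mul_le_mul_right k (hT₁ v)) h
  have hd : (State.steps G t x (T * k)).Done := by
    refine State.done_iff.2 fun v => ?_
    by_cases hv : v ∈ Set.range t
    · obtain ⟨j, rfl⟩ := hv
      exact ⟨j, (hval _).mem j⟩
    · obtain ⟨j, hj⟩ := hclust v hv
      exact ⟨j, hmono v j hj⟩
  refine ⟨hd, fun R γ hγ hγ1 i₁ i₂ h₁ h₂ => ?_⟩
  refine Route.inducedMinor_dist_le hG hc hx hd hγ hγ1 hC ?_ ?_ h₁ h₂
  -- A vertex taken while `ρ` is still below its `D` would require a radius of at least `D` by time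
  -- `T₃`, against `hnear`.
  · intro n _ j i _ hit hij
    by_contra hlt
    have h1 := hT₃ _ _ (not_le.1 hlt)
    have hn : n + 1 ≤ T₃ (R.pt i) * k := by
      have h2 : n < (n / k + 1) * k := by
        rw [mul_comm]; exact Nat.lt_mul_div_succ n (NeZero.pos k)
      exact h2.trans_le (Nat.mul_le_mul_right k h1)
    have h3 := (hval _).dist_le (State.steps_cluster_mono hG hx j hn hij)
    have h4 := WGraph.termDist_le (G := G) t (R.pt i) j
    rw [WGraph.dist_comm] at h4
    have h5 := h4.trans h3
    rw [← ENNReal.ofReal_toReal (Route.termDist_ne_top hc (R.pt i)),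
      ENNReal.ofReal_le_ofReal_iff ((hval _).nonneg j)] at h5
    exact absurd (hnear _ hit j) (not_lt.2 h5)
  · intro j i _ hit hij
    obtain ⟨j', hj'⟩ := hclust _ hit
    obtain rfl : j = j' := by
      by_contra hne
      exact Set.disjoint_left.1 ((hval _).disjoint _ _ hne) hij (hmono _ _ hj')
    exact ((hval _).dist_le hj').trans (ENNReal.ofReal_le_ofReal (hfar _ hit j))

variable {Ω : Type*} [MeasurableSpace Ω] {P : Measure Ω} [IsProbabilityMeasure P] {Y : ℕ → Ω → ℝ}

theorem measure_radius_ge [Finite V] (hY : ExpRounds P k (mean k) Y) (hL : 1 ≤ Real.log k)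
    (hG : G.Positive) (j : Fin k) {y : ℝ} (hy : 0 < y) {T : ℕ} (h : ∀ l < T, 4 * rate k ^ l ≤ y) :
    P {ω | y ≤ (State.steps G t (fun n => Y n ω) (T * k)).radius j} ≤
      ENNReal.ofReal (Real.exp (-(19 * Real.log k))) := by
  have h0 := one_lt_rate hL
  refine (State.measure_le_radius_le hY hG j (s := 40 * Real.log k / y) (by positivity)
    (fun l hl => ?_) y).trans (ENNReal.ofReal_le_ofReal (prod_radius_le hL hy h))
  rw [mean_eq, div_mul_div_comm, div_lt_one (by positivity)]
  nlinarith [h l hl, Real.log_pos (show (1 : ℝ) < k by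
    by_contra hk; linarith [Real.log_nonpos (Nat.cast_nonneg k) (not_lt.1 hk)])]

theorem measure_uncovered [Finite V] (hY : ExpRounds P k (mean k) Y) (hL : 1 ≤ Real.log k)
    (hG : G.Positive) (hc : G.graph.Connected) {v : V} (hv : 1 ≤ (G.termDist t v).toReal) {T : ℕ}
    (h : 80 * (G.termDist t v).toReal ≤ rate k ^ T) :
    P {ω | v ∈ (State.steps G t (fun n => Y n ω) (T * k)).unclustered} ≤
      ENNReal.ofReal (Real.exp (-(8 * Real.log k))) := by
  have h0 := one_lt_rate hL
  exact (State.measure_mem_unclustered_le hY hG hc v (s := 80 * Real.log k / rate k ^ T)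
    (by positivity) T).trans (ENNReal.ofReal_le_ofReal (prod_cover_le hL hv h))

/-- A vertex with `D ≤ 4 r^l` has block weight at most `8 r^l`, and `γ` makes `8 γ r^l` equal to
`mean k l / 20`. The initial potential accounts for `2 / γ = 6400 L` lengths; the surplus of `9 L`
lengths with `s = 1 / (3 · length)` yields `e^(-3 L)`. -/
theorem measure_cost_ge [Finite V] (hY : ExpRounds P k (mean k) Y) (hL : 1 ≤ Real.log k)
    (hG : G.Positive) (hc : G.graph.Connected) (R : Route G t) (hR : 0 < R.pos R.n) (T : ℕ) :
    P {ω | 6409 * Real.log k * R.pos R.n ≤ (R.tracked (1 / (3200 * Real.log k))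
        (fun l => 4 * rate k ^ l) (fun n => Y n ω) (T * k)).2.2} ≤
      ENNReal.ofReal (Real.exp (-(3 * Real.log k))) := by
  have h0 := one_lt_rate hL
  have hγ : 0 < 1 / (3200 * Real.log k) := by positivity
  have hγ1 : 1 / (3200 * Real.log k) ≤ 1 / 3200 :=
    one_div_le_one_div_of_le (by norm_num) (by linarith)
  refine (R.measure_le_cost_le hG hc hY (γ := 1 / (3200 * Real.log k))
    (s := 1 / (3 * R.pos R.n)) hγ (by linarith) (by positivity) (le_of_eq ?_) ?_ T _).trans ?_
  · field_simp
  · intro l i hi hD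
    have hb := (R.D_block_le hc hγ.le hi).1
    have hD0 := R.D_nonneg (R.block (1 / (3200 * Real.log k)) i)
    have h2 : R.D (R.block (1 / (3200 * Real.log k)) i) ≤ 8 * rate k ^ l := by
      nlinarith
    calc _ ≤ 1 / (3200 * Real.log k) * (8 * rate k ^ l) := by gcongr
      _ = _ := by rw [mean_eq]; field_simp; norm_num
  · refine ENNReal.ofReal_le_ofReal (Real.exp_le_exp.2 (le_of_eq ?_))
    field_simp
    ring

/-- With high probability, the algorithm succeeds on a graph of polynomial size. -/
theorem exists_measure_failure_le [Fintype V] (hY : ExpRounds P k (mean k) Y) (hL : 1 ≤ Real.log k)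
    (hG : G.Positive) (hc : G.graph.Connected)
    (hD : ∀ v, v ∉ Set.range t → 1 ≤ G.termDist t v) :
    ∃ T, P {ω | ¬ ((∀ n, 0 ≤ Y n ω) → (State.steps G t (fun n => Y n ω) (T * k)).Done ∧ ∀ i j,
        (G.inducedMinor t (State.steps G t (fun n => Y n ω) (T * k)).cluster).dist i j ≤
          ENNReal.ofReal (9000000 * Real.log k) * G.dist (t i) (t j))} ≤
      ENNReal.ofReal (Fintype.card V * (Real.exp (-(8 * Real.log k)) +
        2 * k * Real.exp (-(19 * Real.log k))) + k ^ 2 * Real.exp (-(3 * Real.log k))) := by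
  classical
  have h0 := one_lt_rate hL
  set D : V → ℝ := fun v => (G.termDist t v).toReal with hDdef
  have hD1 : ∀ v, v ∉ Set.range t → 1 ≤ D v := fun v hv => by
    have := ENNReal.toReal_mono (Route.termDist_ne_top hc v) (hD v hv)
    simpa using this
  have hex₁ : ∀ v, ∃ T, 80 * D v ≤ rate k ^ T := fun v =>
    ((tendsto_pow_atTop_atTop_of_one_lt h0).eventually_ge_atTop _).exists
  have hex₃ : ∀ v, ∃ T, D v ≤ 4 * rate k ^ T := fun v => by
    obtain ⟨T, hT⟩ := hex₁ v
    have : 0 ≤ D v := ENNReal.toReal_nonneg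
    exact ⟨T, by nlinarith [pow_pos (zero_lt_one.trans h0) T]⟩
  -- `T₁` is when `v` should be covered, `T₃` when radii should still be short of `v`; minimality
  -- bounds the scales of all earlier rounds, as the radius estimate needs.
  let T₁ : V → ℕ := fun v => Nat.find (hex₁ v)
  let T₃ : V → ℕ := fun v => Nat.find (hex₃ v)
  let T : ℕ := Finset.univ.sup T₁
  choose R hR₁ hR₂ hR₃ using fun p : Fin k × Fin k => WGraph.exists_route (t := t) hc p.1 p.2
  have hRpos : ∀ p : Fin k × Fin k, p.1 ≠ p.2 → 0 < (R p).pos (R p).n := fun p hp => by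
    rw [← ENNReal.ofReal_pos, hR₃]
    exact WGraph.dist_pos hG (t.injective.ne hp)
  let ρ : ℕ → ℝ := fun l => 4 * rate k ^ l
  let γ : ℝ := 1 / (3200 * Real.log k)
  let st : ℕ → Ω → State V k := fun n ω => State.steps G t (fun n => Y n ω) (n * k)
  let E₁ : V → Set Ω := fun v => {ω | v ∈ (st (T₁ v) ω).unclustered}
  -- `320 = 4 * 80`: rounds before `T₁ v` have scale below `80 * D v`.
  let E₂ : V → Fin k → Set Ω := fun v j => {ω | 320 * D v ≤ (st (T₁ v) ω).radius j}
  let E₃ : V → Fin k → Set Ω := fun v j => {ω | D v ≤ (st (T₃ v) ω).radius j}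
  let E₄ : Fin k × Fin k → Set Ω := fun p =>
    {ω | 6409 * Real.log k * (R p).pos (R p).n ≤
      ((R p).tracked γ ρ (fun n => Y n ω) (T * k)).2.2}
  let S : Finset V := Finset.univ.filter fun v => v ∉ Set.range t
  let Q : Finset (Fin k × Fin k) := Finset.univ.filter fun p => p.1 ≠ p.2
  refine ⟨T, ?_⟩
  have hsub : {ω | ¬ ((∀ n, 0 ≤ Y n ω) → (State.steps G t (fun n => Y n ω) (T * k)).Done ∧ ∀ i j,
        (G.inducedMinor t (State.steps G t (fun n => Y n ω) (T * k)).cluster).dist i j ≤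
          ENNReal.ofReal (9000000 * Real.log k) * G.dist (t i) (t j))} ⊆
      (⋃ v ∈ S, (E₁ v ∪ ⋃ j ∈ (Finset.univ : Finset (Fin k)), (E₂ v j ∪ E₃ v j))) ∪
        ⋃ p ∈ Q, E₄ p := by
    intro ω hω
    by_contra hgood
    refine hω fun hx => ?_
    simp only [Set.mem_union, Set.mem_iUnion, not_or, not_exists] at hgood
    have hS : ∀ v, v ∉ Set.range t → v ∈ S := fun v hv => by simpa [S] using hv
    have hmain := inducedMinor_dist_le_of_track (G := G) (t := t) hG hc hx (ρ := ρ) (T := T)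
      (T₁ := T₁) (T₃ := T₃) (C := 320) (by norm_num)
      (fun v => Finset.le_sup (f := T₁) (Finset.mem_univ v))
      (fun v l hl => by
        by_contra hlt
        have h1 := Nat.find_spec (hex₃ v)
        have h2 := pow_le_pow_right₀ h0.le (not_lt.1 hlt)
        have h3 : 4 * rate k ^ l < D v := hl
        have h4 : D v ≤ 4 * rate k ^ (T₃ v) := h1
        linarith)
      (fun v hv => (hgood.1 v (hS v hv)).1)
      (fun v hv j => (not_le.1 ((hgood.1 v (hS v hv)).2 j (Finset.mem_univ j)).1).le)
      (fun v hv j => not_le.1 ((hgood.1 v (hS v hv)).2 j (Finset.mem_univ j)).2)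
    refine ⟨hmain.1, fun i j => ?_⟩
    rcases eq_or_ne i j with rfl | hij
    · simp
    have hp := hRpos (i, j) hij
    have hγ1 : γ ≤ 1 := (div_le_one (by positivity)).2 (by linarith)
    refine (hmain.2 (R (i, j)) (γ := γ) (by positivity) hγ1 i j (hR₁ _) (hR₂ _)).trans ?_
    rw [← hR₃ (i, j), ← ENNReal.ofReal_mul (by positivity)]
    refine ENNReal.ofReal_le_ofReal ?_
    have h5 : ¬ 6409 * Real.log k * (R (i, j)).pos (R (i, j)).n ≤
        ((R (i, j)).tracked γ ρ (fun n => Y n ω) (T * k)).2.2 :=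
      hgood.2 (i, j) (by simpa [Q] using hij)
    -- `4 * 320 * 6409 * log k + 1 ≤ 9000000 * log k`.
    nlinarith [not_le.1 h5]
  refine (measure_mono hsub).trans ((measure_union_le _ _).trans ?_)
  have hcardS : S.card ≤ Fintype.card V := Finset.card_le_univ S
  have hcardQ : Q.card ≤ k ^ 2 := (Finset.card_le_univ Q).trans (by simp [sq])
  set e₈ := ENNReal.ofReal (Real.exp (-(8 * Real.log k))) with he8
  set e₁₉ := ENNReal.ofReal (Real.exp (-(19 * Real.log k))) with he19
  set e₃ := ENNReal.ofReal (Real.exp (-(3 * Real.log k))) with he3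
  have hB1 : P (⋃ v ∈ S, (E₁ v ∪ ⋃ j ∈ (Finset.univ : Finset (Fin k)), (E₂ v j ∪ E₃ v j))) ≤
      Fintype.card V * (e₈ + 2 * k * e₁₉) := by
    refine (measure_biUnion_finset_le _ _).trans ((Finset.sum_le_card_nsmul _ _
      (e₈ + 2 * k * e₁₉) fun v hv => ?_).trans ?_)
    · have hvt : v ∉ Set.range t := by simpa [S] using hv
      have hv1 := hD1 v hvt
      refine (measure_union_le _ _).trans (add_le_add
        (measure_uncovered hY hL hG hc hv1 (Nat.find_spec (hex₁ v))) ?_)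
      refine (measure_biUnion_finset_le _ _).trans ((Finset.sum_le_card_nsmul _ _
        (2 * e₁₉) fun j _ => ?_).trans (le_of_eq ?_))
      · rw [two_mul]
        refine (measure_union_le _ _).trans (add_le_add ?_ ?_)
        · refine measure_radius_ge hY hL hG j (by positivity) fun l hl => ?_
          have := not_le.1 (Nat.find_min (hex₁ v) hl)
          linarith
        · refine measure_radius_ge hY hL hG j (by positivity) fun l hl => ?_
          exact (not_le.1 (Nat.find_min (hex₃ v) hl)).le
      · rw [Finset.card_univ, Fintype.card_fin, nsmul_eq_mul]
        ring
    · rw [nsmul_eq_mul]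
      gcongr
  have hB2 : P (⋃ p ∈ Q, E₄ p) ≤ (k : ℝ≥0∞) ^ 2 * e₃ := by
    refine (measure_biUnion_finset_le _ _).trans ((Finset.sum_le_card_nsmul _ _
      e₃ fun p hp => ?_).trans ?_)
    · exact measure_cost_ge hY hL hG hc (R p) (hRpos p (by simpa [Q] using hp)) T
    · rw [nsmul_eq_mul]
      gcongr
      exact_mod_cast hcardQ
  refine (add_le_add hB1 hB2).trans (le_of_eq ?_)
  rw [ENNReal.ofReal_add (by positivity) (by positivity), ENNReal.ofReal_mul (by positivity),
    ENNReal.ofReal_mul (by positivity), ENNReal.ofReal_add (by positivity) (by positivity),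
    ENNReal.ofReal_mul (by positivity), ENNReal.ofReal_mul (by positivity)]
  simp [e₈, e₁₉, e₃]

end core

end SPR

end

/-! ### From clusters to a solution, and the success probability on a normalised graph. -/

noncomputable section

namespace SPR

open MeasureTheory ProbabilityTheory

variable {V : Type*} {k : ℕ}

namespace WGraph

variable {G : WGraph V} {t : Fin k ↪ V}

theorem dist_le_dist_inducedMinor (hc : G.graph.Connected) {U : Fin k → Set V} (i j : Fin k) :
    G.dist (t i) (t j) ≤ (G.inducedMinor t U).dist i j := by
  refine le_iInf₂ fun p _ => ?_
  induction p with
  | nil => simp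
  | @cons a b c h p ih =>
    rw [len_cons, ENNReal.coe_add]
    refine (dist_triangle (t a) (t b) (t c)).trans (add_le_add ?_ (ih (by simp)))
    change _ ≤ (((G.dist (t a) (t b)).toNNReal : ℝ≥0) : ℝ≥0∞)
    rw [ENNReal.coe_toNNReal (dist_ne_top hc _ _)]

theorem isSPRSolution_inducedMinor [Finite V] (hG : G.Positive) (hc : G.graph.Connected)
    {U : Fin k → Set V} (hmem : ∀ j, t j ∈ U j) (hdisj : ∀ i j, i ≠ j → Disjoint (U i) (U j))
    (hconn : ∀ j, (G.graph.induce (U j)).Connected) {α : ℝ}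
    (hα : ∀ i j, (G.inducedMinor t U).dist i j ≤ ENNReal.ofReal α * G.dist (t i) (t j)) :
    IsSPRSolution G t (G.inducedMinor t U) α := by
  refine ⟨fun e => ?_, ⟨U, hconn, hdisj, fun x y h => h.2, hmem⟩,
    fun i j => ⟨dist_le_dist_inducedMinor hc i j, hα i j⟩⟩
  induction e with
  | _ i j =>
    intro h
    have hne : i ≠ j := h.1
    exact ENNReal.toNNReal_pos (dist_pos hG (t.injective.ne hne)).ne' (dist_ne_top hc _ _)

theorem induce_connected_of_distOn {A : Set V} {u : V} (hu : u ∈ A)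
    (h : ∀ v ∈ A, G.distOn A u v ≠ ⊤) : (G.graph.induce A).Connected := by
  refine SimpleGraph.connected_iff_exists_forall_reachable _ |>.2 ⟨⟨u, hu⟩, fun ⟨v, hv⟩ => ?_⟩
  have h1 := h v hv
  simp only [distOn, ne_eq, iInf_eq_top, ENNReal.coe_ne_top, imp_false, not_forall] at h1
  obtain ⟨p, hp⟩ := h1
  exact ⟨p.induce A fun x hx => by_contra fun hxA => hp ⟨x, hx, hxA⟩⟩

end WGraph

section algorithm

variable [NeZero k] {G : WGraph V} {t : Fin k ↪ V}

/-- `HasLaw` only gives almost everywhere measurable variables, so they are replaced by measurable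
versions; pairs `(l, j)` are enumerated as `l * k + j`. -/
theorem ExpRounds.of_hasLaw {Ω : Type*} [MeasurableSpace Ω] {μ : Measure Ω}
    [IsProbabilityMeasure μ] {m : ℕ → ℝ} (hm : ∀ l, 0 < m l) {q : ℕ → Fin k → Ω → ℝ}
    (hq : ∀ l j, HasLaw (q l j) (expMeasure (1 / m l)) μ)
    (hi : iIndepFun (fun i : ℕ × Fin k => q i.1 i.2) μ) :
    ∃ Y : ℕ → Ω → ℝ, ExpRounds μ k m Y ∧
      ∀ᵐ ω ∂μ, ∀ l (j : Fin k), q l j ω = Y (l * k + j) ω := by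
  have hae : ∀ n, AEMeasurable (q (n / k) (Fin.ofNat k n)) μ := fun n => (hq _ _).aemeasurable
  refine ⟨fun n => (hae n).mk, ⟨fun n => (hae n).measurable_mk, ?_, hm, fun n => ?_⟩, ?_⟩
  · exact (hi.precomp (Nat.divModEquiv k).injective).congr fun n => (hae n).ae_eq_mk
  · rw [← Measure.map_congr (hae n).ae_eq_mk]
    exact (hq _ _).map_eq
  · filter_upwards [ae_all_iff.2 fun n => (hae n).ae_eq_mk] with ω hω l j
    rw [← hω]
    have h1 := (Nat.divModEquiv k).apply_symm_apply (l, j)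
    have h2 : (Nat.divModEquiv k).symm (l, j) = l * k + j := rfl
    rw [h2, Prod.ext_iff] at h1
    have h3 : (l * k + (j : ℕ)) / k = l := h1.1
    have h4 : Fin.ofNat k (l * k + (j : ℕ)) = j := h1.2
    rw [h3, h4]

/-- The vertices contribute at most `3000 k^4 · 3 k^(-5)` and the pairs of terminals `k^2 · k^(-3)`.
-/
theorem failure_bound_le {n : ℕ} (hn : n ≤ 3000 * k ^ 4) :
    (n : ℝ) * (Real.exp (-(8 * Real.log k)) + 2 * k * Real.exp (-(19 * Real.log k))) +
      k ^ 2 * Real.exp (-(3 * Real.log k)) ≤ 9001 / k := by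
  have hk : (1 : ℝ) ≤ k := by exact_mod_cast NeZero.one_le
  have hk0 : (0 : ℝ) < k := by linarith
  have hn' : (n : ℝ) ≤ 3000 * k ^ 4 := by exact_mod_cast hn
  have he : ∀ a : ℕ, Real.exp (-(a * Real.log k)) = ((k : ℝ) ^ a)⁻¹ := fun a => by
    rw [Real.exp_neg, Real.exp_nat_mul, Real.exp_log hk0]
  have h8 := he 8
  have h19 := he 19
  have h3 := he 3
  push_cast at h8 h19 h3
  rw [h8, h19, h3]
  have h5 : ((k : ℝ) ^ 8)⁻¹ + 2 * k * ((k : ℝ) ^ 19)⁻¹ ≤ 3 * ((k : ℝ) ^ 5)⁻¹ := by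
    have h6 : ((k : ℝ) ^ 8)⁻¹ ≤ ((k : ℝ) ^ 5)⁻¹ :=
      inv_anti₀ (by positivity) (pow_le_pow_right₀ hk (by norm_num))
    have h7 : (k : ℝ) * ((k : ℝ) ^ 19)⁻¹ = ((k : ℝ) ^ 18)⁻¹ := by field_simp
    have h8 : ((k : ℝ) ^ 18)⁻¹ ≤ ((k : ℝ) ^ 5)⁻¹ :=
      inv_anti₀ (by positivity) (pow_le_pow_right₀ hk (by norm_num))
    linarith
  calc _ ≤ 3000 * (k : ℝ) ^ 4 * (3 * ((k : ℝ) ^ 5)⁻¹) + k ^ 2 * ((k : ℝ) ^ 3)⁻¹ := by gcongr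
    _ = 9001 / k := by field_simp; norm_num

/-- With high probability, the algorithm halts and returns a solution with distortion
`O(log k)`. -/
theorem one_sub_le_measureReal_isSPRSolution [Fintype V] (hL : 1 ≤ Real.log k) (hG : G.Positive)
    (hc : G.graph.Connected) (hD : ∀ v, v ∉ Set.range t → 1 ≤ G.termDist t v)
    (hcard : Fintype.card V ≤ 3000 * k ^ 4) {Ω : Type*} [MeasurableSpace Ω] {μ : Measure Ω}
    [IsProbabilityMeasure μ] {q : ℕ → Fin k → Ω → ℝ}
    (hq : ∀ l j, HasLaw (q l j) (expMeasure (1 / (initMean k * rate k ^ l))) μ)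
    (hi : iIndepFun (fun i : ℕ × Fin k => q i.1 i.2) μ) :
    1 - 9001 / (k : ℝ) ≤ μ.real {ω | ∃ M : WGraph (Fin k),
      Returns G t (fun l j => q l j ω) M ∧ IsSPRSolution G t M (9000000 * Real.log k)} := by
  obtain ⟨Y, hY, hqY⟩ := ExpRounds.of_hasLaw (mean_pos hL) hq hi
  obtain ⟨T, hT⟩ := exists_measure_failure_le hY hL hG hc hD
  set S := {ω | ∃ M : WGraph (Fin k),
      Returns G t (fun l j => q l j ω) M ∧ IsSPRSolution G t M (9000000 * Real.log k)}
  set F := {ω | ¬ ((∀ n, 0 ≤ Y n ω) → (State.steps G t (fun n => Y n ω) (T * k)).Done ∧ ∀ i j,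
        (G.inducedMinor t (State.steps G t (fun n => Y n ω) (T * k)).cluster).dist i j ≤
          ENNReal.ofReal (9000000 * Real.log k) * G.dist (t i) (t j))}
  have hcompl : μ Sᶜ ≤ μ F := by
    refine measure_mono_ae ?_
    filter_upwards [hqY, ae_all_iff.2 hY.ae_nonneg] with ω hω hpos hS
    change ω ∈ F
    by_contra hF
    obtain ⟨hd, hdist⟩ := not_not.1 hF hpos
    have hval := State.steps_valid (t := t) hG hpos (T * k)
    refine hS ⟨_, State.returns_of_done hG hpos hω hd,
      WGraph.isSPRSolution_inducedMinor hG hc hval.mem hval.disjoint (fun j => ?_) hdist⟩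
    exact WGraph.induce_connected_of_distOn (hval.mem j) fun v hv =>
      ne_top_of_le_ne_top ENNReal.ofReal_ne_top (hval.inner j v hv)
  have h1 : μ.real Sᶜ ≤ 9001 / k :=
    ENNReal.toReal_le_of_le_ofReal (by positivity) (hcompl.trans (hT.trans
      (ENNReal.ofReal_le_ofReal (failure_bound_le hcard))))
  have h2 : 1 ≤ μ.real S + μ.real Sᶜ := by
    have := measureReal_union_le (μ := μ) S Sᶜ
    rwa [Set.union_compl_self, probReal_univ] at this
  linarith

end algorithm

end SPR

end

/-! ### Transfer of distances and minors through subdivisions and compositions. -/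

noncomputable section

namespace SPR

variable {V W : Type*} {k : ℕ}

namespace WGraph

theorem eq_cons_of_mem_edges {G : SimpleGraph V} {u v b : V} {p : G.Walk u b} (hp : p.IsPath)
    (he : s(u, v) ∈ p.edges) :
    ∃ (h : G.Adj u v) (q : G.Walk v b), p = SimpleGraph.Walk.cons h q := by
  cases p with
  | nil => simp at he
  | @cons _ c _ hadj q =>
    rw [SimpleGraph.Walk.edges_cons, List.mem_cons] at he
    rcases he with he | he
    · obtain rfl : v = c := by
        have := hadj.ne
        simp only [Sym2.eq_iff, true_and] at he
        rcases he with he | he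
        · exact he
        · exact (this he.1).elim
      exact ⟨hadj, q, rfl⟩
    · exact ((SimpleGraph.Walk.cons_isPath_iff hadj q).1 hp |>.2
        (q.fst_mem_support_of_mem_edges he)).elim

/-- On a path, an edge at the splitting vertex `u` is the last one of `p₁` or the first one of `p₂`;
the split moves across it. -/
theorem exists_split_of_mem_edges {G : WGraph V} {a b u v : V} (p₁ : G.graph.Walk a u)
    (p₂ : G.graph.Walk u b) (hp : (p₁.append p₂).IsPath) (h : s(u, v) ∈ (p₁.append p₂).edges) :
    ∃ (q₁ : G.graph.Walk a v) (q₂ : G.graph.Walk v b), q₁.append q₂ = p₁.append p₂ ∧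
      G.len q₁ ≤ G.len p₁ + G.weight s(u, v) := by
  rw [SimpleGraph.Walk.edges_append, List.mem_append] at h
  rcases h with h | h
  · obtain ⟨hadj, q, hq⟩ := eq_cons_of_mem_edges
      hp.of_append_left.reverse (v := v) (by simpa using h)
    have hp1 : p₁ = q.reverse.append (SimpleGraph.Walk.cons hadj.symm SimpleGraph.Walk.nil) := by
      rw [← p₁.reverse_reverse, hq, SimpleGraph.Walk.reverse_cons]
    refine ⟨q.reverse, SimpleGraph.Walk.cons hadj.symm p₂, ?_, ?_⟩
    · rw [hp1, ← SimpleGraph.Walk.append_assoc]; rfl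
    · rw [hp1, len_append, add_assoc]
      exact le_self_add
  · obtain ⟨hadj, q, rfl⟩ := eq_cons_of_mem_edges hp.of_append_right h
    refine ⟨p₁.append (SimpleGraph.Walk.cons hadj SimpleGraph.Walk.nil), q, ?_, ?_⟩
    · rw [← SimpleGraph.Walk.append_assoc]; rfl
    · simp

end WGraph

namespace IsSubdivision

variable {H : WGraph W} {G : WGraph V} {ι : W ↪ V}

theorem dist_le (h : IsSubdivision H G ι) (x y : W) : G.dist (ι x) (ι y) ≤ H.dist x y := by
  obtain ⟨P, -, hlen, -⟩ := h
  refine le_iInf₂ fun p _ => ?_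
  induction p with
  | nil => simp
  | @cons a b c h p ih =>
    rw [WGraph.len_cons, ENNReal.coe_add, ← hlen a b h]
    exact (WGraph.dist_triangle (ι a) (ι b) (ι c)).trans
      (add_le_add (WGraph.dist_le_len _) (ih (by simp)))

/-- A potential `f` on `G` extends the distance from `x` in `H` along the replaced edges. It rises
along an edge of `G` by at most its weight, vanishes at `ι x` and is at least `H.dist x y` at `ι y`,
so every walk between them is at least that long. -/
theorem le_dist (h : IsSubdivision H G ι) (x y : W) : H.dist x y ≤ G.dist (ι x) (ι y) := by
  obtain ⟨P, hpath, hlen, hrev, hends, hinner, -, hedge⟩ := h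
  let f : V → ℝ≥0∞ := fun v => ⨅ (a : W) (b : W) (h : H.graph.Adj a b)
    (p₁ : G.graph.Walk (ι a) v) (p₂ : G.graph.Walk v (ι b)) (_ : p₁.append p₂ = P a b h),
      (H.dist x a + G.len p₁)
  have hf : ∀ {v a b} (h : H.graph.Adj a b) (p₁ : G.graph.Walk (ι a) v)
      (p₂ : G.graph.Walk v (ι b)), p₁.append p₂ = P a b h → f v ≤ H.dist x a + G.len p₁ :=
    fun {v a b} h p₁ p₂ he => iInf_le_of_le a (iInf_le_of_le b (iInf_le_of_le h
      (iInf_le_of_le p₁ (iInf_le_of_le p₂ (iInf_le_of_le he le_rfl)))))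
  have hle : ∀ z, H.dist x z ≤ f (ι z) := by
    intro z
    refine le_iInf fun a => le_iInf fun b => le_iInf fun h => le_iInf fun p₁ => le_iInf fun p₂ =>
      le_iInf fun he => ?_
    rcases hends a b h z (by rw [← he]; simp) with rfl | rfl
    · exact le_self_add
    · have hp2 : p₂ = SimpleGraph.Walk.nil := by
        rw [SimpleGraph.Walk.eq_nil_iff_nil, ← SimpleGraph.Walk.isPath_iff_nil]
        have := hpath a z h
        rw [← he] at this
        exact this.of_append_right
      rw [hp2, SimpleGraph.Walk.append_nil] at he
      rw [he, hlen]
      refine (WGraph.dist_triangle x a z).trans (add_le_add le_rfl ?_)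
      simpa using WGraph.dist_le_len (G := H) (SimpleGraph.Walk.cons h SimpleGraph.Walk.nil)
  have hstep : ∀ {u v}, G.graph.Adj u v → f v ≤ f u + G.weight s(u, v) := by
    intro u v huv
    obtain ⟨a, b, h, he⟩ := hedge s(u, v) huv
    have hext : ∀ {a b} (h : H.graph.Adj a b) (p₁ : G.graph.Walk (ι a) u)
        (p₂ : G.graph.Walk u (ι b)), p₁.append p₂ = P a b h → s(u, v) ∈ (P a b h).edges →
        f v ≤ H.dist x a + G.len p₁ + G.weight s(u, v) := by
      intro a b h p₁ p₂ hp he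
      obtain ⟨q₁, q₂, hq, hq1⟩ := WGraph.exists_split_of_mem_edges p₁ p₂ (by rw [hp]; exact hpath _ _ _)
        (by rw [hp]; exact he)
      refine (hf h q₁ q₂ (hq.trans hp)).trans ?_
      rw [add_assoc]
      gcongr
      exact_mod_cast hq1
    have hrevmem : s(u, v) ∈ (P b a h.symm).edges := by rw [hrev]; simpa using he
    -- An old vertex may lie on many replaced edges, so the extension starts afresh from it; a new
    -- vertex lies on a single one, which therefore contains the edge `s(u, v)`.
    by_cases hu : u ∈ Set.range ι
    · obtain ⟨z, rfl⟩ := hu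
      refine le_trans ?_ (add_le_add (hle z) le_rfl)
      rcases hends a b h z ((P a b h).fst_mem_support_of_mem_edges he) with rfl | rfl
      · simpa using hext h SimpleGraph.Walk.nil (P z b h) rfl he
      · simpa using hext h.symm SimpleGraph.Walk.nil (P z a h.symm) rfl hrevmem
    · simp only [f, ENNReal.iInf_add]
      refine le_iInf fun a' => le_iInf fun b' => le_iInf fun h' => le_iInf fun p₁ =>
        le_iInf fun p₂ => le_iInf fun he' => ?_
      refine hext h' p₁ p₂ he' ?_
      have hs := hinner a b h a' b' h' u hu ((P a b h).fst_mem_support_of_mem_edges he)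
        (by rw [← he']; simp)
      rw [Sym2.eq_iff] at hs
      rcases hs with ⟨rfl, rfl⟩ | ⟨rfl, rfl⟩
      · exact he
      · exact hrevmem
  have hwalk : ∀ {u v} (p : G.graph.Walk u v), f v ≤ f u + G.len p := by
    intro u v p
    induction p with
    | nil => simp
    | cons h p ih =>
      refine ih.trans ?_
      rw [WGraph.len_cons, ENNReal.coe_add, ← add_assoc]
      gcongr
      exact hstep h
  refine le_iInf₂ fun p _ => ?_
  rcases eq_or_ne x y with rfl | hxy
  · simp
  refine (hle y).trans ((hwalk p).trans ?_)
  -- At an isolated vertex `f` would be an empty infimum, so `f (ι x) = 0` needs an edge at `ι x`.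
  have hadj : ∀ {u v} (_ : G.graph.Walk u v), u ≠ v → ∃ c, G.graph.Adj u c := by
    intro u v p huv
    cases p with
    | nil => exact (huv rfl).elim
    | cons h _ => exact ⟨_, h⟩
  obtain ⟨c, hc⟩ := hadj p (ι.injective.ne hxy)
  obtain ⟨a, b, h, he⟩ := hedge s(ι x, c) hc
  have h0 : f (ι x) = 0 := by
    rw [← nonpos_iff_eq_zero]
    rcases hends a b h x ((P a b h).fst_mem_support_of_mem_edges he) with rfl | rfl
    · simpa using hf h SimpleGraph.Walk.nil (P x b h) rfl
    · simpa using hf h.symm SimpleGraph.Walk.nil (P x a h.symm) rfl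
  rw [h0, zero_add]

theorem dist_eq (h : IsSubdivision H G ι) (x y : W) : G.dist (ι x) (ι y) = H.dist x y :=
  le_antisymm (h.dist_le x y) (h.le_dist x y)

theorem connected (h : IsSubdivision H G ι) (hH : H.graph.Connected) : G.graph.Connected := by
  classical
  obtain ⟨P, -, -, -, -, -, hcover, -⟩ := h
  obtain ⟨x₀⟩ := hH.nonempty
  have hreach : ∀ x, G.graph.Reachable (ι x₀) (ι x) := by
    intro x
    obtain ⟨p⟩ := hH.preconnected x₀ x
    induction p with
    | nil => exact SimpleGraph.Reachable.refl _
    | cons h p ih => exact SimpleGraph.Reachable.trans ⟨P _ _ h⟩ ih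
  refine SimpleGraph.connected_iff_exists_forall_reachable _ |>.2 ⟨ι x₀, fun v => ?_⟩
  by_cases hv : v ∈ Set.range ι
  · obtain ⟨x, rfl⟩ := hv
    exact hreach x
  · obtain ⟨x, y, h, hv⟩ := hcover v hv
    exact (hreach x).trans ⟨(P x y h).takeUntil v hv⟩

/-- Reachability in a subdivision, inside a vertex set `B`, of an old vertex `z`. -/
theorem reachable_of_walk {P : ∀ x y, H.graph.Adj x y → G.graph.Walk (ι x) (ι y)}
    (hends : ∀ x y h z, ι z ∈ (P x y h).support → z = x ∨ z = y)
    (hinner : ∀ x y h x' y' h' v, v ∉ Set.range ι → v ∈ (P x y h).support →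
      v ∈ (P x' y' h').support → s(x, y) = s(x', y'))
    (hedge : ∀ e ∈ G.graph.edgeSet, ∃ x y h, e ∈ (P x y h).edges) {B : Set V} {z : W}
    (hz : ι z ∈ B) {v w : V} (p : G.graph.Walk v w) (hw : w = ι z) (hp : ∀ x ∈ p.support, x ∈ B) :
    (∀ y (hy : ι y ∈ B), v = ι y → (H.graph.induce (ι ⁻¹' B)).Reachable ⟨y, hy⟩ ⟨z, hz⟩) ∧
      ∀ a b h, v ∈ (P a b h).support → ∃ c, (c = a ∨ c = b) ∧ ∃ hc : ι c ∈ B,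
        (H.graph.induce (ι ⁻¹' B)).Reachable ⟨c, hc⟩ ⟨z, hz⟩ := by
  have hsnd : ∀ v, (∀ y (hy : ι y ∈ B), v = ι y →
      (H.graph.induce (ι ⁻¹' B)).Reachable ⟨y, hy⟩ ⟨z, hz⟩) → v ∈ B → v ∈ Set.range ι →
      ∀ a b h, v ∈ (P a b h).support → ∃ c, (c = a ∨ c = b) ∧ ∃ hc : ι c ∈ B,
        (H.graph.induce (ι ⁻¹' B)).Reachable ⟨c, hc⟩ ⟨z, hz⟩ := by
    rintro _ h1 hB ⟨y, rfl⟩ a b h hy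
    exact ⟨y, hends a b h y hy, hB, h1 y hB rfl⟩
  induction p with
  | nil =>
    subst hw
    have h1 : ∀ y (hy : ι y ∈ B), ι z = ι y →
        (H.graph.induce (ι ⁻¹' B)).Reachable ⟨y, hy⟩ ⟨z, hz⟩ := fun y hy h => by
      obtain rfl := ι.injective h
      exact SimpleGraph.Reachable.refl _
    exact ⟨h1, hsnd _ h1 hz ⟨z, rfl⟩⟩
  | @cons v v' w hvv' p ih =>
    obtain ⟨ih1, ih2⟩ := ih hw fun x hx => hp x (by simp [hx])
    have hvB : v ∈ B := hp v (by simp)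
    obtain ⟨a', b', h', he⟩ := hedge s(v, v') hvv'
    have hv : v ∈ (P a' b' h').support := SimpleGraph.Walk.fst_mem_support_of_mem_edges _ he
    have hv' : v' ∈ (P a' b' h').support := SimpleGraph.Walk.snd_mem_support_of_mem_edges _ he
    obtain ⟨c, hc, hcB, hcr⟩ := ih2 a' b' h' hv'
    have h1 : ∀ y (hy : ι y ∈ B), v = ι y →
        (H.graph.induce (ι ⁻¹' B)).Reachable ⟨y, hy⟩ ⟨z, hz⟩ := by
      rintro y hy rfl
      by_cases hyc : y = c
      · subst hyc; exact hcr
      · have hadj : H.graph.Adj y c := by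
          rcases hends a' b' h' y hv with rfl | rfl <;> rcases hc with rfl | rfl
          · exact (hyc rfl).elim
          · exact h'
          · exact h'.symm
          · exact (hyc rfl).elim
        exact SimpleGraph.Reachable.trans (SimpleGraph.Adj.reachable
          (u := (⟨y, hy⟩ : ι ⁻¹' B)) (v := ⟨c, hcB⟩) hadj) hcr
    refine ⟨h1, ?_⟩
    by_cases hvι : v ∈ Set.range ι
    · exact hsnd v h1 hvB hvι
    · intro a b h hvab
      have hs := hinner a' b' h' a b h v hvι hv hvab
      refine ⟨c, ?_, hcB, hcr⟩
      rw [Sym2.eq_iff] at hs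
      rcases hs with ⟨rfl, rfl⟩ | ⟨rfl, rfl⟩
      · exact hc
      · exact hc.symm

/-- The branch sets are restricted to old vertices. A new vertex of a branch set is joined inside it
to an old terminal, so one end of its subdivided edge lies in the same set; this keeps connectedness
and adjacencies. -/
theorem isTerminalMinor (h : IsSubdivision H G ι) {s : Fin k ↪ W} {M : WGraph (Fin k)}
    (hM : IsTerminalMinor M (Function.Embedding.refl _) G (s.trans ι)) :
    IsTerminalMinor M (Function.Embedding.refl _) H s := by
  obtain ⟨P, -, -, -, hends, hinner, -, hedge⟩ := h
  obtain ⟨B, hconn, hdisj, hadj, hmem⟩ := hM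
  have hwalk : ∀ j, ∀ v ∈ B j, ∃ p : G.graph.Walk v (ι (s j)), ∀ x ∈ p.support, x ∈ B j := by
    intro j v hv
    obtain ⟨p⟩ := (hconn j).preconnected ⟨v, hv⟩ ⟨ι (s j), hmem j⟩
    refine ⟨p.map (SimpleGraph.Embedding.induce (B j)).toHom, fun x hx => ?_⟩
    obtain ⟨y, -, rfl⟩ := List.mem_map.1 ((SimpleGraph.Walk.support_map _ _).subst
      (motive := fun l => x ∈ l) hx)
    exact y.2
  have hkey := fun j v (hv : v ∈ B j) =>
    reachable_of_walk hends hinner hedge (hmem j) (hwalk j v hv).choose rfl (hwalk j v hv).choose_spec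
  refine ⟨fun j => ι ⁻¹' B j, fun j => ?_, fun x y hxy => (hdisj x y hxy).preimage ι,
    fun x y hxy => ?_, hmem⟩
  · refine SimpleGraph.connected_iff_exists_forall_reachable _ |>.2 ⟨⟨s j, hmem j⟩, fun ⟨z, hz⟩ => ?_⟩
    exact ((hkey j (ι z) hz).1 z hz rfl).symm
  · obtain ⟨u, hu, v, hv, huv⟩ := hadj x y hxy
    obtain ⟨a, b, hab, he⟩ := hedge s(u, v) huv
    obtain ⟨c, hc, hcB, -⟩ := (hkey x u hu).2 a b hab
      (SimpleGraph.Walk.fst_mem_support_of_mem_edges _ he)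
    obtain ⟨d, hd, hdB, -⟩ := (hkey y v hv).2 a b hab
      (SimpleGraph.Walk.snd_mem_support_of_mem_edges _ he)
    have hcd : c ≠ d := by
      rintro rfl
      exact Set.disjoint_left.1 (hdisj x y hxy.ne) hcB hdB
    refine ⟨c, hcB, d, hdB, ?_⟩
    rcases hc with rfl | rfl <;> rcases hd with rfl | rfl
    · exact (hcd rfl).elim
    · exact hab
    · exact hab.symm
    · exact (hcd rfl).elim

end IsSubdivision

theorem IsTerminalMinor.trans {U : Type*} {M : WGraph U} {r : Fin k ↪ U} {H : WGraph W}
    {s : Fin k ↪ W} {G : WGraph V} {t : Fin k ↪ V} (h₁ : IsTerminalMinor M r H s)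
    (h₂ : IsTerminalMinor H s G t) : IsTerminalMinor M r G t := by
  obtain ⟨A, hAconn, hAdisj, hAadj, hAmem⟩ := h₁
  obtain ⟨B, hBconn, hBdisj, hBadj, hBmem⟩ := h₂
  have hsub : ∀ {x} {y}, y ∈ A x → B y ⊆ ⋃ y ∈ A x, B y := fun {x} {y} hy =>
    Set.subset_biUnion_of_mem (u := fun y => B y) hy
  refine ⟨fun x => ⋃ y ∈ A x, B y, fun x => ?_, fun x x' hx => ?_, fun x x' hx => ?_, fun j => ?_⟩
  · obtain ⟨⟨y₀, hy₀⟩⟩ := (hAconn x).nonempty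
    obtain ⟨⟨v₀, hv₀⟩⟩ := (hBconn y₀).nonempty
    have hin : ∀ {y} (hy : y ∈ A x) {u v} (hu : u ∈ B y) (hv : v ∈ B y),
        (G.graph.induce (⋃ y ∈ A x, B y)).Reachable ⟨u, hsub hy hu⟩ ⟨v, hsub hy hv⟩ := by
      intro y hy u v hu hv
      exact ((hBconn y).preconnected ⟨u, hu⟩ ⟨v, hv⟩).map
        (SimpleGraph.induceHomOfLE G.graph (hsub hy)).toHom
    have hall : ∀ {y y' : A x} (p : (H.graph.induce (A x)).Walk y y') {u v} (hu : u ∈ B y)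
        (hv : v ∈ B y'), (G.graph.induce (⋃ y ∈ A x, B y)).Reachable ⟨u, hsub y.2 hu⟩
          ⟨v, hsub y'.2 hv⟩ := by
      intro y y' p
      induction p with
      | @nil y => exact fun hu hv => hin y.2 hu hv
      | @cons a b c h p ih =>
        intro u v hu hv
        obtain ⟨u', hu', v', hv', hadj⟩ := hBadj a b h
        exact (hin a.2 hu hu').trans ((SimpleGraph.Adj.reachable
          (G := G.graph.induce (⋃ y ∈ A x, B y)) (u := ⟨u', hsub a.2 hu'⟩)
          (v := ⟨v', hsub b.2 hv'⟩) hadj).trans (ih hv' hv))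
    refine SimpleGraph.connected_iff_exists_forall_reachable _ |>.2
      ⟨⟨v₀, hsub hy₀ hv₀⟩, fun ⟨v, hv⟩ => ?_⟩
    obtain ⟨y, hy, hvy⟩ := Set.mem_iUnion₂.1 hv
    obtain ⟨p⟩ := (hAconn x).preconnected ⟨y₀, hy₀⟩ ⟨y, hy⟩
    exact hall p hv₀ hvy
  · simp only [Set.disjoint_iUnion_left, Set.disjoint_iUnion_right]
    intro y hy y' hy'
    refine hBdisj _ _ ?_
    rintro rfl
    exact Set.disjoint_left.1 (hAdisj x x' hx) (by assumption) (by assumption)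
  · obtain ⟨y, hy, y', hy', hadj⟩ := hAadj x x' hx
    obtain ⟨u, hu, v, hv, huv⟩ := hBadj y y' hadj
    exact ⟨u, hsub hy hu, v, hsub hy' hv, huv⟩
  · exact hsub (hAmem j) (hBmem j)

namespace IsPreprocessing

variable {V' : Type*} [Fintype V'] {G : WGraph V} {t : Fin k ↪ V} {G' : WGraph V'}
  {t' : Fin k ↪ V'}

theorem connected (h : IsPreprocessing G t G' t') : G'.graph.Connected := by
  obtain ⟨m, H, s, ι, -, hHc, -, -, -, -, hsub, -⟩ := h
  exact hsub.connected hHc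

theorem positive (h : IsPreprocessing G t G' t') : G'.Positive := by
  obtain ⟨m, H, s, ι, -, -, -, -, -, hpos, -⟩ := h
  exact hpos

theorem card_le (h : IsPreprocessing G t G' t') : Fintype.card V' ≤ 3000 * k ^ 4 := by
  obtain ⟨m, H, s, ι, -, -, -, -, hm, -, -, -, hcard, -⟩ := h
  rcases Nat.eq_zero_or_pos k with rfl | hk
  · simp at hm hcard
    subst hm
    simpa using hcard
  have hk1 : (1 : ℝ) ≤ k := by exact_mod_cast hk
  have hch : ((k.choose 2 : ℕ) : ℝ) ≤ (k : ℝ) ^ 2 / 2 := by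
    rw [Nat.cast_choose_two]
    nlinarith
  have hch0 : (0 : ℝ) ≤ (k.choose 2 : ℕ) := Nat.cast_nonneg _
  have hlog : Real.log k ≤ k := (Real.log_le_sub_one_of_pos (by linarith)).trans (by linarith)
  have hlog0 : 0 ≤ Real.log k := Real.log_nonneg hk1
  have hm' : (m : ℝ) ≤ k + 2 * (k.choose 2 : ℝ) ^ 2 := by exact_mod_cast hm
  have h2 : ((k.choose 2 : ℕ) : ℝ) ^ 2 ≤ ((k : ℝ) ^ 2 / 2) ^ 2 := by gcongr
  have h3 : (k.choose 2 : ℝ) * (Real.log k / cw) ≤ (k : ℝ) ^ 2 / 2 * (2400 * k) := by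
    have : Real.log k / cw = 2400 * Real.log k := by rw [cw]; ring
    rw [this]
    gcongr
  have h4 : (k : ℝ) ≤ (k : ℝ) ^ 4 := le_self_pow₀ hk1 (by norm_num)
  have h5 : (k : ℝ) ^ 3 ≤ (k : ℝ) ^ 4 := pow_le_pow_right₀ hk1 (by norm_num)
  have : (Fintype.card V' : ℝ) ≤ 3000 * (k : ℝ) ^ 4 := by nlinarith
  exact_mod_cast this

theorem isSPRSolution [Finite V] (h : IsPreprocessing G t G' t') {c : ℝ≥0} (hc : 0 < c)
    {M : WGraph (Fin k)} {α : ℝ} (hM : IsSPRSolution (G'.scale c) t' M α) :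
    IsSPRSolution G t (M.scale c⁻¹) α := by
  obtain ⟨m, H, s, ι, -, -, hminor, hdist, -, -, hsub, ht, -⟩ := h
  obtain ⟨hpos, hmin, hd⟩ := hM
  have ht' : t' = s.trans ι := by ext j; exact ht j
  subst ht'
  refine ⟨hpos.scale (inv_pos.2 hc), ?_, fun i j => ?_⟩
  · have h1 : IsTerminalMinor M (Function.Embedding.refl _) G' (s.trans ι) := hmin
    exact (hsub.isTerminalMinor h1).trans hminor
  · obtain ⟨h1, h2⟩ := hd i j
    have hcc : (c⁻¹ : ℝ≥0) ≠ 0 := (inv_pos.2 hc).ne'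
    have hG : G.dist (t i) (t j) =
        ((c⁻¹ : ℝ≥0) : ℝ≥0∞) * (G'.scale c).dist (s.trans ι i) (s.trans ι j) := by
      rw [WGraph.dist_scale c hc.ne', ← mul_assoc, ← ENNReal.coe_mul, inv_mul_cancel₀ hc.ne',
        ENNReal.coe_one, one_mul, ← hdist]
      exact (hsub.dist_eq _ _).symm
    rw [WGraph.dist_scale _ hcc, hG]
    refine ⟨by gcongr, ?_⟩
    rw [mul_left_comm]
    gcongr

end IsPreprocessing

end SPR

end

/-! ### The Voronoi minor, for small numbers of terminals. -/

noncomputable section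

namespace SPR

variable {V : Type*} {k : ℕ}

namespace WGraph

variable {G : WGraph V} {t : Fin k ↪ V}

/-- The Voronoi cell of terminal `j`, where ties are broken in favour of the smaller index. -/
def voronoi (G : WGraph V) (t : Fin k ↪ V) (j : Fin k) : Set V :=
  {v | ∀ i, G.dist v (t j) ≤ G.dist v (t i) ∧ (i < j → G.dist v (t j) < G.dist v (t i))}

theorem exists_mem_voronoi [NeZero k] (v : V) : ∃ j, v ∈ G.voronoi t j := by
  classical
  have hne : (Finset.univ.filter fun j => ∀ i, G.dist v (t j) ≤ G.dist v (t i)).Nonempty := by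
    obtain ⟨j, -, hj⟩ := Finset.exists_min_image Finset.univ (fun j => G.dist v (t j))
      ⟨0, Finset.mem_univ _⟩
    exact ⟨j, by simpa using hj⟩
  have hmem := Finset.min'_mem _ hne
  rw [Finset.mem_filter] at hmem
  refine ⟨_, fun i => ⟨hmem.2 i, fun hi => lt_of_not_ge fun hle => ?_⟩⟩
  exact absurd (Finset.min'_le _ i (Finset.mem_filter.2 ⟨Finset.mem_univ i, fun l =>
    hle.trans (hmem.2 l)⟩)) (not_le.2 hi)

theorem disjoint_voronoi {i j : Fin k} (h : i ≠ j) : Disjoint (G.voronoi t i) (G.voronoi t j) := by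
  refine Set.disjoint_left.2 fun v hi hj => ?_
  rcases lt_or_gt_of_ne h with hlt | hlt
  · exact absurd ((hj i).2 hlt) (not_lt.2 (hi j).1)
  · exact absurd ((hi j).2 hlt) (not_lt.2 (hj i).1)

theorem term_mem_voronoi [Finite V] (hG : G.Positive) (j : Fin k) : t j ∈ G.voronoi t j :=
  fun i => ⟨by simp, fun hi => by simpa using dist_pos hG (t.injective.ne hi.ne')⟩

/-- Moving along a shortest path to `t j` lowers the distance to `t j` by the full edge weight and
the distance to any other terminal by no more, so weak and strict preferences persist. -/
theorem support_subset_voronoi {j : Fin k} {v w : V} (p : G.graph.Walk v w) (hw : w = t j)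
    (hp : (G.len p : ℝ≥0∞) ≤ G.dist v (t j)) (hv : v ∈ G.voronoi t j) :
    ∀ x ∈ p.support, x ∈ G.voronoi t j := by
  induction p with
  | nil => simpa using hv
  | @cons x y w h p ih =>
    have hxy : G.dist x y ≤ G.weight s(x, y) := by
      simpa using dist_le_len (G := G) (SimpleGraph.Walk.cons h SimpleGraph.Walk.nil)
    rw [len_cons, ENNReal.coe_add] at hp
    have hle : ∀ i, G.dist x (t i) ≤ G.weight s(x, y) + G.dist y (t i) := fun i =>
      (dist_triangle x y (t i)).trans (add_le_add hxy le_rfl)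
    have hyj : G.dist y (t j) ≤ G.len p := by subst hw; exact dist_le_len p
    have hge : G.weight s(x, y) + G.dist y (t j) ≤ G.dist x (t j) :=
      (add_le_add le_rfl hyj).trans hp
    have hy : y ∈ G.voronoi t j := fun i => by
      refine ⟨?_, fun hi => ?_⟩
      · exact (ENNReal.add_le_add_iff_left ENNReal.coe_ne_top).1
          ((hge.trans (hv i).1).trans (hle i))
      · exact (ENNReal.add_lt_add_iff_left ENNReal.coe_ne_top).1
          ((hge.trans_lt ((hv i).2 hi)).trans_le (hle i))
    have hp' : (G.len p : ℝ≥0∞) ≤ G.dist y (t j) :=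
      (ENNReal.add_le_add_iff_left ENNReal.coe_ne_top).1 (hp.trans (hle j))
    intro z hz
    rw [SimpleGraph.Walk.support_cons, List.mem_cons] at hz
    rcases hz with rfl | hz
    · exact hv
    · exact ih hw hp' hy z hz

theorem induce_voronoi_connected [Finite V] (hG : G.Positive) (hc : G.graph.Connected) (j : Fin k) :
    (G.graph.induce (G.voronoi t j)).Connected := by
  refine induce_connected_of_distOn (term_mem_voronoi hG j) fun v hv => ?_
  obtain ⟨p, -, hp⟩ := exists_isPath_len_eq_dist (dist_ne_top hc v (t j))
  rw [distOn_comm]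
  exact ne_top_of_le_ne_top ENNReal.coe_ne_top
    (distOn_le_len p (support_subset_voronoi p rfl hp.le hv))

/-- If an edge `x y` of a shortest path leads from cell `a` to cell `b`, then `t a` is no farther
from `x` than `t i`, and `t b` no farther from `y` than `t j`; so the edge `a b` has weight at most
`d`. These light edges, which form `K`, connect `i` to `j`, and a path has fewer than `k` edges. -/
theorem inducedMinor_voronoi_dist_le [Finite V] (hG : G.Positive) (hc : G.graph.Connected)
    (i j : Fin k) : (G.inducedMinor t (G.voronoi t)).dist i j ≤ k * G.dist (t i) (t j) := by
  classical
  have hk : NeZero k := ⟨by rintro rfl; exact i.elim0⟩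
  set d := G.dist (t i) (t j) with hd
  set M := G.inducedMinor t (G.voronoi t) with hM
  let K : SimpleGraph (Fin k) :=
    { Adj := fun a b => M.graph.Adj a b ∧ G.dist (t a) (t b) ≤ d
      symm := ⟨fun a b h => ⟨h.1.symm, by rw [dist_comm]; exact h.2⟩⟩
      loopless := ⟨fun a h => h.1.ne rfl⟩ }
  have hreach : ∀ {x w} (p : G.graph.Walk x w), w = t j → G.dist (t i) x + G.len p ≤ d →
      ∀ a, x ∈ G.voronoi t a → K.Reachable a j := by
    intro x w p
    induction p with
    | nil =>
      rintro rfl - a ha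
      by_cases haj : a = j
      · rw [haj]
      · exact (Set.disjoint_left.1 (disjoint_voronoi haj) ha (term_mem_voronoi hG j)).elim
    | @cons x y w h p ih =>
      intro hw hle a ha
      obtain ⟨b, hb⟩ := exists_mem_voronoi (G := G) (t := t) y
      rw [len_cons, ENNReal.coe_add, ← add_assoc] at hle
      have hxy : G.dist x y ≤ G.weight s(x, y) := by
        simpa using dist_le_len (G := G) (SimpleGraph.Walk.cons h SimpleGraph.Walk.nil)
      have hy : G.dist (t i) y ≤ G.dist (t i) x + G.weight s(x, y) :=
        (dist_triangle (t i) x y).trans (add_le_add le_rfl hxy)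
      refine SimpleGraph.Reachable.trans ?_ (ih hw ((add_le_add hy le_rfl).trans hle) b hb)
      by_cases hab : a = b
      · rw [hab]
      · have hadj : M.graph.Adj a b := ⟨hab, x, ha, y, hb, h⟩
        refine SimpleGraph.Adj.reachable (show K.Adj a b from ⟨hadj, ?_⟩)
        have h1 : G.dist (t a) x ≤ G.dist (t i) x := by
          rw [dist_comm, dist_comm (G := G) (u := t i)]; exact (ha i).1
        have h2 : G.dist y (t b) ≤ G.len p := by
          refine (hb j).1.trans ?_
          subst hw
          exact dist_le_len p
        exact ((dist_triangle _ x _).trans (add_le_add le_rfl (dist_triangle x y _))).trans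
          (((add_le_add h1 (add_le_add hxy h2)).trans_eq (add_assoc _ _ _).symm).trans hle)
  obtain ⟨p, -, hp⟩ := exists_isPath_len_eq_dist (dist_ne_top hc (t i) (t j))
  obtain ⟨q⟩ := hreach p rfl (by rw [hp]; simp [hd]) i (term_mem_voronoi hG i)
  have hKM : K ≤ M.graph := fun a b h => h.1
  have hlen : ∀ {a b} (q : K.Walk a b), (M.len (q.mapLe hKM) : ℝ≥0∞) ≤ q.length * d := by
    intro a b q
    induction q with
    | nil => simp
    | @cons a b c h q ih =>
      rw [show (SimpleGraph.Walk.cons h q).mapLe hKM = SimpleGraph.Walk.cons (hKM h) (q.mapLe hKM)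
        from rfl, len_cons, ENNReal.coe_add, SimpleGraph.Walk.length_cons]
      push_cast
      rw [add_mul, add_comm, one_mul]
      refine add_le_add ih ?_
      refine le_trans ?_ h.2
      exact ENNReal.coe_toNNReal_le_self
  refine (dist_le_len (q.bypass.mapLe hKM)).trans ((hlen _).trans ?_)
  have := q.bypass_isPath.length_lt
  rw [Fintype.card_fin] at this
  gcongr

theorem exists_isSPRSolution_of_le [Finite V] (hG : G.Positive) (hc : G.graph.Connected)
    {α : ℝ} (hα : 2 ≤ k → k ≤ α) : ∃ M : WGraph (Fin k), IsSPRSolution G t M α := by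
  refine ⟨_, isSPRSolution_inducedMinor hG hc (U := G.voronoi t) (term_mem_voronoi hG)
    (fun i j => disjoint_voronoi) (induce_voronoi_connected hG hc) fun i j => ?_⟩
  rcases eq_or_ne i j with rfl | hij
  · simp
  · have hk : 2 ≤ k := by
      have := Fin.val_ne_of_ne hij
      omega
    refine (inducedMinor_voronoi_dist_le hG hc i j).trans ?_
    gcongr
    rw [← ENNReal.ofReal_natCast]
    exact ENNReal.ofReal_le_ofReal (hα hk)

end WGraph

end SPR

end

/-! ### Perturbation to unique shortest paths. -/

noncomputable section

namespace SPR

variable {V : Type*} {k : ℕ}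

/-- A metric in which all shortest paths are unique, and are shortest paths of `G`. -/
structure GenericMetric (G : WGraph V) (D : V → V → ℝ) : Prop where
  self : ∀ u, D u u = 0
  pos : ∀ u v, u ≠ v → 0 < D u v
  symm : ∀ u v, D u v = D v u
  triangle : ∀ u v w, D u w ≤ D u v + D v w
  chain : ∀ u v x y, D u x + D x v = D u v → D u y + D y v = D u v → D x y = |D u x - D u y|
  exists_walk : ∀ u v, ∃ p : G.graph.Walk u v, ∀ x ∈ p.support, D u x + D x v = D u v
  dist_add : ∀ u v x, D u x + D x v = D u v → G.dist u x + G.dist x v = G.dist u v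

namespace WGraph

theorem isPath_of_len_le_dist {G : WGraph V} (hG : G.Positive) {u v : V} (p : G.graph.Walk u v)
    (hp : (G.len p : ℝ≥0∞) ≤ G.dist u v) : p.IsPath := by
  induction p with
  | nil => simp
  | @cons x y w h p ih =>
    rw [len_cons, ENNReal.coe_add] at hp
    have hxy : G.dist x y ≤ G.weight s(x, y) := by
      simpa using dist_le_len (G := G) (SimpleGraph.Walk.cons h SimpleGraph.Walk.nil)
    rw [SimpleGraph.Walk.cons_isPath_iff]
    refine ⟨ih ((ENNReal.add_le_add_iff_left ENNReal.coe_ne_top).1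
      (hp.trans ((dist_triangle x y w).trans (add_le_add hxy le_rfl)))), fun hx => ?_⟩
    obtain ⟨q, r, rfl⟩ := SimpleGraph.Walk.mem_support_iff_exists_append.1 hx
    have h1 := hp.trans (dist_le_len r)
    rw [len_append, ENNReal.coe_add] at h1
    norm_cast at h1
    have h2 := hG s(x, y) h
    have h3 : G.weight s(x, y) + G.len q + G.len r ≤ 0 + G.len r := by
      rw [zero_add, add_assoc]; exact h1
    have h4 := le_of_add_le_add_right h3
    exact absurd (le_self_add.trans h4) (not_le.2 h2)

theorem eq_of_isPath_of_edges {G : SimpleGraph V} {u v : V} {p q : G.Walk u v} (hp : p.IsPath)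
    (hq : q.IsPath) (h : ∀ e, e ∈ p.edges ↔ e ∈ q.edges) : p = q := by
  induction p with
  | nil => exact (SimpleGraph.Walk.eq_nil_iff_nil.2 (SimpleGraph.Walk.isPath_iff_nil.1 hq)).symm
  | @cons x y w hadj p ih =>
    obtain ⟨_, q', rfl⟩ := eq_cons_of_mem_edges hq ((h s(x, y)).1 (by simp))
    have hp' := (SimpleGraph.Walk.cons_isPath_iff hadj p).1 hp
    have hq' := (SimpleGraph.Walk.cons_isPath_iff _ q').1 hq
    rw [ih hp'.1 hq'.1 fun e => ?_]
    have he := h e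
    simp only [SimpleGraph.Walk.edges_cons, List.mem_cons] at he
    constructor
    · intro hm
      refine (he.1 (Or.inr hm)).resolve_left ?_
      rintro rfl
      exact hp'.2 (p.fst_mem_support_of_mem_edges hm)
    · intro hm
      refine (he.2 (Or.inr hm)).resolve_left ?_
      rintro rfl
      exact hq'.2 (q'.fst_mem_support_of_mem_edges hm)

/-- The graph with weights increased by `ε η`. -/
def perturb (G : WGraph V) (ε : ℝ≥0) (η : Sym2 V → ℝ≥0) : WGraph V where
  graph := G.graph
  weight e := G.weight e + ε * η e

variable {G : WGraph V}

theorem len_perturb (ε : ℝ≥0) (η : Sym2 V → ℝ≥0) {u v : V} (p : G.graph.Walk u v) :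
    (G.perturb ε η).len p = G.len p + ε * (p.edges.map η).sum := by
  simp [len, perturb, List.sum_map_add, List.sum_map_mul_left]

open Filter Topology in
-- Strict inequalities between the finitely many path lengths persist for small `ε` by continuity,
-- and `η` decides ties for every positive `ε`.
theorem exists_perturb [Finite V] (η : Sym2 V → ℝ≥0) : ∃ ε : ℝ≥0, 0 < ε ∧
    ∀ u v (p q : G.graph.Path u v), (G.len p.1 < G.len q.1 ∨
      (G.len p.1 = G.len q.1 ∧ (p.1.edges.map η).sum < (q.1.edges.map η).sum)) →
      (G.perturb ε η).len p.1 < (G.perturb ε η).len q.1 := by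
  classical
  have := Fintype.ofFinite V
  have h : ∀ᶠ ε : ℝ≥0 in 𝓝[>] 0, ∀ u v (p q : G.graph.Path u v), (G.len p.1 < G.len q.1 ∨
      (G.len p.1 = G.len q.1 ∧ (p.1.edges.map η).sum < (q.1.edges.map η).sum)) →
      (G.perturb ε η).len p.1 < (G.perturb ε η).len q.1 := by
    refine eventually_all.2 fun u => eventually_all.2 fun v => eventually_all.2 fun p =>
      eventually_all.2 fun q => ?_
    by_cases hpq : G.len p.1 < G.len q.1
    · have ht : ∀ p : G.graph.Path u v, Tendsto (fun ε : ℝ≥0 => (G.perturb ε η).len p.1)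
          (𝓝[>] 0) (𝓝 (G.len p.1)) := fun p => by
        simp only [len_perturb]
        have : Continuous fun ε : ℝ≥0 => G.len p.1 + ε * (p.1.edges.map η).sum := by fun_prop
        simpa using (this.tendsto 0).mono_left nhdsWithin_le_nhds
      filter_upwards [(ht p).eventually_lt (ht q) hpq] with ε hε _ using hε
    · filter_upwards [self_mem_nhdsWithin] with ε hε h
      obtain ⟨h1, h2⟩ := h.resolve_left hpq
      rw [len_perturb, len_perturb, h1]
      have : (0 : ℝ≥0) < ε := hε
      gcongr
  obtain ⟨ε, hε, h⟩ := (h.and self_mem_nhdsWithin).exists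
  exact ⟨ε, h, hε⟩

/-- With `η e` a distinct power of two for each edge, different edge sets have different sums by
uniqueness of binary expansions. So perturbed shortest paths are unique, and they remain shortest
for the original weights. -/
theorem exists_genericMetric [Finite V] (hG : G.Positive) (hc : G.graph.Connected) :
    ∃ D, GenericMetric G D := by
  classical
  have := Fintype.ofFinite V
  let idx : Sym2 V → ℕ := fun e => Fintype.equivFin (Sym2 V) e
  have hidx : Function.Injective idx := Fin.val_injective.comp (Fintype.equivFin (Sym2 V)).injective
  let η : Sym2 V → ℝ≥0 := fun e => 2 ^ idx e
  obtain ⟨ε, hε, hlex⟩ := exists_perturb (G := G) η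
  set G₂ := G.perturb ε η with hG₂
  have hpos : G₂.Positive := fun e he => add_pos_of_pos_of_nonneg (hG e he) zero_le
  have hc₂ : G₂.graph.Connected := hc
  -- shortest paths for the perturbed weights
  have hshort : ∀ {u v} (p : G.graph.Walk u v), (G₂.len p : ℝ≥0∞) ≤ G₂.dist u v →
      ∀ q : G.graph.Path u v, ¬ (G₂.len q.1 < G₂.len p) := fun {u v} p hp q hlt =>
    absurd (hp.trans (dist_le_len (G := G₂) q.1)) (not_le.2 (ENNReal.coe_lt_coe.2 hlt))
  have hdist : ∀ {u v} (p : G.graph.Walk u v), (G₂.len p : ℝ≥0∞) ≤ G₂.dist u v →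
      (G.len p : ℝ≥0∞) ≤ G.dist u v := by
    intro u v p hp
    obtain ⟨q, hq, hq'⟩ := exists_isPath_len_eq_dist (dist_ne_top hc u v)
    rw [← hq', ENNReal.coe_le_coe]
    by_contra hlt
    exact hshort p hp ⟨q, hq⟩ (hlex u v ⟨q, hq⟩ ⟨p, isPath_of_len_le_dist hpos p hp⟩
      (Or.inl (not_le.1 hlt)))
  have huniq : ∀ {u v} (p q : G.graph.Walk u v), (G₂.len p : ℝ≥0∞) ≤ G₂.dist u v →
      (G₂.len q : ℝ≥0∞) ≤ G₂.dist u v → p = q := by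
    intro u v p q hp hq
    have hpp := isPath_of_len_le_dist hpos p hp
    have hqp := isPath_of_len_le_dist hpos q hq
    have h1 : G.len p = G.len q := by
      rcases lt_trichotomy (G.len p) (G.len q) with h | h | h
      · exact (hshort q hq ⟨p, hpp⟩ (hlex u v ⟨p, hpp⟩ ⟨q, hqp⟩ (Or.inl h))).elim
      · exact h
      · exact (hshort p hp ⟨q, hqp⟩ (hlex u v ⟨q, hqp⟩ ⟨p, hpp⟩ (Or.inl h))).elim
    have h2 : (p.edges.map η).sum = (q.edges.map η).sum := by
      rcases lt_trichotomy (p.edges.map η).sum (q.edges.map η).sum with h | h | h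
      · exact (hshort q hq ⟨p, hpp⟩ (hlex u v ⟨p, hpp⟩ ⟨q, hqp⟩ (Or.inr ⟨h1, h⟩))).elim
      · exact h
      · exact (hshort p hp ⟨q, hqp⟩ (hlex u v ⟨q, hqp⟩ ⟨p, hpp⟩ (Or.inr ⟨h1.symm, h⟩))).elim
    have h3 : ∀ {p : G.graph.Walk u v}, p.IsPath → (p.edges.map η).sum =
        ((∑ i ∈ p.edges.toFinset.image idx, 2 ^ i : ℕ) : ℝ≥0) := by
      intro p hp
      rw [Finset.sum_image hidx.injOn, List.sum_toFinset _ hp.isTrail.edges_nodup]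
      simp only [η]
      rw [Nat.cast_list_sum, List.map_map]
      simp [Function.comp_def]
    rw [h3 hpp, h3 hqp, Nat.cast_inj] at h2
    have h4 := Finset.image_injective hidx (Finset.geomSum_injective le_rfl h2)
    refine eq_of_isPath_of_edges hpp hqp fun e => ?_
    rw [← List.mem_toFinset, h4, List.mem_toFinset]
  have hw : ∀ u v, ∃ p : G.graph.Walk u v, (G₂.len p : ℝ≥0∞) = G₂.dist u v := fun u v => by
    obtain ⟨p, -, hp⟩ := exists_isPath_len_eq_dist (dist_ne_top hc₂ u v)
    exact ⟨p, hp⟩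
  have happ : ∀ {u x v} (p : G.graph.Walk u x) (q : G.graph.Walk x v),
      (G₂.len (p.append q) : ℝ≥0∞) = G₂.len p + G₂.len q := fun p q => by
    rw [← ENNReal.coe_add]
    exact congrArg _ (len_append (G := G₂) p q)
  have htop : ∀ u v, G₂.dist u v ≠ ⊤ := dist_ne_top hc₂
  have htri : ∀ u v w, (G₂.dist u w).toReal ≤ (G₂.dist u v).toReal + (G₂.dist v w).toReal :=
    fun u v w => by
      rw [← ENNReal.toReal_add (htop _ _) (htop _ _)]
      exact ENNReal.toReal_mono (ENNReal.add_ne_top.2 ⟨htop _ _, htop _ _⟩) (dist_triangle u v w)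
  have hsymm : ∀ u v, (G₂.dist u v).toReal = (G₂.dist v u).toReal := fun u v => by rw [dist_comm]
  have hiff : ∀ {u v x}, (G₂.dist u x).toReal + (G₂.dist x v).toReal = (G₂.dist u v).toReal ↔
      G₂.dist u x + G₂.dist x v = G₂.dist u v := fun {u v x} => by
    rw [← ENNReal.toReal_add (htop _ _) (htop _ _), ENNReal.toReal_eq_toReal_iff'
      (ENNReal.add_ne_top.2 ⟨htop _ _, htop _ _⟩) (htop _ _)]
  have hmem : ∀ {u v x} (p : G.graph.Walk u v), (G₂.len p : ℝ≥0∞) ≤ G₂.dist u v → x ∈ p.support →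
      G₂.dist u x + G₂.dist x v = G₂.dist u v := by
    intro u v x p hp hx
    obtain ⟨q, r, rfl⟩ := SimpleGraph.Walk.mem_support_iff_exists_append.1 hx
    refine le_antisymm (le_trans ?_ hp) (dist_triangle u x v)
    rw [happ q r]
    exact add_le_add (dist_le_len (G := G₂) q) (dist_le_len (G := G₂) r)
  refine ⟨fun u v => (G₂.dist u v).toReal, fun u => by simp, fun u v h => ?_, hsymm, htri, ?_, ?_, ?_⟩
  · exact ENNReal.toReal_pos (dist_pos hpos h).ne' (htop _ _)
  · intro u v x y hx hy
    obtain ⟨p₁, hp₁⟩ := hw u x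
    obtain ⟨p₂, hp₂⟩ := hw x v
    obtain ⟨q₁, hq₁⟩ := hw u y
    obtain ⟨q₂, hq₂⟩ := hw y v
    have hp : (G₂.len (p₁.append p₂) : ℝ≥0∞) ≤ G₂.dist u v := by
      rw [happ p₁ p₂, hp₁, hp₂]; exact (hiff.1 hx).le
    have hq : (G₂.len (q₁.append q₂) : ℝ≥0∞) ≤ G₂.dist u v := by
      rw [happ q₁ q₂, hq₁, hq₂]; exact (hiff.1 hy).le
    -- The shortest paths through `x` and through `y` coincide by uniqueness.
    have hy' : y ∈ (p₁.append p₂).support := by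
      rw [huniq _ _ hp hq]; simp
    rw [SimpleGraph.Walk.mem_support_append_iff] at hy'
    rcases hy' with hy' | hy'
    · have h1 := hiff.2 (hmem p₁ hp₁.le hy')
      have h2 := hsymm x y
      have h3 : 0 ≤ (G₂.dist y x).toReal := ENNReal.toReal_nonneg
      rw [abs_of_nonneg] <;> linarith
    · have h1 := hiff.2 (hmem p₂ hp₂.le hy')
      have h3 : 0 ≤ (G₂.dist x y).toReal := ENNReal.toReal_nonneg
      rw [abs_of_nonpos] <;> linarith
  · intro u v
    obtain ⟨p, hp⟩ := hw u v
    exact ⟨p, fun x hx => hiff.2 (hmem p hp.le hx)⟩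
  · intro u v x hx
    obtain ⟨p₁, hp₁⟩ := hw u x
    obtain ⟨p₂, hp₂⟩ := hw x v
    refine le_antisymm ?_ (dist_triangle u x v)
    have hp : (G₂.len (p₁.append p₂) : ℝ≥0∞) ≤ G₂.dist u v := by
      rw [happ p₁ p₂, hp₁, hp₂]; exact (hiff.1 hx).le
    refine le_trans ?_ (hdist _ hp)
    rw [len_append, ENNReal.coe_add]
    exact add_le_add (dist_le_len p₁) (dist_le_len p₂)

end WGraph

end SPR

end

/-! ### Key vertices on the shortest paths between terminals. -/

noncomputable section

namespace SPR

variable {V : Type*} {k : ℕ}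

/-- `x` lies between `u` and `v` in the metric `D`. -/
def Btw (D : V → V → ℝ) (u x v : V) : Prop := D u x + D x v = D u v

namespace GenericMetric

variable {G : WGraph V} {D : V → V → ℝ} (hD : GenericMetric G D)

include hD

theorem nonneg (u v : V) : 0 ≤ D u v := by
  rcases eq_or_ne u v with rfl | h
  · exact (hD.self u).ge
  · exact (hD.pos u v h).le

theorem eq_of_le_zero {u v : V} (h : D u v ≤ 0) : u = v := by
  by_contra hne
  exact absurd (hD.pos u v hne) (not_lt.2 h)

theorem btw_symm {u x v : V} (h : Btw D u x v) : Btw D v x u := by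
  unfold Btw at *
  rw [hD.symm v x, hD.symm x u, hD.symm v u]
  linarith

theorem btw_left (u v : V) : Btw D u u v := by simp [Btw, hD.self]

theorem btw_right (u v : V) : Btw D u v v := by simp [Btw, hD.self]

theorem inj {u v x y : V} (hx : Btw D u x v) (hy : Btw D u y v) (h : D u x = D u y) : x = y :=
  hD.eq_of_le_zero (by rw [hD.chain u v x y hx hy, h]; simp)

/-- Betweenness on a shortest path is betweenness of the positions. -/
theorem btw_iff {u v x y w : V} (hx : Btw D u x v) (hy : Btw D u y v) (hw : Btw D u w v)
    (h : D u x ≤ D u y) : Btw D x w y ↔ D u x ≤ D u w ∧ D u w ≤ D u y := by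
  unfold Btw
  rw [hD.chain u v x w hx hw, hD.chain u v w y hw hy, hD.chain u v x y hx hy, abs_sub_comm _ (D u y),
    abs_sub_comm (D u x) (D u y), abs_of_nonneg (sub_nonneg.2 h)]
  constructor
  · intro he
    have h1 := le_abs_self (D u x - D u w)
    have h2 := neg_abs_le (D u x - D u w)
    have h3 := le_abs_self (D u y - D u w)
    have h4 := neg_abs_le (D u y - D u w)
    constructor <;> linarith
  · rintro ⟨h1, h2⟩
    rw [abs_of_nonpos (by linarith), abs_of_nonneg (by linarith)]
    linarith

theorem btw_of_btw {u v x y w : V} (hx : Btw D u x v) (hy : Btw D u y v) (hw : Btw D x w y) :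
    Btw D u w v := by
  wlog h : D u x ≤ D u y generalizing x y
  · exact this hy hx (hD.btw_symm hw) (not_le.1 h).le
  have h1 := hD.chain u v x y hx hy
  rw [abs_sub_comm, abs_of_nonneg (sub_nonneg.2 h)] at h1
  have h2 := hD.triangle u x w
  have h3 := hD.triangle w y v
  have h4 := hD.triangle u w v
  unfold Btw at *
  linarith

theorem dist_eq_add {u x v : V} (h : Btw D u x v) : G.dist u x + G.dist x v = G.dist u v :=
  hD.dist_add u v x h

end GenericMetric

/-- `z` lies on the shortest path of the pair `p` of terminals. -/
def OnPath (D : V → V → ℝ) (t : Fin k ↪ V) (p : Fin k × Fin k) (z : V) : Prop :=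
  p.1 < p.2 ∧ Btw D (t p.1) z (t p.2)

/-- A set of vertices on the shortest paths between the terminals that contains the terminals and
the ends of the intersections of two of these paths. -/
structure KeySet (D : V → V → ℝ) (t : Fin k ↪ V) (X : Finset V) : Prop where
  term_mem : ∀ j, t j ∈ X
  onPath : ∀ x ∈ X, ∃ p, OnPath D t p x
  common : ∀ p p' z, OnPath D t p z → OnPath D t p' z →
    ∃ f ∈ X, ∃ l ∈ X, OnPath D t p f ∧ OnPath D t p' f ∧ OnPath D t p l ∧ OnPath D t p' l ∧
      D (t p.1) f ≤ D (t p.1) z ∧ D (t p.1) z ≤ D (t p.1) l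

theorem card_filter_lt (k : ℕ) :
    (Finset.univ.filter fun p : Fin k × Fin k => p.1 < p.2).card = k.choose 2 := by
  rw [Finset.card_filter, Fintype.sum_prod_type_right]
  have h : ∀ j : Fin k, (∑ i : Fin k, if i < j then 1 else 0) = (j : ℕ) := fun j => by
    rw [← Finset.card_filter, ← Fin.card_Iio]
    congr 1
    ext i
    simp
  simp only [h]
  rw [Fin.sum_univ_eq_sum_range (fun i => i) k, Finset.sum_range_id, Nat.choose_two_right]

/-- For each ordered pair of intersecting terminal paths, the first and the last common vertex are
added to the terminals; there are at most `(k.choose 2) ^ 2` such pairs. -/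
theorem exists_keySet [Finite V] {G : WGraph V} {D : V → V → ℝ} (hD : GenericMetric G D)
    (hk : 2 ≤ k) (t : Fin k ↪ V) :
    ∃ X : Finset V, KeySet D t X ∧ X.card ≤ k + 2 * (k.choose 2) ^ 2 := by
  classical
  have := Fintype.ofFinite V
  let Q : Finset (Fin k × Fin k) := Finset.univ.filter fun p => p.1 < p.2
  have hQ : Q.card = k.choose 2 := card_filter_lt k
  have hends : ∀ e : (Fin k × Fin k) × (Fin k × Fin k), ∃ fl : V × V,
      (∃ z, OnPath D t e.1 z ∧ OnPath D t e.2 z) →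
        OnPath D t e.1 fl.1 ∧ OnPath D t e.2 fl.1 ∧ OnPath D t e.1 fl.2 ∧ OnPath D t e.2 fl.2 ∧
        ∀ z, OnPath D t e.1 z → OnPath D t e.2 z →
          D (t e.1.1) fl.1 ≤ D (t e.1.1) z ∧ D (t e.1.1) z ≤ D (t e.1.1) fl.2 := by
    intro e
    by_cases h : ∃ z, OnPath D t e.1 z ∧ OnPath D t e.2 z
    · have hne : (Finset.univ.filter fun z => OnPath D t e.1 z ∧ OnPath D t e.2 z).Nonempty := by
        obtain ⟨z, hz⟩ := h
        exact ⟨z, by simpa using hz⟩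
      obtain ⟨f, hf, hf'⟩ := Finset.exists_min_image _ (fun z => D (t e.1.1) z) hne
      obtain ⟨l, hl, hl'⟩ := Finset.exists_max_image _ (fun z => D (t e.1.1) z) hne
      simp only [Finset.mem_filter, Finset.mem_univ, true_and] at hf hl hf' hl'
      exact ⟨(f, l), fun _ => ⟨hf.1, hf.2, hl.1, hl.2, fun z h1 h2 =>
        ⟨hf' z ⟨h1, h2⟩, hl' z ⟨h1, h2⟩⟩⟩⟩
    · exact ⟨(t e.1.1, t e.1.1), fun h' => (h h').elim⟩
  choose fl hfl using hends
  let E := (Q ×ˢ Q).filter fun e => ∃ z, OnPath D t e.1 z ∧ OnPath D t e.2 z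
  refine ⟨Finset.univ.image t ∪ (E.image (fun e => (fl e).1) ∪ E.image fun e => (fl e).2),
    ⟨fun j => ?_, ?_, ?_⟩, ?_⟩
  · exact Finset.mem_union_left _ (Finset.mem_image_of_mem t (Finset.mem_univ j))
  · intro x hx
    simp only [Finset.mem_union, Finset.mem_image] at hx
    rcases hx with ⟨j, -, rfl⟩ | ⟨e, he, rfl⟩ | ⟨e, he, rfl⟩
    · obtain ⟨i, hi⟩ : ∃ i : Fin k, i ≠ j := by
        have : Nontrivial (Fin k) := Fin.nontrivial_iff_two_le.2 hk
        exact exists_ne j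
      rcases lt_or_gt_of_ne hi with h | h
      · exact ⟨(i, j), h, hD.btw_right _ _⟩
      · exact ⟨(j, i), h, hD.btw_left _ _⟩
    · exact ⟨e.1, (hfl e (Finset.mem_filter.1 he).2).1⟩
    · exact ⟨e.1, (hfl e (Finset.mem_filter.1 he).2).2.2.1⟩
  · intro p p' z hp hp'
    have hz : ∃ z, OnPath D t (p, p').1 z ∧ OnPath D t (p, p').2 z := ⟨z, hp, hp'⟩
    have hE : (p, p') ∈ E := by
      refine Finset.mem_filter.2 ⟨Finset.mem_product.2 ⟨?_, ?_⟩, hz⟩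
      · simpa [Q] using hp.1
      · simpa [Q] using hp'.1
    obtain ⟨h1, h2, h3, h4, h5⟩ := hfl (p, p') hz
    exact ⟨_, Finset.mem_union_right _ (Finset.mem_union_left _ (Finset.mem_image_of_mem _ hE)), _,
      Finset.mem_union_right _ (Finset.mem_union_right _ (Finset.mem_image_of_mem _ hE)),
      h1, h2, h3, h4, h5 z hp hp'⟩
  · have hE : E.card ≤ (k.choose 2) ^ 2 := by
      refine (Finset.card_filter_le _ _).trans ?_
      rw [Finset.card_product, hQ, sq]
    refine (Finset.card_union_le _ _).trans (add_le_add ?_ ((Finset.card_union_le _ _).trans ?_))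
    · exact Finset.card_image_le.trans (by simp)
    · rw [two_mul]
      exact add_le_add (Finset.card_image_le.trans hE) (Finset.card_image_le.trans hE)

/-- Two key vertices are neighbours on the shortest path between some terminals. -/
def KeyAdj (D : V → V → ℝ) (t : Fin k ↪ V) (X : Finset V) (x y : V) : Prop :=
  x ≠ y ∧ (∃ p, OnPath D t p x ∧ OnPath D t p y) ∧ ∀ z ∈ X, Btw D x z y → z = x ∨ z = y

theorem KeyAdj.symm {G : WGraph V} {D : V → V → ℝ} (hD : GenericMetric G D) {t : Fin k ↪ V}
    {X : Finset V} {x y : V} (h : KeyAdj D t X x y) : KeyAdj D t X y x := by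
  obtain ⟨h1, ⟨p, h2, h3⟩, h4⟩ := h
  exact ⟨h1.symm, ⟨p, h3, h2⟩, fun z hz hb => (h4 z hz (hD.btw_symm hb)).symm⟩

namespace KeySet

variable {G : WGraph V} {D : V → V → ℝ} (hD : GenericMetric G D) {t : Fin k ↪ V} {X : Finset V}

include hD

theorem onPath_of_btw {p : Fin k × Fin k} {x y z : V} (hx : OnPath D t p x) (hy : OnPath D t p y)
    (hz : Btw D x z y) : OnPath D t p z := ⟨hx.1, hD.btw_of_btw hx.2 hy.2 hz⟩

/-- The segment of neighbouring keys around `z` stays on every path through `z`. -/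
theorem onPath_of_keyAdj (hX : KeySet D t X) {x y z : V} (h : KeyAdj D t X x y) (hz : z ∉ X)
    (hzxy : Btw D x z y) {p' : Fin k × Fin k} (hp' : OnPath D t p' z) :
    OnPath D t p' x ∧ OnPath D t p' y := by
  obtain ⟨-, ⟨p, hx, hy⟩, hkey⟩ := h
  wlog hxy : D (t p.1) x ≤ D (t p.1) y generalizing x y
  · exact (this (hD.btw_symm hzxy) (fun z hz hb => (hkey z hz (hD.btw_symm hb)).symm) hy hx
      (not_le.1 hxy).le).symm
  have hp := onPath_of_btw hD hx hy hzxy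
  -- Around `z`, the keys `f` and `l` bound the common part of both paths. No key is strictly
  -- between `x` and `y`, so `f` is at or before `x` and `l` at or after `y`.
  obtain ⟨f, hf, l, hl, hpf, hpf', hpl, hpl', hfz, hzl⟩ := hX.common p p' z hp hp'
  have hz' := (hD.btw_iff hx.2 hy.2 hp.2 hxy).1 hzxy
  have hfx : D (t p.1) f ≤ D (t p.1) x := by
    by_contra hlt
    rcases hkey f hf ((hD.btw_iff hx.2 hy.2 hpf.2 hxy).2
      ⟨(not_le.1 hlt).le, hfz.trans hz'.2⟩) with rfl | rfl
    · exact hlt le_rfl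
    · exact hz (hD.inj hp.2 hpf.2 (le_antisymm hz'.2 hfz) ▸ hf)
  have hyl : D (t p.1) y ≤ D (t p.1) l := by
    by_contra hlt
    rcases hkey l hl ((hD.btw_iff hx.2 hy.2 hpl.2 hxy).2
      ⟨hz'.1.trans hzl, (not_le.1 hlt).le⟩) with rfl | rfl
    · exact hz (hD.inj hp.2 hpl.2 (le_antisymm hzl hz'.1) ▸ hl)
    · exact hlt le_rfl
  have hfl : D (t p.1) f ≤ D (t p.1) l := hfz.trans hzl
  exact ⟨onPath_of_btw hD hpf' hpl' ((hD.btw_iff hpf.2 hpl.2 hx.2 hfl).2 ⟨hfx, hxy.trans hyl⟩),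
    onPath_of_btw hD hpf' hpl' ((hD.btw_iff hpf.2 hpl.2 hy.2 hfl).2 ⟨hfx.trans hxy, hyl⟩)⟩

/-- A vertex that is not a key lies in at most one segment. -/
theorem keyAdj_unique (hX : KeySet D t X) {x y x' y' z : V} (hx : x ∈ X) (hy : y ∈ X)
    (hx' : x' ∈ X) (hy' : y' ∈ X) (h : KeyAdj D t X x y) (h' : KeyAdj D t X x' y') (hz : z ∉ X)
    (hzxy : Btw D x z y) (hzxy' : Btw D x' z y') : (x = x' ∧ y = y') ∨ (x = y' ∧ y = x') := by
  obtain ⟨p, hpx, hpy⟩ := h.2.1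
  have hpz := onPath_of_btw hD hpx hpy hzxy
  obtain ⟨hpx', hpy'⟩ := hX.onPath_of_keyAdj hD h' hz hzxy' hpz
  wlog hxy : D (t p.1) x ≤ D (t p.1) y generalizing x y
  · rcases this hy hx (h.symm hD) (hD.btw_symm hzxy) hpy hpx (not_le.1 hxy).le with h1 | h1
    · exact Or.inr ⟨h1.2, h1.1⟩
    · exact Or.inl ⟨h1.2, h1.1⟩
  wlog hxy' : D (t p.1) x' ≤ D (t p.1) y' generalizing x' y'
  · exact (this hy' hx' (h'.symm hD) (hD.btw_symm hzxy') hpy' hpx' (not_le.1 hxy').le).symm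
  have hz1 := (hD.btw_iff hpx.2 hpy.2 hpz.2 hxy).1 hzxy
  have hz2 := (hD.btw_iff hpx'.2 hpy'.2 hpz.2 hxy').1 hzxy'
  have hne : ∀ {w}, w ∈ X → OnPath D t p w → D (t p.1) w ≠ D (t p.1) z := fun hw hpw he =>
    hz (hD.inj hpw.2 hpz.2 he ▸ hw)
  -- All four ends now lie on one path. Neither segment contains a key strictly inside, so `x` is
  -- the last key before `z` for both segments, and `y` the first one behind it.
  have key : ∀ {x y x'}, KeyAdj D t X x y → x' ∈ X → OnPath D t p x → OnPath D t p y →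
      OnPath D t p x' → D (t p.1) x ≤ D (t p.1) z → D (t p.1) z ≤ D (t p.1) y →
      D (t p.1) x' ≤ D (t p.1) z → D (t p.1) x' ≤ D (t p.1) x := by
    intro x y x' h hx' hpx hpy hpx' h1 h2 h3
    by_contra hlt
    rcases h.2.2 x' hx' ((hD.btw_iff hpx.2 hpy.2 hpx'.2 (h1.trans h2)).2
      ⟨(not_le.1 hlt).le, h3.trans h2⟩) with rfl | rfl
    · exact hlt le_rfl
    · exact hne hx' hpx' (le_antisymm h3 h2)
  have key' : ∀ {x y y'}, KeyAdj D t X x y → y' ∈ X → OnPath D t p x → OnPath D t p y →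
      OnPath D t p y' → D (t p.1) x ≤ D (t p.1) z → D (t p.1) z ≤ D (t p.1) y →
      D (t p.1) z ≤ D (t p.1) y' → D (t p.1) y ≤ D (t p.1) y' := by
    intro x y y' h hy' hpx hpy hpy' h1 h2 h3
    by_contra hlt
    rcases h.2.2 y' hy' ((hD.btw_iff hpx.2 hpy.2 hpy'.2 (h1.trans h2)).2
      ⟨h1.trans h3, (not_le.1 hlt).le⟩) with rfl | rfl
    · exact hne hy' hpy' (le_antisymm h1 h3)
    · exact hlt le_rfl
  refine Or.inl ⟨hD.inj hpx.2 hpx'.2 (le_antisymm ?_ ?_), hD.inj hpy.2 hpy'.2 (le_antisymm ?_ ?_)⟩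
  · exact key h' hx hpx' hpy' hpx hz2.1 hz2.2 hz1.1
  · exact key h hx' hpx hpy hpx' hz1.1 hz1.2 hz2.1
  · exact key' h hy' hpx hpy hpy' hz1.1 hz1.2 hz2.2
  · exact key' h' hy hpx' hpy' hpy hz2.1 hz2.2 hz1.2

end KeySet

end SPR

end

/-! ### The skeleton on the key vertices. -/

noncomputable section

namespace SPR

variable {V : Type*} {k m : ℕ} {G : WGraph V} {D : V → V → ℝ}

/-- The graph on the key vertices in which neighbours on a shortest path between terminals are
adjacent, with the distances in `G` as weights. -/
def skeleton (hD : GenericMetric G D) (t : Fin k ↪ V) (X : Finset V) (f : Fin m ↪ V) :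
    WGraph (Fin m) where
  graph :=
    { Adj := fun a b => KeyAdj D t X (f a) (f b)
      symm := ⟨fun _ _ h => h.symm hD⟩
      loopless := ⟨fun _ h => h.1 rfl⟩ }
  weight := Sym2.lift ⟨fun a b => (G.dist (f a) (f b)).toNNReal,
    fun a b => congrArg ENNReal.toNNReal (G.dist_comm (f a) (f b))⟩

namespace skeleton

variable (hD : GenericMetric G D) {t : Fin k ↪ V} {X : Finset V} {f : Fin m ↪ V}

theorem coe_weight (hc : G.graph.Connected) (a b : Fin m) :
    ((skeleton hD t X f).weight s(a, b) : ℝ≥0∞) = G.dist (f a) (f b) :=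
  ENNReal.coe_toNNReal (WGraph.dist_ne_top hc _ _)

theorem positive [Finite V] (hG : G.Positive) (hc : G.graph.Connected) :
    (skeleton hD t X f).Positive := by
  intro e
  induction e with
  | _ a b =>
    intro h
    have hne : f a ≠ f b := h.1
    rw [← ENNReal.coe_pos, coe_weight hD hc]
    exact WGraph.dist_pos hG hne

theorem dist_le (hc : G.graph.Connected) (a b : Fin m) :
    G.dist (f a) (f b) ≤ (skeleton hD t X f).dist a b := by
  refine le_iInf₂ fun p _ => ?_
  induction p with
  | nil => simp
  | @cons a b c h p ih =>
    rw [WGraph.len_cons, ENNReal.coe_add, coe_weight hD hc]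
    exact (WGraph.dist_triangle (f a) (f b) (f c)).trans (add_le_add le_rfl (ih (by simp)))

/-- Induction on the number of keys between the ends: non-neighbours are split at a key between
them, where distances in `G` add up. -/
theorem exists_walk (hc : G.graph.Connected) (hfX : ∀ x, x ∈ X ↔ x ∈ Set.range f)
    {p : Fin k × Fin k} (a b : Fin m) (ha : OnPath D t p (f a)) (hb : OnPath D t p (f b)) :
    ∃ q : (skeleton hD t X f).graph.Walk a b,
      ((skeleton hD t X f).len q : ℝ≥0∞) ≤ G.dist (f a) (f b) ∧
        ∀ c ∈ q.support, OnPath D t p (f c) := by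
  classical
  obtain ⟨N, hN⟩ : ∃ N, (X.filter fun z => Btw D (f a) z (f b)).card = N := ⟨_, rfl⟩
  induction N using Nat.strong_induction_on generalizing a b with
  | _ N ih =>
    by_cases hab : a = b
    · subst hab
      exact ⟨SimpleGraph.Walk.nil, by simp, by simpa using ha⟩
    by_cases hadj : KeyAdj D t X (f a) (f b)
    · have hadj' : (skeleton hD t X f).graph.Adj a b := hadj
      refine ⟨SimpleGraph.Walk.cons hadj' SimpleGraph.Walk.nil, ?_, ?_⟩
      · rw [WGraph.len_cons, WGraph.len_nil, add_zero, coe_weight hD hc]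
      · intro c hc
        simp only [SimpleGraph.Walk.support_cons, SimpleGraph.Walk.support_nil, List.mem_cons,
          List.not_mem_nil, or_false] at hc
        rcases hc with rfl | rfl
        · exact ha
        · exact hb
    · have hne : f a ≠ f b := f.injective.ne hab
      obtain ⟨z, hz, hzb, hza, hzb'⟩ : ∃ z ∈ X, Btw D (f a) z (f b) ∧ z ≠ f a ∧ z ≠ f b := by
        by_contra hno
        push Not at hno
        refine hadj ⟨hne, ⟨p, ha, hb⟩, fun z hz hzb => ?_⟩
        by_cases h : z = f a
        · exact Or.inl h
        · exact Or.inr (hno z hz hzb h)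
      obtain ⟨c, rfl⟩ := (hfX z).1 hz
      have hpc := KeySet.onPath_of_btw hD ha hb hzb
      have hmono : ∀ {x y w : V}, Btw D (f a) x (f b) → Btw D (f a) y (f b) → Btw D x w y →
          Btw D (f a) w (f b) := fun hx hy hw => hD.btw_of_btw hx hy hw
      have hlt₁ : (X.filter fun z => Btw D (f a) z (f c)).card < N := by
        rw [← hN]
        refine Finset.card_lt_card (Finset.ssubset_iff_of_subset (fun w hw => ?_) |>.2
          ⟨f b, ?_, ?_⟩)
        · rw [Finset.mem_filter] at hw ⊢
          exact ⟨hw.1, hmono (hD.btw_left _ _) hzb hw.2⟩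
        · exact Finset.mem_filter.2 ⟨(hfX _).2 ⟨b, rfl⟩, hD.btw_right _ _⟩
        · rw [Finset.mem_filter]
          rintro ⟨-, h⟩
          have h2 := hD.nonneg (f b) (f c)
          have h3 := hD.symm (f b) (f c)
          unfold Btw at h hzb
          exact hzb' (hD.eq_of_le_zero (by linarith : D (f c) (f b) ≤ 0))
      have hlt₂ : (X.filter fun z => Btw D (f c) z (f b)).card < N := by
        rw [← hN]
        refine Finset.card_lt_card (Finset.ssubset_iff_of_subset (fun w hw => ?_) |>.2
          ⟨f a, ?_, ?_⟩)
        · rw [Finset.mem_filter] at hw ⊢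
          exact ⟨hw.1, hmono hzb (hD.btw_right _ _) hw.2⟩
        · exact Finset.mem_filter.2 ⟨(hfX _).2 ⟨a, rfl⟩, hD.btw_left _ _⟩
        · rw [Finset.mem_filter]
          rintro ⟨-, h⟩
          have h2 := hD.nonneg (f a) (f c)
          have h3 := hD.symm (f a) (f c)
          unfold Btw at h hzb
          exact hza (hD.eq_of_le_zero (by linarith : D (f c) (f a) ≤ 0))
      obtain ⟨q₁, hq₁, hq₁'⟩ := ih _ hlt₁ a c ha hpc rfl
      obtain ⟨q₂, hq₂, hq₂'⟩ := ih _ hlt₂ c b hpc hb rfl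
      refine ⟨q₁.append q₂, ?_, fun w hw => ?_⟩
      · rw [WGraph.len_append, ENNReal.coe_add, ← hD.dist_eq_add hzb]
        exact add_le_add hq₁ hq₂
      · rw [SimpleGraph.Walk.mem_support_append_iff] at hw
        exact hw.elim (hq₁' w) (hq₂' w)

theorem dist_eq_of_onPath (hc : G.graph.Connected) (hfX : ∀ x, x ∈ X ↔ x ∈ Set.range f)
    {p : Fin k × Fin k} {a b : Fin m} (ha : OnPath D t p (f a)) (hb : OnPath D t p (f b)) :
    (skeleton hD t X f).dist a b = G.dist (f a) (f b) := by
  obtain ⟨q, hq, -⟩ := exists_walk hD hc hfX a b ha hb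
  exact le_antisymm ((WGraph.dist_le_len q).trans hq) (dist_le hD hc a b)

include hD in
theorem onPath_term {i j : Fin k} (h : i < j) :
    OnPath D t (i, j) (t i) ∧ OnPath D t (i, j) (t j) :=
  ⟨⟨h, hD.btw_left _ _⟩, ⟨h, hD.btw_right _ _⟩⟩

include hD in
theorem exists_onPath_term {i j : Fin k} (h : i ≠ j) :
    ∃ p : Fin k × Fin k, OnPath D t p (t i) ∧ OnPath D t p (t j) ∧
      (p = (i, j) ∨ p = (j, i)) := by
  rcases lt_or_gt_of_ne h with h | h
  · exact ⟨(i, j), (onPath_term hD h).1, (onPath_term hD h).2, Or.inl rfl⟩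
  · exact ⟨(j, i), (onPath_term hD h).2, (onPath_term hD h).1, Or.inr rfl⟩

theorem dist_term (hc : G.graph.Connected) (hfX : ∀ x, x ∈ X ↔ x ∈ Set.range f)
    {s : Fin k ↪ Fin m} (hs : ∀ j, f (s j) = t j) (i j : Fin k) :
    (skeleton hD t X f).dist (s i) (s j) = G.dist (t i) (t j) := by
  rcases eq_or_ne i j with rfl | h
  · simp
  · obtain ⟨p, h1, h2, -⟩ := exists_onPath_term hD (t := t) h
    rw [← hs i] at h1
    rw [← hs j] at h2
    rw [dist_eq_of_onPath hD hc hfX h1 h2, hs, hs]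

theorem connected (hk : 2 ≤ k) (hc : G.graph.Connected) (hX : KeySet D t X)
    (hfX : ∀ x, x ∈ X ↔ x ∈ Set.range f) {s : Fin k ↪ Fin m} (hs : ∀ j, f (s j) = t j) :
    (skeleton hD t X f).graph.Connected := by
  refine SimpleGraph.connected_iff_exists_forall_reachable _ |>.2 ⟨s ⟨0, by omega⟩, fun a => ?_⟩
  obtain ⟨p, hp⟩ := hX.onPath (f a) ((hfX _).2 ⟨a, rfl⟩)
  have h1 : OnPath D t p (f (s p.1)) := by rw [hs]; exact ⟨hp.1, hD.btw_left _ _⟩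
  obtain ⟨q, -⟩ := exists_walk hD hc hfX _ a h1 hp
  refine SimpleGraph.Reachable.trans ?_ ⟨q⟩
  by_cases h : (⟨0, by omega⟩ : Fin k) = p.1
  · rw [h]
  · obtain ⟨p', h1, h2, -⟩ := exists_onPath_term hD (t := t) h
    rw [← hs] at h1 h2
    obtain ⟨q, -⟩ := exists_walk hD hc hfX _ _ h1 h2
    exact ⟨q⟩

theorem isTerminalMinor (hX : KeySet D t X) (hfX : ∀ x, x ∈ X ↔ x ∈ Set.range f)
    {s : Fin k ↪ Fin m} (hs : ∀ j, f (s j) = t j) :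
    IsTerminalMinor (skeleton hD t X f) s G t := by
  have hmem : ∀ a, f a ∈ X := fun a => (hfX _).2 ⟨a, rfl⟩
  -- The interior of a segment is given to its end with the smaller index; by `KeySet.keyAdj_unique`
  -- no vertex is given away twice.
  let B : Fin m → Set V := fun a => {z | z = f a ∨
    (z ∉ X ∧ ∃ b, KeyAdj D t X (f a) (f b) ∧ a < b ∧ Btw D (f a) z (f b))}
  have hfB : ∀ a, f a ∈ B a := fun a => Or.inl rfl
  -- the part of a segment before its last vertex
  have hseg : ∀ {a b}, KeyAdj D t X (f a) (f b) → a < b → ∀ {w}, Btw D (f a) w (f b) → w ≠ f b →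
      w ∈ B a := by
    intro a b h hab w hw hwb
    by_cases hwX : w ∈ X
    · exact Or.inl ((h.2.2 w hwX hw).resolve_right hwb)
    · exact Or.inr ⟨hwX, b, h, hab, hw⟩
  refine ⟨B, fun a => ?_, fun a a' haa' => ?_, ?_, fun j => ?_⟩
  · refine SimpleGraph.connected_iff_exists_forall_reachable _ |>.2 ⟨⟨f a, hfB a⟩, fun ⟨z, hz⟩ => ?_⟩
    rcases id hz with rfl | ⟨hzX, b, h, hab, hzb⟩
    · exact SimpleGraph.Reachable.refl _
    · obtain ⟨p, hp⟩ := hD.exists_walk (f a) z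
      refine ⟨p.induce (B a) fun x hx => ?_⟩
      have hx' := hp x hx
      refine hseg h hab (hD.btw_of_btw (hD.btw_left _ _) hzb hx') ?_
      rintro rfl
      have h1 := hD.nonneg (f b) z
      have h2 := hD.symm (f b) z
      unfold Btw at hzb
      have h3 : z = f b := hD.eq_of_le_zero (by linarith : D z (f b) ≤ 0)
      exact hzX (h3 ▸ hmem b)
  · refine Set.disjoint_left.2 fun z hz hz' => ?_
    rcases hz with rfl | ⟨hzX, b, h, hab, hzb⟩
    · rcases hz' with h' | ⟨hzX, -⟩
      · exact haa' (f.injective h')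
      · exact hzX (hmem a)
    · rcases hz' with rfl | ⟨-, b', h', hab', hzb'⟩
      · exact hzX (hmem a')
      · rcases hX.keyAdj_unique hD (hmem a) (hmem b) (hmem a') (hmem b') h h' hzX hzb hzb' with
          h1 | h1
        · exact haa' (f.injective h1.1)
        · have e1 := f.injective h1.1
          have e2 := f.injective h1.2
          omega
  · have hadj : ∀ {a b}, KeyAdj D t X (f a) (f b) → a < b →
        ∃ u ∈ B a, ∃ v ∈ B b, G.graph.Adj u v := by
      intro a b h hab
      obtain ⟨p, hp⟩ := hD.exists_walk (f a) (f b)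
      obtain ⟨c, q, hcb, hq⟩ : ∃ (c : V) (q : G.graph.Walk (f a) c) (hcb : G.graph.Adj c (f b)),
          p = q.concat hcb := by
        have hnil : ¬ p.Nil := fun hn => h.1 hn.eq
        exact ⟨p.penultimate, p.dropLast, p.adj_penultimate hnil, (p.concat_dropLast _).symm⟩
      refine ⟨c, hseg h hab (hp c ?_) hcb.ne, f b, hfB b, hcb⟩
      rw [hq]
      simp
    intro a b h
    rcases lt_trichotomy a b with hab | rfl | hab
    · exact hadj h hab
    · exact (h.1 rfl).elim
    · obtain ⟨u, hu, v, hv, huv⟩ := hadj (KeyAdj.symm hD h) hab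
      exact ⟨v, hv, u, hu, huv.symm⟩
  · rw [← hs j]
    exact hfB _

/-- A walk along the path of `p` from before `a` to behind `b` has an edge that crosses over. Both
this edge and `s(a, b)` join keys with no key strictly between, so they coincide. -/
theorem mem_edges_of_crossing (hfX : ∀ x, x ∈ X ↔ x ∈ Set.range f) {p : Fin k × Fin k} {a b : Fin m}
    (h : KeyAdj D t X (f a) (f b)) (ha : OnPath D t p (f a)) (hb : OnPath D t p (f b))
    (hab : D (t p.1) (f a) < D (t p.1) (f b)) {c d : Fin m}
    (q : (skeleton hD t X f).graph.Walk c d) (hq : ∀ x ∈ q.support, OnPath D t p (f x))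
    (hc : D (t p.1) (f c) ≤ D (t p.1) (f a)) (hd : D (t p.1) (f b) ≤ D (t p.1) (f d)) :
    s(a, b) ∈ q.edges := by
  have hmem : ∀ a, f a ∈ X := fun a => (hfX _).2 ⟨a, rfl⟩
  induction q with
  | nil => exact absurd (hd.trans hc) (not_le.2 hab)
  | @cons c c' d hcc' q ih =>
    have hpc := hq c (by simp)
    have hpc' := hq c' (by simp)
    rw [SimpleGraph.Walk.edges_cons, List.mem_cons]
    by_cases hle : D (t p.1) (f c') ≤ D (t p.1) (f a)
    · exact Or.inr (ih (fun x hx => hq x (by simp [hx])) hle hd)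
    · left
      rw [not_le] at hle
      have hadj : KeyAdj D t X (f c) (f c') := hcc'
      have hbc' : D (t p.1) (f b) ≤ D (t p.1) (f c') := by
        by_contra hlt
        rw [not_le] at hlt
        rcases h.2.2 (f c') (hmem c')
          ((hD.btw_iff ha.2 hb.2 hpc'.2 hab.le).2 ⟨hle.le, hlt.le⟩) with h' | h'
        · rw [h'] at hle; exact lt_irrefl _ hle
        · rw [h'] at hlt; exact lt_irrefl _ hlt
      have hcc : D (t p.1) (f c) ≤ D (t p.1) (f c') := hc.trans hle.le
      have h1 : f a = f c := by
        refine (hadj.2.2 (f a) (hmem a)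
          ((hD.btw_iff hpc.2 hpc'.2 ha.2 hcc).2 ⟨hc, hle.le⟩)).resolve_right fun h' => ?_
        rw [h'] at hle
        exact lt_irrefl _ hle
      have h2 : f b = f c' := by
        refine (hadj.2.2 (f b) (hmem b)
          ((hD.btw_iff hpc.2 hpc'.2 hb.2 hcc).2 ⟨hc.trans hab.le, hbc'⟩)).resolve_left fun h' => ?_
        rw [h', h1] at hab
        exact lt_irrefl _ hab
      rw [f.injective h1, f.injective h2]

/-- The edges of the skeleton on a path between two terminals are no longer than this path. -/
theorem sum_weight_le (hc : G.graph.Connected)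
    (hfX : ∀ x, x ∈ X ↔ x ∈ Set.range f) {s : Fin k ↪ Fin m} (hs : ∀ j, f (s j) = t j)
    {p : Fin k × Fin k} (hp : p.1 < p.2) (E : Finset (Sym2 (Fin m)))
    (hE : ∀ e ∈ E, e ∈ (skeleton hD t X f).graph.edgeSet ∧ ∀ a ∈ e, OnPath D t p (f a)) :
    ((∑ e ∈ E, (skeleton hD t X f).weight e : ℝ≥0) : ℝ≥0∞) ≤ G.dist (t p.1) (t p.2) := by
  classical
  obtain ⟨q, hq, hq'⟩ := exists_walk hD hc hfX (p := p) (s p.1) (s p.2)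
    (by rw [hs]; exact (onPath_term hD hp).1) (by rw [hs]; exact (onPath_term hD hp).2)
  rw [hs, hs] at hq
  refine le_trans ?_ ((ENNReal.coe_le_coe.2 (WGraph.len_bypass_le _ q)).trans hq)
  rw [ENNReal.coe_le_coe, WGraph.len, ← List.sum_toFinset _ q.bypass_isPath.isTrail.edges_nodup]
  refine Finset.sum_le_sum_of_subset fun e he => ?_
  rw [List.mem_toFinset]
  obtain ⟨h1, h2⟩ := hE e he
  have hsub : ∀ x ∈ q.bypass.support, OnPath D t p (f x) := fun x hx =>
    hq' x (q.support_bypass_subset_support hx)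
  have hmain : ∀ {a b}, KeyAdj D t X (f a) (f b) → OnPath D t p (f a) → OnPath D t p (f b) →
      D (t p.1) (f a) < D (t p.1) (f b) → s(a, b) ∈ q.bypass.edges := by
    intro a b h ha hb hab
    refine mem_edges_of_crossing hD hfX h ha hb hab _ hsub ?_ ?_
    · rw [hs, hD.self]; exact hD.nonneg _ _
    · rw [hs]
      have := hb.2
      have := hD.nonneg (f b) (t p.2)
      unfold Btw at *
      linarith
  induction e with
  | _ a b =>
    have ha := h2 a (by simp)
    have hb := h2 b (by simp)
    have h : KeyAdj D t X (f a) (f b) := h1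
    rcases lt_trichotomy (D (t p.1) (f a)) (D (t p.1) (f b)) with hab | hab | hab
    · exact hmain h ha hb hab
    · exact (h.1 (hD.inj ha.2 hb.2 hab)).elim
    · rw [Sym2.eq_swap]
      exact hmain (h.symm hD) hb ha hab

end skeleton

end SPR

end

/-! ### Construction of subdivisions. -/

noncomputable section

namespace SPR

namespace Subdivide

variable {W : Type*} [LinearOrder W] (n : Sym2 W → ℕ)

/-- The vertices of the path of length `n s(x, y)` that replaces the edge `s(x, y)`. -/
def pt (x y : W) (l : ℕ) : W ⊕ (Sym2 W × ℕ) :=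
  if l = 0 then Sum.inl x else if l = n s(x, y) then Sum.inl y
    else Sum.inr (s(x, y), if x < y then l else n s(x, y) - l)

variable {n}

theorem pt_zero (x y : W) : pt n x y 0 = Sum.inl x := if_pos rfl

theorem pt_last (hn : ∀ e, 1 ≤ n e) (x y : W) : pt n x y (n s(x, y)) = Sum.inl y := by
  have := hn s(x, y)
  rw [pt, if_neg (by omega), if_pos rfl]

/-- Inner vertices are numbered from the smaller end, so both orientations of an edge run through
the same vertices. -/
theorem pt_symm (hn : ∀ e, 1 ≤ n e) {x y : W} (hxy : x ≠ y) {l : ℕ} (hl : l ≤ n s(x, y)) :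
    pt n y x l = pt n x y (n s(x, y) - l) := by
  have := hn s(x, y)
  unfold pt
  rw [Sym2.eq_swap (a := y)]
  rcases lt_or_gt_of_ne hxy with h | h
  · simp only [if_pos h, if_neg h.not_gt]
    split_ifs <;> first | rfl | omega
  · simp only [if_pos h, if_neg h.not_gt]
    split_ifs <;> first | rfl | omega | (congr 2; omega)

theorem pt_inj {x y : W} (hxy : x ≠ y) {l l' : ℕ} (hl : l ≤ n s(x, y)) (hl' : l' ≤ n s(x, y))
    (h : pt n x y l = pt n x y l') : l = l' := by
  unfold pt at h
  split_ifs at h <;> simp at h <;> first | omega | exact (hxy h).elim | exact (hxy h.symm).elim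

theorem eq_of_pt_eq_inl {x y z : W} {l : ℕ} (h : pt n x y l = Sum.inl z) : z = x ∨ z = y := by
  unfold pt at h
  split_ifs at h <;> simp at h <;> simp [h]

theorem eq_of_pt_eq_inr {x y : W} {l i : ℕ} {e : Sym2 W} (h : pt n x y l = Sum.inr (e, i)) :
    e = s(x, y) := by
  unfold pt at h
  split_ifs at h <;> simp at h <;> exact h.1.symm

/-- The weight of an edge of the subdivided graph whose edges `e` have been cut in pieces of weight
`w e`. -/
def wt (w : Sym2 W → ℝ≥0) : W ⊕ (Sym2 W × ℕ) → W ⊕ (Sym2 W × ℕ) → ℝ≥0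
  | Sum.inl x, Sum.inl y => w s(x, y)
  | Sum.inl _, Sum.inr e => w e.1
  | Sum.inr e, Sum.inl _ => w e.1
  | Sum.inr e, Sum.inr e' => max (w e.1) (w e'.1)

omit [LinearOrder W] in
theorem wt_symm (w : Sym2 W → ℝ≥0) (a b : W ⊕ (Sym2 W × ℕ)) : wt w a b = wt w b a := by
  rcases a with a | a <;> rcases b with b | b <;> simp [wt, Sym2.eq_swap, max_comm]

/-- Consecutive inner vertices carry the same edge label, so the maximum in `wt` serves only as a
symmetric default. -/
theorem wt_pt (w : Sym2 W → ℝ≥0) {x y : W} {l : ℕ} (hl : l < n s(x, y)) :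
    wt w (pt n x y l) (pt n x y (l + 1)) = w s(x, y) := by
  unfold pt
  rw [if_neg (Nat.succ_ne_zero l), if_neg hl.ne (α := W ⊕ (Sym2 W × ℕ))]
  split_ifs <;> simp [wt]

variable (n) in
/-- The vertices of the subdivided graph. -/
def verts [Fintype W] (H : SimpleGraph W) [Fintype H.edgeSet] : Finset (W ⊕ (Sym2 W × ℕ)) :=
  Finset.univ.disjSum (H.edgeFinset.biUnion fun e => (Finset.Ioo 0 (n e)).image fun i => (e, i))

theorem card_verts_le [Fintype W] (H : SimpleGraph W) [Fintype H.edgeSet] :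
    (verts n H).card ≤ Fintype.card W + ∑ e ∈ H.edgeFinset, (n e - 1) := by
  rw [verts, Finset.card_disjSum, Finset.card_univ]
  refine Nat.add_le_add_left (Finset.card_biUnion_le.trans (Finset.sum_le_sum fun e _ => ?_)) _
  exact Finset.card_image_le.trans (by simp)

theorem pt_mem_verts [Fintype W] {H : SimpleGraph W} [Fintype H.edgeSet] {x y : W} (h : H.Adj x y)
    {l : ℕ} (hl : l ≤ n s(x, y)) : pt n x y l ∈ verts n H := by
  unfold pt verts
  split_ifs
  · simp
  · simp
  · simp only [Finset.inr_mem_disjSum, Finset.mem_biUnion, Finset.mem_image, Finset.mem_Ioo]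
    refine ⟨s(x, y), by simpa using h, _, ?_, rfl⟩
    omega
  · simp only [Finset.inr_mem_disjSum, Finset.mem_biUnion, Finset.mem_image, Finset.mem_Ioo]
    refine ⟨s(x, y), by simpa using h, _, ?_, rfl⟩
    omega

end Subdivide

open Subdivide in
/-- Every edge `e` can be replaced by a path with `n e` edges of the same weight. -/
theorem exists_isSubdivision {W : Type*} [Fintype W] [LinearOrder W] (H : WGraph W)
    [Fintype H.graph.edgeSet] (hH : H.Positive) {n : Sym2 W → ℕ} (hn : ∀ e, 1 ≤ n e) :
    ∃ (N : ℕ) (G : WGraph (Fin N)) (ι : W ↪ Fin N), G.Positive ∧ IsSubdivision H G ι ∧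
      N ≤ Fintype.card W + ∑ e ∈ H.graph.edgeFinset, (n e - 1) ∧
      ∀ x y, H.graph.Adj x y → ∃ p : G.graph.Walk (ι x) (ι y), G.len p = H.weight s(x, y) ∧
        ∀ e ∈ p.edges, G.weight e = H.weight s(x, y) / n s(x, y) := by
  classical
  set S := verts n H.graph with hS
  let g : Fin S.card → W ⊕ (Sym2 W × ℕ) := fun a => (S.equivFin.symm a).1
  have hg : Function.Injective g := Subtype.val_injective.comp S.equivFin.symm.injective
  have hex : ∀ r ∈ S, ∃ a, g a = r := fun r hr => ⟨S.equivFin ⟨r, hr⟩, by simp [g]⟩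
  have hgS : ∀ a, g a ∈ S := fun a => (S.equivFin.symm a).2
  choose ι' hι' using fun z : W => hex (Sum.inl z) (by simp [hS, verts])
  let ι : W ↪ Fin S.card := ⟨ι', fun a b h => by
    have := congrArg g h
    rw [hι', hι'] at this
    exact Sum.inl_injective this⟩
  have hι : ∀ z, g (ι z) = Sum.inl z := hι'
  let w : Sym2 W → ℝ≥0 := fun e => H.weight e / n e
  let G : WGraph (Fin S.card) :=
    { graph :=
        { Adj := fun u v => ∃ x y l, H.graph.Adj x y ∧ l < n s(x, y) ∧ g u = pt n x y l ∧
            g v = pt n x y (l + 1)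
          symm := ⟨fun u v ⟨x, y, l, h, hl, hu, hv⟩ => by
            have h1 : n s(y, x) = n s(x, y) := by rw [Sym2.eq_swap]
            refine ⟨y, x, n s(x, y) - (l + 1), h.symm, by omega, ?_, ?_⟩
            · rw [hv, pt_symm hn h.ne (by omega)]
              congr 1; omega
            · rw [hu, pt_symm hn h.ne (by omega)]
              congr 1; omega⟩
          loopless := ⟨fun u ⟨x, y, l, h, hl, hu, hv⟩ => by
            have := pt_inj h.ne hl.le hl (hu.symm.trans hv)
            omega⟩ }
      weight := Sym2.lift ⟨fun u v => wt w (g u) (g v), fun u v => wt_symm w _ _⟩ }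
  have hGw : ∀ {x y l}, l < n s(x, y) → ∀ {u v}, g u = pt n x y l → g v = pt n x y (l + 1) →
      G.weight s(u, v) = w s(x, y) := by
    intro x y l hl u v hu hv
    change wt w (g u) (g v) = _
    rw [hu, hv, wt_pt w hl]
  -- the path that replaces an edge
  have hpath : ∀ {x y}, H.graph.Adj x y → ∀ l ≤ n s(x, y), ∃ (v : Fin S.card)
      (p : G.graph.Walk (ι x) v), g v = pt n x y l ∧
        p.support.map g = (List.range (l + 1)).map (pt n x y) ∧ G.len p = l * w s(x, y) ∧
        (∀ e ∈ p.edges, G.weight e = w s(x, y)) ∧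
        ∀ i < l, ∀ u v, g u = pt n x y i → g v = pt n x y (i + 1) → s(u, v) ∈ p.edges := by
    intro x y h l
    induction l with
    | zero =>
      intro _
      exact ⟨ι x, SimpleGraph.Walk.nil, by rw [hι, pt_zero], by simp [hι, pt_zero], by simp,
        by simp, by simp⟩
    | succ l ih =>
      intro hl
      obtain ⟨v, p, hv, hsupp, hlen, hwt, hedge⟩ := ih (by omega)
      obtain ⟨v', hv'⟩ := hex _ (pt_mem_verts h hl)
      have hadj : G.graph.Adj v v' := ⟨x, y, l, h, hl, hv, hv'⟩
      have hw : G.weight s(v, v') = w s(x, y) := hGw hl hv hv'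
      refine ⟨v', p.append (SimpleGraph.Walk.cons hadj SimpleGraph.Walk.nil), hv', ?_, ?_, ?_, ?_⟩
      · rw [SimpleGraph.Walk.support_append, List.map_append, hsupp, List.range_succ (n := l + 1),
          List.map_append]
        simp [hv']
      · rw [WGraph.len_append, WGraph.len_cons, WGraph.len_nil, hlen, hw]
        push_cast
        ring
      · intro e he
        rw [SimpleGraph.Walk.edges_append, List.mem_append] at he
        rcases he with he | he
        · exact hwt e he
        · simp only [SimpleGraph.Walk.edges_cons, SimpleGraph.Walk.edges_nil, List.mem_cons,
            List.not_mem_nil, or_false] at he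
          rw [he, hw]
      · intro i hi u u' hu hu'
        rw [SimpleGraph.Walk.edges_append, List.mem_append]
        rcases Nat.lt_succ_iff_lt_or_eq.1 hi with hi | rfl
        · exact Or.inl (hedge i hi u u' hu hu')
        · right
          rw [hg (hu.trans hv.symm), hg (hu'.trans hv'.symm)]
          simp
  have hpath' : ∀ x y (h : H.graph.Adj x y), ∃ p : G.graph.Walk (ι x) (ι y),
      p.support.map g = (List.range (n s(x, y) + 1)).map (pt n x y) ∧
        G.len p = H.weight s(x, y) ∧ (∀ e ∈ p.edges, G.weight e = w s(x, y)) ∧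
        ∀ i < n s(x, y), ∀ u v, g u = pt n x y i → g v = pt n x y (i + 1) →
          s(u, v) ∈ p.edges := by
    intro x y h
    obtain ⟨v, p, hv, hsupp, hlen, hwt, hedge⟩ := hpath h (n s(x, y)) le_rfl
    obtain rfl : v = ι y := hg (by rw [hv, hι, pt_last hn])
    refine ⟨p, hsupp, ?_, hwt, hedge⟩
    have : (n s(x, y) : ℝ≥0) ≠ 0 := by
      have := hn s(x, y)
      exact_mod_cast (by omega : n s(x, y) ≠ 0)
    rw [hlen, mul_div_cancel₀ _ this]
  choose P hsupp hlen hwt hedge using hpath'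
  have hmem : ∀ {x y h v}, v ∈ (P x y h).support → ∃ l ≤ n s(x, y), g v = pt n x y l := by
    intro x y h v hv
    have h1 := List.mem_map_of_mem (f := g) hv
    rw [hsupp, List.mem_map] at h1
    obtain ⟨l, hl, h2⟩ := h1
    exact ⟨l, by rw [List.mem_range] at hl; omega, h2.symm⟩
  have hmem' : ∀ {x y h l v}, l ≤ n s(x, y) → g v = pt n x y l → v ∈ (P x y h).support := by
    intro x y h l v hl hv
    have h1 : g v ∈ (P x y h).support.map g := by
      rw [hsupp, hv]
      exact List.mem_map_of_mem (List.mem_range.2 (by omega))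
    obtain ⟨v', hv', h2⟩ := List.mem_map.1 h1
    exact hg h2 ▸ hv'
  have hpos : ∀ {x y}, H.graph.Adj x y → 0 < w s(x, y) := by
    intro x y h
    have h1 := hn s(x, y)
    have h2 : (0 : ℝ≥0) < n s(x, y) := by exact_mod_cast h1
    exact div_pos (hH s(x, y) h) h2
  refine ⟨S.card, G, ι, ?_, ⟨P, ?_, hlen, ?_, ?_, ?_, ?_, ?_⟩, card_verts_le _,
    fun x y h => ⟨P x y h, hlen x y h, hwt x y h⟩⟩
  · intro e
    induction e with
    | _ u v =>
      rintro ⟨x, y, l, h, hl, hu, hv⟩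
      rw [hGw hl hu hv]
      exact hpos h
  · intro x y h
    rw [SimpleGraph.Walk.isPath_def]
    refine List.Nodup.of_map g ?_
    rw [hsupp]
    refine List.Nodup.map_on (fun a ha b hb hab => ?_) List.nodup_range
    rw [List.mem_range] at ha hb
    exact pt_inj h.ne (by omega) (by omega) hab
  · intro x y h
    refine SimpleGraph.Walk.ext_support (List.map_injective_iff.2 hg ?_)
    rw [hsupp, SimpleGraph.Walk.support_reverse, List.map_reverse, hsupp, Sym2.eq_swap]
    refine List.ext_getElem (by simp) fun i h1 h2 => ?_
    simp only [List.length_map, List.length_range] at h1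
    simp only [List.getElem_map, List.getElem_range, List.getElem_reverse, List.length_map,
      List.length_range]
    rw [pt_symm hn h.ne (by omega)]
    congr 1
  · intro x y h z hz
    obtain ⟨l, -, hl⟩ := hmem hz
    rw [hι] at hl
    exact eq_of_pt_eq_inl hl.symm
  · intro x y h x' y' h' v hv hv1 hv2
    obtain ⟨l, -, hl⟩ := hmem hv1
    obtain ⟨l', -, hl'⟩ := hmem hv2
    rcases hgv : g v with z | ⟨e, i⟩
    · exact (hv ⟨z, hg ((hι z).trans hgv.symm)⟩).elim
    · rw [hgv] at hl hl'
      rw [← eq_of_pt_eq_inr hl.symm, ← eq_of_pt_eq_inr hl'.symm]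
  · intro v hv
    rcases hgv : g v with z | ⟨e, i⟩
    · exact (hv ⟨z, hg ((hι z).trans hgv.symm)⟩).elim
    · have h1 := hgS v
      rw [hgv, hS, verts, Finset.inr_mem_disjSum, Finset.mem_biUnion] at h1
      obtain ⟨e', he', h2⟩ := h1
      obtain ⟨i', hi', h3⟩ := Finset.mem_image.1 h2
      obtain ⟨rfl, rfl⟩ := Prod.mk.injEq _ _ _ _ ▸ h3
      rw [Finset.mem_Ioo] at hi'
      induction e' with
      | _ x y =>
        have h : H.graph.Adj x y := by simpa using he'
        wlog hxy : x < y generalizing x y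
        · have hyx : y < x := lt_of_le_of_ne (not_lt.1 hxy) h.ne.symm
          have hs : s(x, y) = s(y, x) := Sym2.eq_swap
          exact this y x (by rw [← hs]; exact he') (by rw [← hs]; exact hi')
            (by rw [← hs]; exact hgv) (by rw [← hs]; exact h2) rfl h.symm hyx
        refine ⟨x, y, h, hmem' (l := i') hi'.2.le ?_⟩
        rw [hgv, pt, if_neg (by omega), if_neg (by omega), if_pos hxy]
  · intro e
    induction e with
    | _ u v =>
      rintro ⟨x, y, l, h, hl, hu, hv⟩
      exact ⟨x, y, h, hedge x y h l hl u v hu hv⟩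

end SPR

end

/-! ### Existence of the preprocessing and of the normalisation. -/

noncomputable section

namespace SPR

variable {V : Type*} {k : ℕ}

theorem exists_walk_of_forall_adj {W : Type*} {H : WGraph W} {G : WGraph V} {ι : W → V}
    {w : Sym2 W → ℝ≥0}
    (h : ∀ x y, H.graph.Adj x y → ∃ p : G.graph.Walk (ι x) (ι y), G.len p = H.weight s(x, y) ∧
      ∀ e ∈ p.edges, G.weight e = w s(x, y)) {a b : W} (q : H.graph.Walk a b) :
    ∃ p : G.graph.Walk (ι a) (ι b), G.len p = H.len q ∧
      ∀ e ∈ p.edges, ∃ e' ∈ q.edges, G.weight e = w e' := by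
  induction q with
  | nil => exact ⟨SimpleGraph.Walk.nil, by simp, by simp⟩
  | @cons a b c hab q ih =>
    obtain ⟨p, hp, hp'⟩ := ih
    obtain ⟨p₀, hp₀, hp₀'⟩ := h a b hab
    refine ⟨p₀.append p, by rw [WGraph.len_append, WGraph.len_cons, hp, hp₀], fun e he => ?_⟩
    rw [SimpleGraph.Walk.edges_append, List.mem_append] at he
    rcases he with he | he
    · exact ⟨s(a, b), by simp, hp₀' e he⟩
    · obtain ⟨e', he', h'⟩ := hp' e he
      exact ⟨e', by simp [he'], h'⟩

/-- The number of pieces of an edge that is long compared to the given lengths. -/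
def pieces {P : Type*} (Q : Finset P) (w : ℝ≥0) (l : P → ℝ≥0) : ℕ :=
  max 1 (Q.sup fun p => ⌈w / l p⌉₊)

theorem div_pieces_le {P : Type*} {Q : Finset P} {w : ℝ≥0} {l : P → ℝ≥0} {p : P} (hp : p ∈ Q)
    (hl : 0 < l p) : w / pieces Q w l ≤ l p := by
  have h1 : (1 : ℝ≥0) ≤ pieces Q w l := by exact_mod_cast le_max_left 1 _
  have h2 : ⌈w / l p⌉₊ ≤ pieces Q w l :=
    (Finset.le_sup (f := fun p => ⌈w / l p⌉₊) hp).trans (le_max_right _ _)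
  have h3 : w / l p ≤ pieces Q w l := (Nat.le_ceil _).trans (by exact_mod_cast h2)
  rw [div_le_iff₀ (by positivity)]
  rw [div_le_iff₀ hl, mul_comm] at h3
  exact h3

/-- The maximum is attained by one `p`, and rounding up adds less than one piece. -/
theorem pieces_sub_one_le {P : Type*} (Q : Finset P) (w : ℝ≥0) (l : P → ℝ≥0) :
    ((pieces Q w l - 1 : ℕ) : ℝ≥0) ≤ ∑ p ∈ Q, w / l p := by
  rcases Q.eq_empty_or_nonempty with rfl | hQ
  · simp [pieces]
  · obtain ⟨p, hp, hsup⟩ := Finset.exists_mem_eq_sup Q hQ fun p => ⌈w / l p⌉₊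
    refine le_trans ?_ (Finset.single_le_sum (f := fun p => w / l p) (fun _ _ => zero_le) hp)
    rw [pieces, hsup]
    have h := Nat.ceil_lt_add_one (zero_le (a := w / l p))
    rcases Nat.eq_zero_or_pos ⌈w / l p⌉₊ with h0 | h0
    · simp [h0]
    · rw [max_eq_right h0, ← add_le_add_iff_right 1]
      have h1 : ((⌈w / l p⌉₊ - 1 : ℕ) : ℝ≥0) + 1 = (⌈w / l p⌉₊ : ℝ≥0) := by
        exact_mod_cast Nat.sub_add_cancel h0
      rw [h1]
      exact h.le

/-- The preprocessing is possible. -/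
theorem exists_isPreprocessing [Finite V] {G : WGraph V} (hG : G.Positive)
    (hc : G.graph.Connected) (hk : 2 ≤ k) (t : Fin k ↪ V) :
    ∃ (n : ℕ) (G' : WGraph (Fin n)) (t' : Fin k ↪ Fin n), IsPreprocessing G t G' t' := by
  classical
  obtain ⟨D, hD⟩ := WGraph.exists_genericMetric hG hc
  obtain ⟨X, hX, hXcard⟩ := exists_keySet hD hk t
  let f : Fin X.card ↪ V := X.equivFin.symm.toEmbedding.trans (Function.Embedding.subtype _)
  have hfX : ∀ x, x ∈ X ↔ x ∈ Set.range f := by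
    intro x
    constructor
    · intro hx
      exact ⟨X.equivFin ⟨x, hx⟩, by simp [f]⟩
    · rintro ⟨a, rfl⟩
      exact (X.equivFin.symm a).2
  choose s' hs' using fun j => (hfX _).1 (hX.term_mem j)
  let s : Fin k ↪ Fin X.card := ⟨s', fun i j h => t.injective (by rw [← hs' i, ← hs' j, h])⟩
  have hs : ∀ j, f (s j) = t j := hs'
  set H := skeleton hD t X f with hH
  have hHpos : H.Positive := skeleton.positive hD hG hc
  let Q : Finset (Fin k × Fin k) := Finset.univ.filter fun p => p.1 < p.2
  let c : ℝ≥0 := (cw / Real.log k).toNNReal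
  let d : Fin k × Fin k → ℝ≥0 := fun p => (G.dist (t p.1) (t p.2)).toNNReal
  let on : Fin k × Fin k → Sym2 (Fin X.card) → Prop := fun p e => ∀ a ∈ e, OnPath D t p (f a)
  -- Each edge is cut finely enough for every pair of terminals whose shortest path contains it.
  let n : Sym2 (Fin X.card) → ℕ := fun e =>
    pieces (Q.filter fun p => on p e) (H.weight e) fun p => c * d p
  have hlog : 0 < Real.log k := Real.log_pos (by exact_mod_cast hk)
  have hcpos : 0 < c := Real.toNNReal_pos.2 (div_pos (by norm_num [cw]) hlog)
  have hdcoe : ∀ p, (d p : ℝ≥0∞) = G.dist (t p.1) (t p.2) := fun p =>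
    ENNReal.coe_toNNReal (WGraph.dist_ne_top hc _ _)
  have hdpos : ∀ p : Fin k × Fin k, p.1 < p.2 → 0 < d p := fun p hp => by
    rw [← ENNReal.coe_pos, hdcoe]
    exact WGraph.dist_pos hG (t.injective.ne hp.ne)
  obtain ⟨N, G', ι, hG', hsub, hN, hwalk⟩ := exists_isSubdivision H hHpos (n := n)
    fun e => le_max_left _ _
  refine ⟨N, G', s.trans ι, X.card, H, s, ι, hHpos, skeleton.connected hD hk hc hX hfX hs,
    skeleton.isTerminalMinor hD hX hfX hs, skeleton.dist_term hD hc hfX hs, hXcard, hG', hsub,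
    fun _ => rfl, ?_, ?_⟩
  · have h1 : ((∑ e ∈ H.graph.edgeFinset, (n e - 1) : ℕ) : ℝ≥0) ≤ (k.choose 2 : ℝ≥0) * c⁻¹ := by
      rw [Nat.cast_sum]
      calc ∑ e ∈ H.graph.edgeFinset, ((n e - 1 : ℕ) : ℝ≥0)
          ≤ ∑ e ∈ H.graph.edgeFinset, ∑ p ∈ Q.filter fun p => on p e, H.weight e / (c * d p) :=
            Finset.sum_le_sum fun e _ => pieces_sub_one_le _ _ _
        _ = ∑ p ∈ Q, ∑ e ∈ H.graph.edgeFinset.filter fun e => on p e, H.weight e / (c * d p) := by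
            simp only [Finset.sum_filter]
            rw [Finset.sum_comm]
        -- The edges on the path of `p` have total weight at most `d p`, so each pair pays for at
        -- most `c⁻¹ = log k / cw` new vertices.
        _ ≤ ∑ p ∈ Q, c⁻¹ := by
            refine Finset.sum_le_sum fun p hp => ?_
            have hp' : p.1 < p.2 := (Finset.mem_filter.1 hp).2
            rw [← Finset.sum_div, div_le_iff₀ (mul_pos hcpos (hdpos p hp')), ← mul_assoc,
              inv_mul_cancel₀ hcpos.ne', one_mul, ← ENNReal.coe_le_coe, hdcoe]
            refine skeleton.sum_weight_le hD hc hfX hs hp' _ fun e he => ?_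
            rw [Finset.mem_filter, SimpleGraph.mem_edgeFinset] at he
            exact he
        _ = _ := by rw [Finset.sum_const, card_filter_lt, nsmul_eq_mul]
    have h2 : ((c⁻¹ : ℝ≥0) : ℝ) = Real.log k / cw := by
      rw [NNReal.coe_inv, Real.coe_toNNReal _ (div_nonneg (by norm_num [cw]) hlog.le), inv_div]
    rw [Fintype.card_fin] at hN ⊢
    rw [← h2]
    have h3 : (N : ℝ≥0) ≤ (X.card : ℝ≥0) + (k.choose 2 : ℝ≥0) * c⁻¹ :=
      le_trans (by exact_mod_cast hN) (add_le_add le_rfl h1)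
    exact_mod_cast h3
  · intro i j hij
    obtain ⟨p, hpi, hpj, hp⟩ := skeleton.exists_onPath_term hD (t := t) hij
    obtain ⟨q, hq, hq'⟩ := skeleton.exists_walk hD hc hfX (s i) (s j) (by rw [hs]; exact hpi)
      (by rw [hs]; exact hpj)
    rw [hs, hs] at hq
    obtain ⟨r, hr, hr'⟩ := exists_walk_of_forall_adj (w := fun e => H.weight e / n e) hwalk q
    have hdist : G'.dist (ι (s i)) (ι (s j)) = G.dist (t i) (t j) := by
      rw [hsub.dist_eq, skeleton.dist_term hD hc hfX hs]
    have hdp : (d p : ℝ≥0∞) = G.dist (t i) (t j) := by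
      rw [hdcoe]
      rcases hp with rfl | rfl
      · rfl
      · exact G.dist_comm _ _
    refine ⟨r, le_antisymm ?_ (WGraph.dist_le_len r), fun e he => ?_⟩
    · change (G'.len r : ℝ≥0∞) ≤ G'.dist (ι (s i)) (ι (s j))
      rw [hdist, hr]
      exact hq
    · obtain ⟨e', he', hw⟩ := hr' e he
      change (G'.weight e : ℝ≥0∞) ≤ (c : ℝ≥0∞) * G'.dist (ι (s i)) (ι (s j))
      rw [hdist, hw, ← hdp, ← ENNReal.coe_mul, ENNReal.coe_le_coe]
      refine div_pieces_le (l := fun p => c * d p) (Finset.mem_filter.2 ⟨?_, ?_⟩)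
        (mul_pos hcpos (hdpos p hpi.1))
      · simpa [Q] using hpi.1
      · intro a ha
        exact hq' a (SimpleGraph.Walk.mem_support_of_mem_edges he' ha)

theorem exists_isNormalized [Finite V] [NeZero k] {G : WGraph V} (hG : G.Positive)
    (hc : G.graph.Connected) (t : Fin k ↪ V) :
    ∃ c : ℝ≥0, 0 < c ∧ (G.scale c).IsNormalized t := by
  classical
  have := Fintype.ofFinite V
  by_cases hne : (Set.range t)ᶜ.Nonempty
  · obtain ⟨v, hv, hmin⟩ := Set.exists_min_image _ (G.termDist t) (Set.toFinite _) hne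
    obtain ⟨j, hj⟩ := WGraph.exists_termDist_eq (G := G) t v
    have hpos : 0 < G.termDist t v := by
      rw [hj]
      exact WGraph.dist_pos hG fun h => hv ⟨j, h.symm⟩
    have htop : G.termDist t v ≠ ⊤ := by rw [hj]; exact WGraph.dist_ne_top hc _ _
    set a := (G.termDist t v).toNNReal with ha
    have hapos : 0 < a := ENNReal.toNNReal_pos hpos.ne' htop
    have hcoe : (a : ℝ≥0∞) = G.termDist t v := ENNReal.coe_toNNReal htop
    have hone : (1 : ℝ≥0∞) = ((a⁻¹ : ℝ≥0) : ℝ≥0∞) * G.termDist t v := by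
      rw [← hcoe, ← ENNReal.coe_mul, inv_mul_cancel₀ hapos.ne', ENNReal.coe_one]
    refine ⟨a⁻¹, inv_pos.2 hapos, fun _ => ⟨⟨v, hv, ?_⟩, ?_⟩⟩
    · rw [WGraph.termDist_scale _ _ (inv_pos.2 hapos).ne', ← hone]
    · rintro _ ⟨u, hu, rfl⟩
      rw [WGraph.termDist_scale _ _ (inv_pos.2 hapos).ne', hone]
      gcongr
      exact hmin u hu
  · exact ⟨1, one_pos, fun h => (hne h).elim⟩

end SPR

end

/-! ### Assembly. -/

noncomputable section

namespace SPR

open MeasureTheory ProbabilityTheory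

variable {V : Type*} {k : ℕ}

/-- On a preprocessed graph, the algorithm succeeds with high probability. -/
theorem IsPreprocessing.one_sub_le_measureReal [Finite V] [NeZero k] {V' : Type*} [Fintype V']
    {G : WGraph V} {t : Fin k ↪ V} {G' : WGraph V'} {t' : Fin k ↪ V'}
    (h : IsPreprocessing G t G' t') (hL : 1 ≤ Real.log k) {c : ℝ≥0} (hc : 0 < c)
    (hnorm : (G'.scale c).IsNormalized t') {Ω : Type*} [MeasurableSpace Ω] {μ : Measure Ω}
    [IsProbabilityMeasure μ] {q : ℕ → Fin k → Ω → ℝ}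
    (hq : ∀ l j, HasLaw (q l j) (expMeasure (1 / (initMean k * rate k ^ l))) μ)
    (hi : iIndepFun (fun i : ℕ × Fin k => q i.1 i.2) μ) :
    1 - 9001 / (k : ℝ) ≤ μ.real {ω | ∃ M : WGraph (Fin k),
      Returns (G'.scale c) t' (fun l j => q l j ω) M ∧
        IsSPRSolution G t (M.scale c⁻¹) (9000000 * Real.log k)} := by
  refine (one_sub_le_measureReal_isSPRSolution hL (h.positive.scale hc) h.connected
    (fun v hv => (hnorm ⟨v, hv⟩).2 ⟨v, hv, rfl⟩) h.card_le hq hi).trans ?_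
  exact measureReal_mono fun ω ⟨M, hM, hM'⟩ => ⟨M, hM, h.isSPRSolution hc hM'⟩

/-- Every weighted graph has a Steiner point removal minor with distortion `O(log k)`. -/
theorem exists_isSPRSolution [Finite V] {G : WGraph V} (hG : G.Positive) (hc : G.graph.Connected)
    (t : Fin k ↪ V) : ∃ M : WGraph (Fin k), IsSPRSolution G t M (9000000 * Real.log k) := by
  -- Up to here the bound `1 - 9001 / k` is not positive; the distortion `k` of the Voronoi minor is
  -- below `9000000 * log 2`.
  by_cases hk : k ≤ 9001
  · refine WGraph.exists_isSPRSolution_of_le hG hc fun h2 => ?_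
    have h1 : Real.log 2 ≤ Real.log k := Real.log_le_log (by norm_num) (by exact_mod_cast h2)
    have h3 : (k : ℝ) ≤ 9001 := by exact_mod_cast hk
    linarith [Real.log_two_gt_d9]
  · rw [not_le] at hk
    have : NeZero k := ⟨by omega⟩
    have hL : 1 ≤ Real.log k := one_le_log_of_three_le (by omega)
    obtain ⟨n, G', t', h⟩ := exists_isPreprocessing hG hc (by omega) t
    obtain ⟨c, hc0, hnorm⟩ := exists_isNormalized h.positive h.connected t'
    -- The increments are realised as the coordinates of an infinite product space; positive
    -- probability then yields an outcome.
    let P : ℕ × Fin k → Measure ℝ := fun i => expMeasure (1 / (initMean k * rate k ^ i.1))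
    have hP : ∀ i, IsProbabilityMeasure (P i) := fun i =>
      isProbabilityMeasure_expMeasure (one_div_pos.2 (mean_pos hL i.1))
    have hmain := h.one_sub_le_measureReal hL hc0 hnorm (μ := Measure.infinitePi P)
      (q := fun l j ω => ω (l, j))
      (fun l j => (measurePreserving_eval_infinitePi P (l, j)).hasLaw)
      (iIndepFun_infinitePi (P := P) (X := fun _ ω => ω) fun _ => measurable_id)
    have hpos : (0 : ℝ) < 1 - 9001 / k := by
      rw [sub_pos, div_lt_one (by positivity)]
      exact_mod_cast hk
    obtain ⟨ω, M, -, hM⟩ := nonempty_of_measureReal_ne_zero (hpos.trans_le hmain).ne'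
    exact ⟨_, hM⟩

end SPR

end

theorem mainTheorem1 :
    ∃ C : ℝ, 0 < C ∧
      ∀ (V : Type*) [Fintype V] (k : ℕ) (G : SPR.WGraph V) (t : Fin k ↪ V),
        G.Positive → G.graph.Connected →
        -- the algorithm, run on a preprocessed and rescaled graph, succeeds with high probability
        (2 ≤ k → ∀ (V' : Type*) [Fintype V'] (G' : SPR.WGraph V') (t' : Fin k ↪ V') (c : ℝ≥0),
          SPR.IsPreprocessing G t G' t' → 0 < c → (G'.scale c).IsNormalized t' →
          ∀ (Ω : Type*) [MeasurableSpace Ω] (μ : MeasureTheory.Measure Ω)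
            [MeasureTheory.IsProbabilityMeasure μ] (q : ℕ → Fin k → Ω → ℝ),
            (∀ l j, ProbabilityTheory.HasLaw (q l j)
              (ProbabilityTheory.expMeasure (1 / (SPR.initMean k * SPR.rate k ^ l))) μ) →
            ProbabilityTheory.iIndepFun (fun i : ℕ × Fin k => q i.1 i.2) μ →
            1 - C / k ≤ μ.real {ω | ∃ M : SPR.WGraph (Fin k),
              SPR.Returns (G'.scale c) t' (fun l j => q l j ω) M ∧
              SPR.IsSPRSolution G t (M.scale c⁻¹) (C * Real.log k)}) ∧
        -- the preprocessing is always possible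
        (2 ≤ k → ∃ (n : ℕ) (G' : SPR.WGraph (Fin n)) (t' : Fin k ↪ Fin n) (c : ℝ≥0),
          SPR.IsPreprocessing G t G' t' ∧ 0 < c ∧ (G'.scale c).IsNormalized t') ∧
        -- every weighted graph has a Steiner point removal minor with distortion `O(log k)`
        ∃ M : SPR.WGraph (Fin k), SPR.IsSPRSolution G t M (C * Real.log k) := by
  refine ⟨9000000, by norm_num, fun V _ k G t hG hc => ⟨?_, fun hk => ?_,
    SPR.exists_isSPRSolution hG hc t⟩⟩
  · intro hk V' _ G' t' c h hc0 hnorm Ω _ μ _ q hq hi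
    have hk0 : (0 : ℝ) < k := by exact_mod_cast (by omega : 0 < k)
    -- In this range `1 - C / k ≤ 0`, so nothing has to be shown; in particular `log k ≥ 1` is
    -- available in the other case.
    by_cases hlarge : k ≤ 9000000
    · refine le_trans ?_ MeasureTheory.measureReal_nonneg
      rw [sub_nonpos, one_le_div hk0]
      exact_mod_cast hlarge
    · have : NeZero k := ⟨by omega⟩
      refine le_trans ?_ (h.one_sub_le_measureReal (SPR.one_le_log_of_three_le (by omega)) hc0
        hnorm hq hi)
      gcongr
      norm_num
  · have : NeZero k := ⟨by omega⟩
    obtain ⟨n, G', t', h⟩ := SPR.exists_isPreprocessing hG hc hk t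
    obtain ⟨c, hc0, hnorm⟩ := SPR.exists_isNormalized h.positive h.connected t'
    exact ⟨n, G', t', c, h, hc0, hnorm⟩
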